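/- Let $m\ge 1$, $n\ge 0$, $N=m+n$, and let $\Omega\subset\mathbb R^m$ be open and bounded. *Graph varifolds.* Let $\mathbb G(N,m)=\{P\in\mathbb R^{N\times N}: P=P^t,\ P^2=P,\ \operatorname{tr}P=m\}$ be the Grassmannian of $m$-planes in $\mathbb R^N$. For a Sobolev map $u:\Omega\to\mathbb R^n$, which is determined only up to null sets, its graph is $$\Gamma_u=\{(x,u(x)) : x\in\Omega,\ u \text{ is approximately differentiable at } x\}\subset\mathbb R^m\times\mathbb R^n ,$$ which does not depend on the representative of $u$ up to $\mathcal H^m$-null sets. Its varifold with multiplicity one $[\![\Gamma_u]\!]$ is the measure on $\mathbb R^N\times\mathbb G(N,m)$ given by $$[\![\Gamma_u]\!](f)=\int_{\Gamma_u}f(y,T_y\Gamma_u)\,d\mathcal H^m(y),$$ where $T_y\Gamma_u$ is the approximate tangent plane. For $U\subset\mathbb R^N$ open, "$[\![\Gamma_{u_j}]\!]\to[\![\Gamma_u]\!]$ in the sense of varifolds in $U$" means that all of these are rectifiable varifolds in $U$ (in particular $\mathcal H^m(\Gamma_{u_j}\cap K)<\infty$ and $\mathcal H^m(\Gamma_{u}\cap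 K)<\infty$ for each compact $K\subset U$) and that $[\![\Gamma_{u_j}]\!](f)\to[\![\Gamma_u]\!](f)$ for every $f\in C_c(U\times\mathbb G(N,m))$. *Young measures.* Let $1<p<\infty$. A sequence $v_j:\Omega\to\mathbb R^{n\times m}$ generates the Young measure $(\nu_x)_{x\in\Omega}$ if $x\mapsto\nu_x$ is a measurable family of probability measures on $\mathbb R^{n\times m}$ such that, for every continuous $f:\mathbb R^{n\times m}\to\mathbb R$ with $|f(\Lambda)|\le C(1+\|\Lambda\|^s)$ for some constant $C$ and some $s\in[1,p)$, the function $f$ is $\nu_x$-integrable for a.e. $x$, $x\mapsto\int f\,d\nu_x$ is integrable on $\Omega$, and $$\int_\Omega f(v_j)\,\eta\,dx\to\int_\Omega\Big(\int f\,d\nu_x\Big)\eta(x)\,dx\qquad\forall\eta\in C_c^\infty(\Omega).$$ **Theorem.** (i) Let $1<p<\infty$, let $u_j\rightharpoonup u$ weakly in $W^{1,p}(\Omega,\mathbb R^n)$, and let $(Du_j)_j$ generate the Young measure $(\nu_x)_{x\in\Omega}$. Suppose that $[\![\Gamma_{u_j}]\!]\to[\![\Gamma_u]\!]$ in the sense of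 varifolds in $\Omega\times\mathbb R^n$. Then $\nu_x=\delta_{Du(x)}$ for a.e. $x\in\Omega$, and $u_j\to u$ strongly in $W^{1,q}(\Omega,\mathbb R^n)$ for every $1\le q<p$. (ii) Conversely, if $u_j\to u$ strongly in $W^{1,m}(\Omega,\mathbb R^n)$, then there is a subsequence $u_{j_k}$ such that $[\![\Gamma_{u_{j_k}}]\!]\to[\![\Gamma_u]\!]$ in the sense of varifolds in $\mathbb R^N$ (hence also in $\Omega\times\mathbb R^n$). -/

import Mathlib

open MeasureTheory Filter Topology Set
open scoped ENNReal ContDiff Matrix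

noncomputable section

namespace GraphVarifold

/-- `ℝᵐ` with its Euclidean norm. -/
abbrev E (m : ℕ) : Type := EuclideanSpace ℝ (Fin m)

/-- The ambient space `ℝᴺ = ℝᵐ × ℝⁿ`, `N = m + n`, with its Euclidean norm. -/
abbrev Amb (m n : ℕ) : Type := EuclideanSpace ℝ (Fin m ⊕ Fin n)

/-- The point `(x, y)` of `ℝᵐ × ℝⁿ`. -/
def pt {m n : ℕ} (x : E m) (y : E n) : Amb m n := WithLp.toLp 2 (Sum.elim x.ofLp y.ofLp)

/-- The cylinder `Ω × ℝⁿ`. -/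
def domainCylinder {m : ℕ} (n : ℕ) (Ω : Set (E m)) : Set (Amb m n) :=
  {z | ∃ x ∈ Ω, ∃ y : E n, z = pt x y}

/-! ### Sobolev maps -/

/-- `φ ∈ C_c^∞(Ω)`. -/
def IsTestFunction {m : ℕ} (Ω : Set (E m)) (φ : E m → ℝ) : Prop :=
  ContDiff ℝ ∞ φ ∧ HasCompactSupport φ ∧ tsupport φ ⊆ Ω

/-- `Du` is the weak (distributional) differential of `u` on `Ω`. -/
def IsWeakDeriv {m n : ℕ} (Ω : Set (E m)) (u : E m → E n) (Du : E m → E m →L[ℝ] E n) : Prop :=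
  LocallyIntegrableOn u Ω ∧ LocallyIntegrableOn Du Ω ∧
    ∀ φ : E m → ℝ, IsTestFunction Ω φ → ∀ v : E m,
      ∫ x in Ω, (fderiv ℝ φ x v) • u x = -∫ x in Ω, φ x • Du x v

/-- `u ∈ W^{1,p}(Ω, ℝⁿ)` with weak differential `Du`. -/
def MemSobolev {m n : ℕ} (Ω : Set (E m)) (p : ℝ≥0∞) (u : E m → E n)
    (Du : E m → E m →L[ℝ] E n) : Prop :=
  MemLp u p (volume.restrict Ω) ∧ MemLp Du p (volume.restrict Ω) ∧ IsWeakDeriv Ω u Du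

/-- `u_j ⇀ u` weakly in `W^{1,p}(Ω, ℝⁿ)`, `1 < p < ∞`: the maps and their weak differentials
converge when tested against `L^{p'}(Ω)`, `p' = p / (p - 1)`. -/
def WeakSobolevTendsto {m n : ℕ} (Ω : Set (E m)) (p : ℝ)
    (uj : ℕ → E m → E n) (Duj : ℕ → E m → E m →L[ℝ] E n)
    (u : E m → E n) (Du : E m → E m →L[ℝ] E n) : Prop :=
  (∀ j, MemSobolev Ω (ENNReal.ofReal p) (uj j) (Duj j)) ∧
  MemSobolev Ω (ENNReal.ofReal p) u Du ∧
  ∀ g : E m → ℝ, MemLp g (ENNReal.ofReal (p / (p - 1))) (volume.restrict Ω) →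
    Tendsto (fun j => ∫ x in Ω, g x • uj j x) atTop (𝓝 (∫ x in Ω, g x • u x)) ∧
    ∀ v : E m, Tendsto (fun j => ∫ x in Ω, g x • Duj j x v) atTop (𝓝 (∫ x in Ω, g x • Du x v))

/-- `u_j → u` strongly in `W^{1,q}(Ω, ℝⁿ)`. -/
def StrongSobolevTendsto {m n : ℕ} (Ω : Set (E m)) (q : ℝ≥0∞)
    (uj : ℕ → E m → E n) (Duj : ℕ → E m → E m →L[ℝ] E n)
    (u : E m → E n) (Du : E m → E m →L[ℝ] E n) : Prop :=
  (∀ j, MemSobolev Ω q (uj j) (Duj j)) ∧ MemSobolev Ω q u Du ∧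
  Tendsto (fun j => eLpNorm (fun x => uj j x - u x) q (volume.restrict Ω)) atTop (𝓝 0) ∧
  Tendsto (fun j => eLpNorm (fun x => Duj j x - Du x) q (volume.restrict Ω)) atTop (𝓝 0)

/-! ### Young measures -/

/-- The sequence `v_j : Ω → X` generates the Young measure `(ν_x)_{x ∈ Ω}`, with respect to
continuous integrands of growth strictly less than `p`. -/
def GeneratesYoungMeasure {m : ℕ} {X : Type*} [NormedAddCommGroup X] [MeasurableSpace X]
    (Ω : Set (E m)) (p : ℝ) (v : ℕ → E m → X) (ν : E m → Measure X) : Prop :=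
  AEMeasurable ν (volume.restrict Ω) ∧
  (∀ᵐ x ∂(volume.restrict Ω), IsProbabilityMeasure (ν x)) ∧
  ∀ f : X → ℝ, Continuous f →
    (∃ C s : ℝ, 1 ≤ s ∧ s < p ∧ ∀ Λ, |f Λ| ≤ C * (1 + ‖Λ‖ ^ s)) →
    (∀ᵐ x ∂(volume.restrict Ω), Integrable f (ν x)) ∧
    Integrable (fun x => ∫ Λ, f Λ ∂(ν x)) (volume.restrict Ω) ∧
    ∀ η : E m → ℝ, IsTestFunction Ω η →
      Tendsto (fun j => ∫ x in Ω, f (v j x) * η x) atTop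
        (𝓝 (∫ x in Ω, (∫ Λ, f Λ ∂(ν x)) * η x))

/-! ### Varifolds of multiplicity one -/

/-- The Grassmannian `𝔾(m + n, m)`: `m`-planes of `ℝᵐ⁺ⁿ`, identified with the matrices of the
orthogonal projections onto them, with the topology of the space of matrices. -/
def Grass (m n : ℕ) : Type :=
  {P : Matrix (Fin m ⊕ Fin n) (Fin m ⊕ Fin n) ℝ // Pᵀ = P ∧ P * P = P ∧ P.trace = m}

instance (m n : ℕ) : TopologicalSpace (Grass m n) :=
  inferInstanceAs (TopologicalSpace
    {P : Matrix (Fin m ⊕ Fin n) (Fin m ⊕ Fin n) ℝ // Pᵀ = P ∧ P * P = P ∧ P.trace = m})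

instance (m n : ℕ) : MeasurableSpace (Grass m n) := borel _

instance (m n : ℕ) : BorelSpace (Grass m n) := ⟨rfl⟩

instance (m n : ℕ) : Nonempty (Grass m n) :=
  ⟨⟨Matrix.fromBlocks 1 0 0 0, by simp [Matrix.fromBlocks_transpose],
    by simp [Matrix.fromBlocks_multiply], by simp [Matrix.trace, Matrix.fromBlocks]⟩⟩

/-- The plane onto which `P` projects. -/
def plane {m n : ℕ} (P : Grass m n) : Set (Amb m n) := {z | P.1 *ᵥ z.ofLp = z.ofLp}

/-- The `m`-dimensional Hausdorff measure `ℋᵐ` on `ℝᵐ⁺ⁿ`, with the usual factor `ω_m / 2ᵐ`. -/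
def hausdorff (m n : ℕ) : Measure (Amb m n) :=
  (volume (Metric.ball (0 : E m) 1) / 2 ^ m) • Measure.hausdorffMeasure (m : ℝ)

/-- `P` is the approximate tangent plane of `Γ` at `y`: the rescaled sets `(Γ - y) / r` converge
to `P` as `r → 0⁺`, as measures against `C_c(ℝᵐ⁺ⁿ)`. -/
def IsApproxTangent {m n : ℕ} (Γ : Set (Amb m n)) (y : Amb m n) (P : Grass m n) : Prop :=
  ∀ f : Amb m n → ℝ, Continuous f → HasCompactSupport f →
    Tendsto (fun r : ℝ => (r ^ m)⁻¹ * ∫ z in Γ, f (r⁻¹ • (z - y)) ∂(hausdorff m n))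
      (𝓝[>] 0) (𝓝 (∫ z in plane P, f z ∂(hausdorff m n)))

/-- The approximate tangent plane `T_y Γ` (an arbitrary plane if there is none). -/
def approxTangent {m n : ℕ} (Γ : Set (Amb m n)) (y : Amb m n) : Grass m n :=
  Classical.epsilon (IsApproxTangent Γ y)

/-- The `m`-varifold `⟦Γ⟧ = (Γ, 1)`, a measure on `ℝᵐ⁺ⁿ × 𝔾(m + n, m)`:
`⟦Γ⟧(f) = ∫_Γ f(y, T_y Γ) dℋᵐ(y)`. -/
def varifold {m n : ℕ} (Γ : Set (Amb m n)) : Measure (Amb m n × Grass m n) :=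
  ((hausdorff m n).restrict Γ).map (fun y => (y, approxTangent Γ y))

/-- `⟦Γ⟧` is well defined and is a rectifiable varifold in `U`: `Γ` is `ℋᵐ`-measurable, it has
locally finite `ℋᵐ`-measure in `U`, and at `ℋᵐ`-almost all of its points it has an approximate
tangent plane, which depends measurably on the point. -/
structure IsVarifoldIn {m n : ℕ} (U : Set (Amb m n)) (Γ : Set (Amb m n)) : Prop where
  measurable : NullMeasurableSet Γ (hausdorff m n)
  finite : ∀ K : Set (Amb m n), IsCompact K → K ⊆ U → hausdorff m n (Γ ∩ K) < (⊤ : ℝ≥0∞)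
  tangent : ∀ᵐ y ∂((hausdorff m n).restrict Γ), ∃ P, IsApproxTangent Γ y P
  aemeasurable : AEMeasurable (approxTangent Γ) ((hausdorff m n).restrict Γ)

/-- `⟦Γ_j⟧ → ⟦Γ⟧` as varifolds in the open set `U`, that is, weakly-* as Radon measures
on `U × 𝔾(m + n, m)`. -/
def VarifoldTendsto {m n : ℕ} (U : Set (Amb m n)) (Γj : ℕ → Set (Amb m n))
    (Γ : Set (Amb m n)) : Prop :=
  (∀ j, IsVarifoldIn U (Γj j)) ∧ IsVarifoldIn U Γ ∧
  ∀ f : Amb m n × Grass m n → ℝ, Continuous f → HasCompactSupport f →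
    tsupport f ⊆ U ×ˢ univ →
    Tendsto (fun j => ∫ w, f w ∂(varifold (Γj j))) atTop (𝓝 (∫ w, f w ∂(varifold Γ)))

/-! ### Graphs of Sobolev maps -/

/-- `u` is approximately differentiable at `x` with approximate differential `L`. -/
def HasApproxDerivAt {m n : ℕ} (u : E m → E n) (L : E m →L[ℝ] E n) (x : E m) : Prop :=
  ∀ ε : ℝ, 0 < ε →
    Tendsto (fun r : ℝ =>
        volume {y ∈ Metric.ball x r | ε * ‖y - x‖ < ‖u y - u x - L (y - x)‖} /
          volume (Metric.ball x r))
      (𝓝[>] 0) (𝓝 0)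

/-- The graph `Γ_u` of a map `u : Ω → ℝⁿ` which, as a Sobolev map, is determined only almost
everywhere: the set of all `(x, u x)`, where `x ∈ Ω` is a point of approximate differentiability
of `u`. Changing `u` on a null set changes `Γ_u` only by an `ℋᵐ`-null set; for Lipschitz `u`
(and for the continuous representative of a `W^{1,p}` map with `p > m`) this is the
full graph up to an `ℋᵐ`-null set. -/
def sobolevGraph {m n : ℕ} (Ω : Set (E m)) (u : E m → E n) : Set (Amb m n) :=
  {z | ∃ x ∈ Ω, (∃ L, HasApproxDerivAt u L x) ∧ z = pt x (u x)}

end GraphVarifold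

end

open GraphVarifold

/-!
The proof describes the varifold of a Sobolev graph through the parametrization `x ↦ (x, u x)`:
`⟦Γ_u⟧(f) = ∫_Ω J(Du) f((x, u x), T(Du)) dx`, where `T(L)` is the graph of the linear map `L` and
`J(L)` the factor by which `x ↦ (x, L x)` scales `ℋᵐ` (`IsW11.integral_varifold`). Both halves of
the theorem are then statements about integrals over `Ω`.

*The formula.* The pull-back of `ℋᵐ` by `x ↦ (x, L x)` is a Haar measure, so `J(L)` exists by
uniqueness of Haar measures. No explicit value is needed, only that `J` is positive, continuous and
of growth `m`, which follows from the Lipschitz comparison of graphs (`jac_le_mul`). The area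
formula for a graph differentiable along a set follows by cutting the set into pieces where the
graph is nearly linear (`hausdorff_graphPt_image`). A Sobolev map is approximately differentiable
at almost every point: it is the integral of its differential along almost every segment
(`IsWeakDeriv.ae_eq_integral_segment`), and at a Lebesgue point of `Du` the averages over short
segments are close to `Du x` in the mean. Near points of the sets `slowSet u k`, which exhaust the
points of approximate differentiability, approximate differentials are differentials along the set
(`HasApproxDerivAt.hasFDerivWithinAt`), so the area formula applies (`IsW11.restrict_sobolevGraph`).
Blowing up at points that are moreover Lebesgue points of the localized Jacobian identifies the
approximate tangent plane (`IsW11.ae_isApproxTangent`), which is unique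
(`IsApproxTangent.eq_tangentProj`).

*Strong convergence implies varifold convergence.* Along a subsequence converging fast in `W^{1,m}`
there is convergence almost everywhere with `|Du_j - Du|^m` dominated by an integrable function, and
the integrands `J(Du_j) f` are dominated because `J` has growth `m`
(`StrongSobolevTendsto.exists_varifoldTendsto`).

*Varifold convergence implies strong convergence.* On planes that are not vertical, the linear map
of which the plane is the graph depends continuously on the plane (`slope`). Hence, for continuous
`W`, the quantity `min(1, |(u_j, Du_j) - W|)`, divided by `J(Du_j)` and cut off near `∂Ω`, for large
`|u_j|` and near vertical planes, is an admissible test function for varifold convergence. What is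
cut off is controlled uniformly by the `L¹` bound coming from weak convergence and the uniform
boundedness principle. With `W` close to `(u, Du)` in `L¹` this gives convergence
`(u_j, Du_j) → (u, Du)` in measure (`tendsto_integral_min_of_varifoldTendsto`), so that the Young
measure is a Dirac mass (`GeneratesYoungMeasure.ae_eq_dirac`) and, by boundedness in `W^{1,p}`, the
convergence is strong in `W^{1,q}` for `q < p` (`tendsto_eLpNorm_of_tendsto_integral_min`).
-/

open scoped NNReal

noncomputable section

namespace GraphVarifold

variable {m n : ℕ}

/-! ### The product structure of the ambient space -/

/-- The projection of `ℝᵐ × ℝⁿ` onto `ℝᵐ`. -/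
def horiz (m n : ℕ) : Amb m n →L[ℝ] E m :=
  LinearMap.toContinuousLinearMap
    { toFun := fun z => WithLp.toLp 2 fun i => z (Sum.inl i)
      map_add' := fun _ _ => rfl
      map_smul' := fun _ _ => rfl }

/-- The projection of `ℝᵐ × ℝⁿ` onto `ℝⁿ`. -/
def vert (m n : ℕ) : Amb m n →L[ℝ] E n :=
  LinearMap.toContinuousLinearMap
    { toFun := fun z => WithLp.toLp 2 fun i => z (Sum.inr i)
      map_add' := fun _ _ => rfl
      map_smul' := fun _ _ => rfl }

@[simp] lemma horiz_pt (x : E m) (y : E n) : horiz m n (pt x y) = x := rfl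

@[simp] lemma vert_pt (x : E m) (y : E n) : vert m n (pt x y) = y := rfl

lemma pt_horiz_vert (z : Amb m n) : pt (horiz m n z) (vert m n z) = z := by
  ext i
  rcases i with i | i <;> rfl

lemma pt_sub (x x' : E m) (y y' : E n) : pt x y - pt x' y' = pt (x - x') (y - y') := by
  ext i
  rcases i with i | i <;> rfl

lemma pt_smul (r : ℝ) (x : E m) (y : E n) : r • pt x y = pt (r • x) (r • y) := by
  ext i
  rcases i with i | i <;> rfl

lemma norm_pt_sq (x : E m) (y : E n) : ‖pt x y‖ ^ 2 = ‖x‖ ^ 2 + ‖y‖ ^ 2 := by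
  simp [EuclideanSpace.norm_sq_eq, pt]

lemma norm_le_norm_pt (x : E m) (y : E n) : ‖x‖ ≤ ‖pt x y‖ :=
  (sq_le_sq₀ (norm_nonneg _) (by positivity)).1 (by rw [norm_pt_sq]; nlinarith [sq_nonneg ‖y‖])

lemma norm_le_norm_pt' (x : E m) (y : E n) : ‖y‖ ≤ ‖pt x y‖ :=
  (sq_le_sq₀ (norm_nonneg _) (by positivity)).1 (by rw [norm_pt_sq]; nlinarith [sq_nonneg ‖x‖])

lemma norm_pt_le (x : E m) (y : E n) : ‖pt x y‖ ≤ ‖x‖ + ‖y‖ :=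
  (sq_le_sq₀ (norm_nonneg _) (by positivity)).1 (by rw [norm_pt_sq]; nlinarith [norm_nonneg x, norm_nonneg y])

lemma norm_pt_zero (y : E n) : ‖pt (0 : E m) y‖ = ‖y‖ := by
  have := norm_pt_sq (0 : E m) y
  simpa using this

lemma continuous_pt : Continuous fun q : E m × E n => pt q.1 q.2 := by
  refine (PiLp.continuous_toLp 2 _).comp (continuous_pi fun i => ?_)
  rcases i with i | i
  · exact (PiLp.continuous_ofLp 2 _ |>.comp continuous_fst).comp continuous_id |> continuous_pi_iff.1 |> (· i)
  · exact (PiLp.continuous_ofLp 2 _ |>.comp continuous_snd).comp continuous_id |> continuous_pi_iff.1 |> (· i)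

/-- The linear parametrization `x ↦ (x, L x)` of the graph of `L`. -/
def graphMap (L : E m →L[ℝ] E n) : E m →L[ℝ] Amb m n :=
  LinearMap.toContinuousLinearMap
    { toFun := fun x => pt x (L x)
      map_add' := fun x y => by rw [map_add]; ext i; rcases i with i | i <;> rfl
      map_smul' := fun r x => by rw [map_smul, ← pt_smul]; rfl }

lemma graphMap_apply (L : E m →L[ℝ] E n) (x : E m) : graphMap L x = pt x (L x) := rfl

lemma norm_le_norm_graphMap (L : E m →L[ℝ] E n) (x : E m) : ‖x‖ ≤ ‖graphMap L x‖ :=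
  norm_le_norm_pt _ _

lemma norm_graphMap_sub_le (L L' : E m →L[ℝ] E n) : ‖graphMap L - graphMap L'‖ ≤ ‖L - L'‖ := by
  refine ContinuousLinearMap.opNorm_le_bound _ (norm_nonneg _) fun x => ?_
  have : (graphMap L - graphMap L') x = pt 0 ((L - L') x) := by
    simp [graphMap_apply, pt_sub]
  rw [this, norm_pt_zero]
  exact (L - L').le_opNorm x

lemma graphMap_injective (L : E m →L[ℝ] E n) : Function.Injective (graphMap L) :=
  fun x y h => by simpa [graphMap_apply] using congrArg (horiz m n) h

lemma isClosedEmbedding_graphMap (L : E m →L[ℝ] E n) : IsClosedEmbedding (graphMap L) :=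
  (graphMap L).toLinearMap.isClosedEmbedding_of_injective
    (LinearMap.ker_eq_bot.2 (graphMap_injective L))

/-! ### Comparison of Hausdorff measures and the Jacobian of a linear graph -/

/-- Hausdorff measures of two images of the same set compare as soon as distances do. -/
lemma hausdorffMeasure_image_le_of_dist_le {α X Y : Type*} [MetricSpace X] [MeasurableSpace X]
    [BorelSpace X] [MetricSpace Y] [MeasurableSpace Y] [BorelSpace Y] {f : α → Y} {g : α → X}
    {S : Set α} {K : ℝ≥0} (h : ∀ x ∈ S, ∀ y ∈ S, dist (f x) (f y) ≤ K * dist (g x) (g y)) (d : ℕ) :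
    μH[d] (f '' S) ≤ (K : ℝ≥0∞) ^ d * μH[d] (g '' S) := by
  rcases S.eq_empty_or_nonempty with rfl | ⟨x₀, -⟩
  · simp
  have : Nonempty α := ⟨x₀⟩
  set i := Function.invFunOn g S
  have hi : ∀ x ∈ g '' S, i x ∈ S ∧ g (i x) = x := fun x hx => Function.invFunOn_pos hx
  have hL : LipschitzOnWith K (f ∘ i) (g '' S) := by
    refine LipschitzOnWith.of_dist_le_mul fun x hx y hy => ?_
    have := h _ (hi x hx).1 _ (hi y hy).1
    rwa [(hi x hx).2, (hi y hy).2] at this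
  have h1 := hL.hausdorffMeasure_image_le (d := d) (Nat.cast_nonneg d)
  rw [ENNReal.rpow_natCast] at h1
  refine le_trans (measure_mono ?_) h1
  rintro _ ⟨x, hx, rfl⟩
  have hgx := hi (g x) (mem_image_of_mem g hx)
  refine ⟨g x, mem_image_of_mem g hx, ?_⟩
  have := h _ hgx.1 x hx
  rw [hgx.2, dist_self, mul_zero] at this
  exact dist_le_zero.1 this

lemma hausdorff_const_ne_zero (m : ℕ) : volume (Metric.ball (0 : E m) 1) / 2 ^ m ≠ 0 :=
  ENNReal.div_ne_zero.2 ⟨(Metric.measure_ball_pos _ _ one_pos).ne', by simp⟩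

lemma hausdorff_const_ne_top (m : ℕ) : volume (Metric.ball (0 : E m) 1) / 2 ^ m ≠ ⊤ :=
  ENNReal.div_ne_top measure_ball_lt_top.ne (by simp)

lemma hausdorff_apply (S : Set (Amb m n)) :
    hausdorff m n S = volume (Metric.ball (0 : E m) 1) / 2 ^ m * μH[(m : ℝ)] S := rfl

lemma hausdorff_image_le_of_dist_le {α : Type*} {f g : α → Amb m n} {S : Set α} {K : ℝ≥0}
    (h : ∀ x ∈ S, ∀ y ∈ S, dist (f x) (f y) ≤ K * dist (g x) (g y)) :
    hausdorff m n (f '' S) ≤ (K : ℝ≥0∞) ^ m * hausdorff m n (g '' S) := by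
  rw [hausdorff_apply, hausdorff_apply, mul_left_comm]
  gcongr
  exact hausdorffMeasure_image_le_of_dist_le h m

lemma hausdorffMeasure_graphMap_image_bounds (L : E m →L[ℝ] E n) (S : Set (E m)) :
    μH[(m : ℝ)] S ≤ μH[(m : ℝ)] (graphMap L '' S) ∧
      μH[(m : ℝ)] (graphMap L '' S) ≤ (‖graphMap L‖₊ : ℝ≥0∞) ^ m * μH[(m : ℝ)] S := by
  constructor
  · have := hausdorffMeasure_image_le_of_dist_le (f := id) (g := graphMap L) (S := S) (K := 1)
      (fun x _ y _ => by
        rw [dist_eq_norm, dist_eq_norm, ← map_sub]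
        simpa using norm_le_norm_graphMap L (x - y)) m
    simpa using this
  · have := hausdorffMeasure_image_le_of_dist_le (f := graphMap L) (g := id) (S := S)
      (K := ‖graphMap L‖₊) (fun x _ y _ => by
        rw [dist_eq_norm, dist_eq_norm, ← map_sub]
        exact (graphMap L).le_opNorm (x - y)) m
    simpa using this

lemma isAddHaarMeasure_hausdorffMeasure_E (m : ℕ) :
    (μH[(m : ℝ)] : Measure (E m)).IsAddHaarMeasure := by
  simpa using isAddHaarMeasure_hausdorffMeasure (E := E m)

/-- The pull-back of `ℋᵐ` by the parametrization of the graph of `L`. -/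
def graphMeasure (L : E m →L[ℝ] E n) : Measure (E m) := (hausdorff m n).comap (graphMap L)

lemma graphMeasure_apply (L : E m →L[ℝ] E n) (S : Set (E m)) :
    graphMeasure L S = hausdorff m n (graphMap L '' S) :=
  (isClosedEmbedding_graphMap L).measurableEmbedding.comap_apply _ _

instance (L : E m →L[ℝ] E n) : (graphMeasure L).IsAddHaarMeasure where
  map_add_left_eq_self g := by
    ext S hS
    rw [Measure.map_apply (measurable_const_add g) hS, graphMeasure_apply, graphMeasure_apply,
      hausdorff_apply, hausdorff_apply]
    congr 1
    have : graphMap L '' ((fun x => g + x) ⁻¹' S)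
        = (fun z => graphMap L g + z) ⁻¹' (graphMap L '' S) := by
      ext z
      constructor
      · rintro ⟨x, hx, rfl⟩
        exact ⟨g + x, hx, map_add _ _ _⟩
      · rintro ⟨x, hx, hz⟩
        refine ⟨x - g, by simpa using hx, ?_⟩
        rw [map_sub, hz]; simp
    rw [this, measure_preimage_add]
  lt_top_of_isCompact K hK := by
    have := isAddHaarMeasure_hausdorffMeasure_E m
    rw [graphMeasure_apply, hausdorff_apply]
    refine ENNReal.mul_lt_top (hausdorff_const_ne_top m).lt_top ?_
    refine lt_of_le_of_lt (hausdorffMeasure_graphMap_image_bounds L K).2 ?_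
    exact ENNReal.mul_lt_top (ENNReal.pow_lt_top ENNReal.coe_lt_top) hK.measure_lt_top
  open_pos U hU hne := by
    have := isAddHaarMeasure_hausdorffMeasure_E m
    rw [graphMeasure_apply, hausdorff_apply]
    refine mul_ne_zero (hausdorff_const_ne_zero m) ?_
    exact ((hU.measure_pos _ hne).trans_le (hausdorffMeasure_graphMap_image_bounds L U).1).ne'

/-- The Jacobian of `x ↦ (x, L x)`: the factor by which this map scales `ℋᵐ`. It equals
`√det (1 + LᵗL)`, but only the scaling property is needed. -/
def jac (L : E m →L[ℝ] E n) : ℝ≥0 := Measure.addHaarScalarFactor (graphMeasure L) volume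

lemma graphMeasure_eq (L : E m →L[ℝ] E n) : graphMeasure L = jac L • (volume : Measure (E m)) :=
  Measure.isAddLeftInvariant_eq_smul _ _

lemma hausdorff_graphMap_image (L : E m →L[ℝ] E n) (S : Set (E m)) :
    hausdorff m n (graphMap L '' S) = jac L * volume S := by
  rw [← graphMeasure_apply, graphMeasure_eq]; rfl

lemma dist_graphMap_le (L L' : E m →L[ℝ] E n) (x y : E m) :
    dist (graphMap L' x) (graphMap L' y)
      ≤ (1 + ‖L - L'‖₊ : ℝ≥0) * dist (graphMap L x) (graphMap L y) := by
  rw [dist_eq_norm, dist_eq_norm, ← map_sub, ← map_sub]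
  have h1 : ‖(graphMap L' - graphMap L) (x - y)‖ ≤ ‖L - L'‖ * ‖graphMap L (x - y)‖ := by
    refine ((graphMap L' - graphMap L).le_opNorm _).trans ?_
    refine mul_le_mul ?_ (norm_le_norm_graphMap L _) (norm_nonneg _) (norm_nonneg _)
    rw [norm_sub_rev L]
    exact norm_graphMap_sub_le _ _
  have h2 : graphMap L' (x - y)
      = graphMap L (x - y) + (graphMap L' - graphMap L) (x - y) := by simp
  calc ‖graphMap L' (x - y)‖ ≤ ‖graphMap L (x - y)‖ + ‖(graphMap L' - graphMap L) (x - y)‖ := by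
        conv_lhs => rw [h2]
        exact norm_add_le _ _
    _ ≤ _ := by push_cast at h1 ⊢; linarith

lemma jac_le_mul (L L' : E m →L[ℝ] E n) : jac L' ≤ (1 + ‖L - L'‖₊) ^ m * jac L := by
  have h := hausdorff_image_le_of_dist_le (S := Metric.ball (0 : E m) 1)
    (fun x _ y _ => dist_graphMap_le L L' x y)
  rw [hausdorff_graphMap_image, hausdorff_graphMap_image, ← mul_assoc] at h
  have h' := (ENNReal.mul_le_mul_iff_left (Metric.measure_ball_pos volume (0 : E m) one_pos).ne'
    measure_ball_lt_top.ne).1 h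
  exact_mod_cast h'

lemma jac_pos (L : E m →L[ℝ] E n) : 0 < jac L :=
  Measure.addHaarScalarFactor_pos_of_isAddHaarMeasure _ _

lemma jac_le_growth (L : E m →L[ℝ] E n) : jac L ≤ (1 + ‖L‖₊) ^ m * jac (0 : E m →L[ℝ] E n) := by
  simpa using jac_le_mul 0 L

lemma continuous_jac : Continuous (jac : (E m →L[ℝ] E n) → ℝ≥0) := by
  rw [continuous_iff_continuousAt]
  intro L
  have hc : Continuous fun L' : E m →L[ℝ] E n => (1 + ‖L - L'‖₊) ^ m := by fun_prop
  have h1 : Tendsto (fun L' : E m →L[ℝ] E n => (1 + ‖L - L'‖₊) ^ m * jac L) (𝓝 L) (𝓝 (jac L)) := by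
    simpa using (hc.tendsto L).mul_const (jac L)
  have h2 : Tendsto (fun L' : E m →L[ℝ] E n => jac L / (1 + ‖L - L'‖₊) ^ m) (𝓝 L) (𝓝 (jac L)) := by
    have := ((continuous_const (y := jac L)).div₀ hc (fun L' => by positivity)).tendsto L
    simpa using this
  refine tendsto_of_tendsto_of_tendsto_of_le_of_le h2 h1 (fun L' => ?_) (fun L' => jac_le_mul L L')
  have := jac_le_mul L' L
  rw [← nnnorm_neg, neg_sub] at this
  exact div_le_of_le_mul₀ (by positivity) (by positivity) (by rwa [mul_comm])

/-! ### The Grassmannian and tangent planes of graphs -/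

instance : SecondCountableTopology (Grass m n) :=
  have : SecondCountableTopology (Matrix (Fin m ⊕ Fin n) (Fin m ⊕ Fin n) ℝ) :=
    inferInstanceAs (SecondCountableTopology (Fin m ⊕ Fin n → Fin m ⊕ Fin n → ℝ))
  (IsEmbedding.subtypeVal : IsEmbedding
    (Subtype.val : Grass m n → Matrix (Fin m ⊕ Fin n) (Fin m ⊕ Fin n) ℝ)).secondCountableTopology

lemma continuous_grass_val : Continuous fun P : Grass m n => P.1 := continuous_subtype_val

instance : CompactSpace (Grass m n) := by
  refine isCompact_iff_compactSpace.1 (?_ : IsCompact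
    {P : Matrix (Fin m ⊕ Fin n) (Fin m ⊕ Fin n) ℝ | Pᵀ = P ∧ P * P = P ∧ P.trace = m})
  have hK : IsCompact (Set.pi univ fun _ => Set.pi univ fun _ => Icc (-(m + 1 : ℝ)) (m + 1) :
      Set ((Fin m ⊕ Fin n) → (Fin m ⊕ Fin n) → ℝ)) :=
    isCompact_univ_pi fun _ => isCompact_univ_pi fun _ => isCompact_Icc
  refine hK.of_isClosed_subset ?_ ?_
  · refine (isClosed_eq (by fun_prop) (by fun_prop)).inter
      ((isClosed_eq (by fun_prop) (by fun_prop)).inter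
        (isClosed_eq (by fun_prop) (by fun_prop)))
  · rintro P ⟨h1, h2, h3⟩ i - j -
    -- the squares of the entries of a projection sum up to its trace
    have hs : ∑ i, ∑ j, P i j ^ 2 = m := by
      rw [← h3]
      conv_rhs => rw [← h2]
      simp only [Matrix.trace, Matrix.diag]
      refine Finset.sum_congr rfl fun i _ => Finset.sum_congr rfl fun j _ => ?_
      have : P j i = P i j := congrFun (congrFun h1 i) j
      rw [sq]
      exact congrArg (P i j * ·) this.symm
    have h4 : P i j ^ 2 ≤ m := by
      rw [← hs]
      refine le_trans ?_ (Finset.single_le_sum (f := fun i => ∑ j, P i j ^ 2)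
        (fun i _ => Finset.sum_nonneg fun j _ => sq_nonneg _) (Finset.mem_univ i))
      exact Finset.single_le_sum (f := fun j => P i j ^ 2) (fun j _ => sq_nonneg _)
        (Finset.mem_univ j)
    have h5 : (0 : ℝ) ≤ m := Nat.cast_nonneg m
    exact ⟨by nlinarith, by nlinarith⟩

/-- Linear maps `ℝᵐ → ℝⁿ` as matrices. -/
def matEquiv (m n : ℕ) : (E m →L[ℝ] E n) ≃ₗ[ℝ] Matrix (Fin n) (Fin m) ℝ :=
  LinearMap.toContinuousLinearMap.symm.trans Matrix.toEuclideanLin.symm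

lemma continuous_matEquiv : Continuous (matEquiv m n) :=
  (matEquiv m n).toLinearMap.continuous_of_finiteDimensional

lemma continuous_matEquiv_symm : Continuous (matEquiv m n).symm :=
  (matEquiv m n).symm.toLinearMap.continuous_of_finiteDimensional

lemma matEquiv_mulVec (L : E m →L[ℝ] E n) (x : E m) :
    matEquiv m n L *ᵥ x.ofLp = (L x).ofLp := by
  have : Matrix.toEuclideanLin (matEquiv m n L) = L.toLinearMap := by
    simp [matEquiv]
  have h := congrArg (fun l => (l x).ofLp) this
  simpa using h

/-- The matrix of `x ↦ (x, L x)`. -/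
def frame (L : E m →L[ℝ] E n) : Matrix (Fin m ⊕ Fin n) (Fin m) ℝ :=
  Matrix.fromRows 1 (matEquiv m n L)

lemma frame_mulVec (L : E m →L[ℝ] E n) (x : E m) :
    frame L *ᵥ x.ofLp = (graphMap L x).ofLp := by
  rw [frame, Matrix.fromRows_mulVec, Matrix.one_mulVec, matEquiv_mulVec]
  rfl

/-- The Gram matrix `1 + LᵗL` of the columns of `frame L`. -/
def gram (L : E m →L[ℝ] E n) : Matrix (Fin m) (Fin m) ℝ := (frame L)ᵀ * frame L

lemma gram_eq (L : E m →L[ℝ] E n) : gram L = 1 + (matEquiv m n L)ᵀ * matEquiv m n L := by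
  rw [gram, frame, Matrix.transpose_fromRows, Matrix.fromCols_mul_fromRows]
  simp

lemma gram_det_pos (L : E m →L[ℝ] E n) : 0 < (gram L).det := by
  have h : ((1 : Matrix (Fin m) (Fin m) ℝ) + (matEquiv m n L)ᵀ * matEquiv m n L).PosDef := by
    have := Matrix.posSemidef_conjTranspose_mul_self (matEquiv m n L)
    rw [Matrix.conjTranspose_eq_transpose_of_trivial] at this
    exact Matrix.PosDef.one.add_posSemidef this
  rw [gram_eq]
  exact h.det_pos

lemma gram_transpose (L : E m →L[ℝ] E n) : (gram L)ᵀ = gram L := by simp [gram]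

lemma gram_isUnit_det (L : E m →L[ℝ] E n) : IsUnit (gram L).det := (gram_det_pos L).ne'.isUnit

/-- The graph of `L`, as a point of the Grassmannian: the matrix `M (Mᵗ M)⁻¹ Mᵗ` with
`M = frame L`. -/
def tangentProj (L : E m →L[ℝ] E n) : Grass m n :=
  ⟨frame L * (gram L)⁻¹ * (frame L)ᵀ, by
    rw [Matrix.transpose_mul, Matrix.transpose_mul, Matrix.transpose_transpose,
      Matrix.transpose_nonsing_inv, gram_transpose, Matrix.mul_assoc], by
    calc frame L * (gram L)⁻¹ * (frame L)ᵀ * (frame L * (gram L)⁻¹ * (frame L)ᵀ)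
        = frame L * ((gram L)⁻¹ * gram L) * (gram L)⁻¹ * (frame L)ᵀ := by
          simp only [gram, Matrix.mul_assoc]
      _ = _ := by rw [Matrix.nonsing_inv_mul _ (gram_isUnit_det L), Matrix.mul_one], by
    rw [Matrix.mul_assoc, Matrix.trace_mul_comm, Matrix.mul_assoc]
    change ((gram L)⁻¹ * gram L).trace = _
    rw [Matrix.nonsing_inv_mul _ (gram_isUnit_det L)]
    simp⟩

lemma continuousAt_matrix_inv {k : ℕ} {A : Matrix (Fin k) (Fin k) ℝ} (hA : A.det ≠ 0) :
    ContinuousAt (fun B : Matrix (Fin k) (Fin k) ℝ => B⁻¹) A := by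
  have h : (fun B : Matrix (Fin k) (Fin k) ℝ => B⁻¹) = fun B => B.det⁻¹ • B.adjugate := by
    ext1 B
    rw [Matrix.inv_def, Ring.inverse_eq_inv']
  rw [h]
  have h1 : Continuous fun B : Matrix (Fin k) (Fin k) ℝ => B.det := continuous_id.matrix_det
  have h2 : Continuous fun B : Matrix (Fin k) (Fin k) ℝ => B.adjugate := continuous_id.matrix_adjugate
  exact (h1.continuousAt.inv₀ hA).smul h2.continuousAt

lemma continuous_frame : Continuous (frame : (E m →L[ℝ] E n) → _) := by
  refine continuous_matrix fun i j => ?_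
  rcases i with i | i
  · exact continuous_const
  · exact continuous_matEquiv.matrix_elem i j

lemma continuous_gram : Continuous (gram : (E m →L[ℝ] E n) → _) :=
  continuous_frame.matrix_transpose.matrix_mul continuous_frame

lemma continuous_tangentProj : Continuous (tangentProj : (E m →L[ℝ] E n) → Grass m n) := by
  refine Continuous.subtype_mk ?_ _
  refine (continuous_frame.matrix_mul ?_).matrix_mul continuous_frame.matrix_transpose
  refine continuous_iff_continuousAt.2 fun L => ?_
  exact (continuousAt_matrix_inv (gram_det_pos L).ne').comp (f := gram) continuous_gram.continuousAt

lemma plane_tangentProj (L : E m →L[ℝ] E n) : plane (tangentProj L) = range (graphMap L) := by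
  ext z
  constructor
  · intro hz
    refine ⟨WithLp.toLp 2 ((gram L)⁻¹ *ᵥ ((frame L)ᵀ *ᵥ z.ofLp)), ?_⟩
    have hz' : (frame L * (gram L)⁻¹ * (frame L)ᵀ) *ᵥ z.ofLp = z.ofLp := hz
    have h := frame_mulVec L (WithLp.toLp 2 ((gram L)⁻¹ *ᵥ ((frame L)ᵀ *ᵥ z.ofLp)))
    simp only [Matrix.mulVec_mulVec, ← Matrix.mul_assoc] at h
    rw [hz'] at h
    have h' := congrArg (WithLp.toLp 2) h
    simp only [WithLp.toLp_ofLp] at h'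
    rw [Matrix.mulVec_mulVec]
    exact h'.symm
  · rintro ⟨x, rfl⟩
    change (frame L * (gram L)⁻¹ * (frame L)ᵀ) *ᵥ (graphMap L x).ofLp = (graphMap L x).ofLp
    rw [← frame_mulVec, Matrix.mulVec_mulVec, Matrix.mul_assoc, Matrix.mul_assoc]
    change (frame L * ((gram L)⁻¹ * gram L)) *ᵥ _ = _
    rw [Matrix.nonsing_inv_mul _ (gram_isUnit_det L), Matrix.mul_one]

lemma isClosed_plane (P : Grass m n) : IsClosed (plane P) :=
  isClosed_eq (by fun_prop) (by fun_prop)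

/-- Two orthogonal projections of the same trace coincide if one plane contains the other: their
difference is then a projection of trace zero. -/
lemma eq_of_plane_subset {P P' : Grass m n} (h : plane P ⊆ plane P') : P' = P := by
  obtain ⟨P, hP1, hP2, hP3⟩ := P
  obtain ⟨P', hP1', hP2', hP3'⟩ := P'
  have h1 : P' * P = P := by
    ext i j
    have hj : WithLp.toLp 2 (P.col j) ∈ plane (⟨P', hP1', hP2', hP3'⟩ : Grass m n) := by
      refine h ?_
      change P *ᵥ P.col j = P.col j
      ext k
      exact congrFun (congrFun hP2 k) j
    exact congrFun (hj : P' *ᵥ P.col j = P.col j) i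
  have h2 : P * P' = P := by
    have := congrArg Matrix.transpose h1
    rwa [Matrix.transpose_mul, hP1, hP1'] at this
  have h3 : (P' - P)ᵀ * (P' - P) = P' - P := by
    rw [Matrix.transpose_sub, hP1, hP1', Matrix.sub_mul, Matrix.mul_sub, Matrix.mul_sub, hP2', h1,
      h2, hP2]
    abel
  have h4 : ((P' - P)ᵀ * (P' - P)).trace = 0 := by
    rw [h3, Matrix.trace_sub, hP3, hP3', sub_self]
  have h5 : P' - P = 0 := by
    rw [← Matrix.conjTranspose_eq_transpose_of_trivial] at h4
    exact Matrix.trace_conjTranspose_mul_self_eq_zero_iff.1 h4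
  exact Subtype.ext (sub_eq_zero.1 h5)

/-- The determinant of the compression of `P` to `ℝᵐ`; it vanishes exactly on the planes which
are not graphs over `ℝᵐ`. -/
def horizDet (P : Grass m n) : ℝ := P.1.toBlocks₁₁.det

lemma continuous_toBlocks₁₁ : Continuous fun P : Grass m n => P.1.toBlocks₁₁ :=
  continuous_matrix fun _ _ => continuous_grass_val.matrix_elem _ _

lemma continuous_toBlocks₂₁ : Continuous fun P : Grass m n => P.1.toBlocks₂₁ :=
  continuous_matrix fun _ _ => continuous_grass_val.matrix_elem _ _

lemma continuous_horizDet : Continuous (horizDet : Grass m n → ℝ) :=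
  continuous_toBlocks₁₁.matrix_det

/-- The linear map of which the plane `P` is the graph (junk if `P` is not a graph). -/
def slope (P : Grass m n) : E m →L[ℝ] E n :=
  (matEquiv m n).symm (P.1.toBlocks₂₁ * (P.1.toBlocks₁₁)⁻¹)

lemma continuousAt_slope {P : Grass m n} (hP : horizDet P ≠ 0) : ContinuousAt slope P := by
  refine continuous_matEquiv_symm.continuousAt.comp ?_
  refine ContinuousAt.comp (f := fun P : Grass m n => (P.1.toBlocks₂₁, (P.1.toBlocks₁₁)⁻¹))
    (g := fun q : Matrix (Fin n) (Fin m) ℝ × Matrix (Fin m) (Fin m) ℝ => q.1 * q.2) ?_ ?_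
  · exact (continuous_fst.matrix_mul continuous_snd).continuousAt
  · refine continuous_toBlocks₂₁.continuousAt.prodMk ?_
    exact (continuousAt_matrix_inv hP).comp (f := fun P : Grass m n => P.1.toBlocks₁₁)
      continuous_toBlocks₁₁.continuousAt

lemma tangentProj_val (L : E m →L[ℝ] E n) :
    (tangentProj L).1 = Matrix.fromBlocks (gram L)⁻¹ ((gram L)⁻¹ * (matEquiv m n L)ᵀ)
      (matEquiv m n L * (gram L)⁻¹) (matEquiv m n L * (gram L)⁻¹ * (matEquiv m n L)ᵀ) := by
  change frame L * (gram L)⁻¹ * (frame L)ᵀ = _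
  conv_lhs => rw [frame, Matrix.transpose_fromRows, Matrix.fromRows_mul,
    Matrix.fromRows_mul_fromCols]
  simp

lemma horizDet_tangentProj (L : E m →L[ℝ] E n) : horizDet (tangentProj L) = ((gram L).det)⁻¹ := by
  rw [horizDet, tangentProj_val, Matrix.toBlocks_fromBlocks₁₁, Matrix.det_nonsing_inv,
    Ring.inverse_eq_inv']

lemma horizDet_tangentProj_pos (L : E m →L[ℝ] E n) : 0 < horizDet (tangentProj L) := by
  rw [horizDet_tangentProj]
  exact inv_pos.2 (gram_det_pos L)

lemma slope_tangentProj (L : E m →L[ℝ] E n) : slope (tangentProj L) = L := by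
  rw [slope, tangentProj_val, Matrix.toBlocks_fromBlocks₁₁, Matrix.toBlocks_fromBlocks₂₁,
    Matrix.nonsing_inv_nonsing_inv _ (gram_isUnit_det L), Matrix.mul_assoc,
    Matrix.nonsing_inv_mul _ (gram_isUnit_det L), Matrix.mul_one, LinearEquiv.symm_apply_apply]

lemma restrict_plane (L : E m →L[ℝ] E n) :
    (hausdorff m n).restrict (plane (tangentProj L))
      = (jac L • (volume : Measure (E m))).map (graphMap L) := by
  rw [← graphMeasure_eq, graphMeasure, plane_tangentProj,
    (isClosedEmbedding_graphMap L).measurableEmbedding.map_comap]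

lemma setIntegral_plane (L : E m →L[ℝ] E n) (f : Amb m n → ℝ) :
    ∫ z in plane (tangentProj L), f z ∂(hausdorff m n) = ∫ x, jac L * f (graphMap L x) := by
  rw [restrict_plane, (isClosedEmbedding_graphMap L).measurableEmbedding.integral_map,
    integral_smul_nnreal_measure, NNReal.smul_def, integral_const_mul, smul_eq_mul]

/-- A graph that is an approximate tangent plane is the only one. -/
lemma IsApproxTangent.eq_tangentProj {Γ : Set (Amb m n)} {y : Amb m n} {L : E m →L[ℝ] E n}
    {P : Grass m n} (hL : IsApproxTangent Γ y (tangentProj L)) (hP : IsApproxTangent Γ y P) :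
    P = tangentProj L := by
  refine eq_of_plane_subset fun z₀ hz₀ => ?_
  by_contra hz
  obtain ⟨ρ, hρ, hball⟩ := Metric.isOpen_iff.1 (isClosed_plane P).isOpen_compl z₀ hz
  set f : Amb m n → ℝ := fun z => max 0 (ρ - dist z z₀) with hf
  have hfc : Continuous f := by fun_prop
  have hfs : HasCompactSupport f := by
    refine HasCompactSupport.of_support_subset_isCompact (isCompact_closedBall z₀ ρ) fun z hz => ?_
    rw [Metric.mem_closedBall]
    by_contra hlt
    exact hz (max_eq_left (by linarith))
  have heq := tendsto_nhds_unique (hL f hfc hfs) (hP f hfc hfs)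
  have h0 : ∫ z in plane P, f z ∂(hausdorff m n) = 0 := by
    refine setIntegral_eq_zero_of_forall_eq_zero fun z hz => max_eq_left ?_
    by_contra hlt
    exact hball (Metric.mem_ball.2 (by linarith : dist z z₀ < ρ)) hz
  rw [h0, setIntegral_plane, integral_const_mul] at heq
  obtain ⟨x₀, hx₀⟩ : z₀ ∈ range (graphMap L) := plane_tangentProj L ▸ hz₀
  have hpos : 0 < ∫ x, f (graphMap L x) := by
    refine (hfc.comp (graphMap L).continuous).integral_pos_of_hasCompactSupport_nonneg_nonzero
      (hfs.comp_isClosedEmbedding (isClosedEmbedding_graphMap L)) (fun x => le_max_left _ _)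
      (x := x₀) ?_
    simp [hf, hx₀, hρ.ne', hρ.le]
  have := mul_pos (NNReal.coe_pos.2 (jac_pos L)) hpos
  linarith

/-! ### The area formula for graphs -/

/-- The graph parametrization `x ↦ (x, u x)`. -/
def graphPt (u : E m → E n) (x : E m) : Amb m n := pt x (u x)

lemma graphPt_injective (u : E m → E n) : Function.Injective (graphPt u) :=
  fun x y h => by simpa [graphPt] using congrArg (horiz m n) h

lemma measurable_graphPt {u : E m → E n} (hu : Measurable u) : Measurable (graphPt u) :=
  continuous_pt.measurable.comp (measurable_id.prodMk hu)

lemma hausdorff_image_le_of_approximatesLinearOn {f : E m → Amb m n} {L : E m →L[ℝ] E n}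
    {S : Set (E m)} {δ : ℝ≥0} (h : ApproximatesLinearOn f (graphMap L) S δ) :
    hausdorff m n (f '' S) ≤ ((1 + δ : ℝ≥0) : ℝ≥0∞) ^ m * (jac L * volume S) := by
  rw [← hausdorff_graphMap_image]
  refine hausdorff_image_le_of_dist_le fun x hx y hy => ?_
  have h1 := h x hx y hy
  have h2 := norm_le_norm_graphMap L (x - y)
  have h3 : f x - f y = (f x - f y - graphMap L (x - y)) + graphMap L (x - y) := by abel
  rw [dist_eq_norm, dist_eq_norm, ← map_sub]
  calc ‖f x - f y‖ ≤ ‖f x - f y - graphMap L (x - y)‖ + ‖graphMap L (x - y)‖ := by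
        conv_lhs => rw [h3]
        exact norm_add_le _ _
    _ ≤ δ * ‖graphMap L (x - y)‖ + ‖graphMap L (x - y)‖ := by gcongr; exact h1.trans (by gcongr)
    _ = _ := by push_cast; ring

lemma le_hausdorff_image_of_approximatesLinearOn {f : E m → Amb m n} {L : E m →L[ℝ] E n}
    {S : Set (E m)} {δ : ℝ≥0} (hδ : δ < 1) (h : ApproximatesLinearOn f (graphMap L) S δ) :
    jac L * volume S ≤ (((1 - δ)⁻¹ : ℝ≥0) : ℝ≥0∞) ^ m * hausdorff m n (f '' S) := by
  rw [← hausdorff_graphMap_image]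
  refine hausdorff_image_le_of_dist_le fun x hx y hy => ?_
  have h1 := h x hx y hy
  have h2 := norm_le_norm_graphMap L (x - y)
  have hδ' : (0 : ℝ) < 1 - δ := sub_pos.2 (by exact_mod_cast hδ)
  rw [dist_eq_norm, dist_eq_norm, ← map_sub]
  have h4 : ‖graphMap L (x - y)‖ ≤ ‖f x - f y‖ + ‖f x - f y - graphMap L (x - y)‖ := by
    rw [norm_sub_rev (f x - f y) (graphMap L (x - y))]
    have := norm_add_le (f x - f y) (graphMap L (x - y) - (f x - f y))
    rwa [add_sub_cancel] at this
  have h5 : (δ : ℝ) * ‖x - y‖ ≤ δ * ‖graphMap L (x - y)‖ := by gcongr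
  rw [NNReal.coe_inv, NNReal.coe_sub hδ.le, NNReal.coe_one, inv_mul_eq_div, le_div_iff₀ hδ']
  nlinarith

/-- Where a graph map is differentiable along a null set, it maps it to an `ℋᵐ`-null set. -/
lemma hausdorff_image_eq_zero {f : E m → Amb m n} {L : E m → E m →L[ℝ] E n} {S : Set (E m)}
    (hf : ∀ x ∈ S, HasFDerivWithinAt f (graphMap (L x)) S x) (hS : volume S = 0) :
    hausdorff m n (f '' S) = 0 := by
  rcases S.eq_empty_or_nonempty with rfl | hne
  · simp
  obtain ⟨t, A, -, -, hcov, happ, hA⟩ := exists_partition_approximatesLinearOn_of_hasFDerivWithinAt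
    f S (fun x => graphMap (L x)) hf (fun _ => 1) (fun _ => one_ne_zero)
  have hsub : f '' S ⊆ ⋃ i, f '' (S ∩ t i) := by
    rw [← image_iUnion, ← inter_iUnion, inter_eq_left.2 hcov]
  refine measure_mono_null hsub (measure_iUnion_null fun i => ?_)
  obtain ⟨y, -, hy⟩ := hA hne i
  have h := happ i
  rw [hy] at h
  have := hausdorff_image_le_of_approximatesLinearOn h
  rw [measure_mono_null inter_subset_left hS, mul_zero, mul_zero] at this
  exact le_antisymm this zero_le

/-- A set along which `f` is differentiable splits into countably many measurable pieces on each
of which `f` and its differential are close to one linear map. -/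
lemma exists_partition_near_linear {f : E m → Amb m n} {L : E m → E m →L[ℝ] E n} {B : Set (E m)}
    (hL : Measurable L) (hB : MeasurableSet B)
    (hf : ∀ x ∈ B, HasFDerivWithinAt f (graphMap (L x)) B x) {δ : ℝ≥0} (hδ : 0 < δ) :
    ∃ (S : ℕ × ℕ → Set (E m)) (Λ : ℕ × ℕ → E m →L[ℝ] E n), (∀ i, MeasurableSet (S i)) ∧
      Pairwise (Function.onFun Disjoint S) ∧ B = ⋃ i, S i ∧
      ∀ i, ApproximatesLinearOn f (graphMap (Λ i)) (S i) δ ∧ ∀ x ∈ S i, ‖L x - Λ i‖₊ ≤ δ := by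
  set d := TopologicalSpace.denseSeq (E m →L[ℝ] E n)
  set W : ℕ → Set (E m) := fun k => L ⁻¹' Metric.ball (d k) (δ / 2) with hW
  have hWm : ∀ k, MeasurableSet (W k) := fun k => hL Metric.isOpen_ball.measurableSet
  have hWu : ⋃ k, W k = univ := by
    refine eq_univ_of_forall fun x => mem_iUnion.2 ?_
    obtain ⟨k, hk⟩ := (TopologicalSpace.denseRange_denseSeq (E m →L[ℝ] E n)).exists_dist_lt (L x)
      (half_pos (NNReal.coe_pos.2 hδ))
    exact ⟨k, hk⟩
  set D := disjointed W with hD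
  have hDm : ∀ k, MeasurableSet (D k) := fun k => MeasurableSet.disjointed hWm k
  have hsmall : ∀ k, ∀ x ∈ B ∩ D k, ∀ y ∈ B ∩ D k, ‖L x - L y‖₊ ≤ δ := by
    intro k x hx y hy
    have h1 : dist (L x) (d k) < δ / 2 := disjointed_subset W k hx.2
    have h2 : dist (L y) (d k) < δ / 2 := disjointed_subset W k hy.2
    have h3 := dist_triangle_right (L x) (L y) (d k)
    rw [dist_eq_norm (L x) (L y)] at h3
    have h4 : ‖L x - L y‖ ≤ δ := by linarith
    exact_mod_cast h4
  have hpart : ∀ k, ∃ (t : ℕ → Set (E m)) (Λ : ℕ → E m →L[ℝ] E n),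
      Pairwise (Function.onFun Disjoint t) ∧ (∀ i, MeasurableSet (t i)) ∧
      (B ∩ D k ⊆ ⋃ i, t i) ∧
      ∀ i, ApproximatesLinearOn f (graphMap (Λ i)) ((B ∩ D k) ∩ t i) δ ∧
        ∀ x ∈ (B ∩ D k) ∩ t i, ‖L x - Λ i‖₊ ≤ δ := by
    intro k
    rcases (B ∩ D k).eq_empty_or_nonempty with he | hne
    · rw [he]
      refine ⟨fun _ => ∅, fun _ => 0, fun i j _ => by simp [Function.onFun], fun _ => .empty,
        by simp, fun i => ⟨by simp, by simp⟩⟩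
    obtain ⟨t, A, hdisj, hmeas, hcov, happ, hA⟩ :=
      exists_partition_approximatesLinearOn_of_hasFDerivWithinAt
      f (B ∩ D k) (fun x => graphMap (L x)) (fun x hx => (hf x hx.1).mono inter_subset_left)
      (fun _ => δ) (fun _ => hδ.ne')
    choose y hyB hy using hA hne
    refine ⟨t, fun i => L (y i), hdisj, hmeas, hcov, fun i => ⟨?_, fun x hx => ?_⟩⟩
    · rw [← hy]; exact happ i
    · exact hsmall k x hx.1 _ (hyB i)
  choose t Λ hdisj hmeas hcov hΛ using hpart
  refine ⟨fun i => (B ∩ D i.1) ∩ t i.1 i.2, fun i => Λ i.1 i.2,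
    fun i => (hB.inter (hDm _)).inter (hmeas _ _), ?_, ?_, fun i => hΛ i.1 i.2⟩
  · rintro ⟨k, i⟩ ⟨k', i'⟩ hne
    by_cases hk : k = k'
    · subst hk
      have : i ≠ i' := fun h => hne (by rw [h])
      exact (hdisj k this).mono inter_subset_right inter_subset_right
    · exact (disjoint_disjointed W hk).mono (inter_subset_left.trans inter_subset_right)
        (inter_subset_left.trans inter_subset_right)
  · refine subset_antisymm (fun x hx => ?_) (iUnion_subset fun i => ?_)
    · have : x ∈ ⋃ k, D k := by rw [hD, iUnion_disjointed, hWu]; trivial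
      obtain ⟨k, hk⟩ := mem_iUnion.1 this
      obtain ⟨i, hi⟩ := mem_iUnion.1 (hcov k ⟨hx, hk⟩)
      exact mem_iUnion.2 ⟨(k, i), ⟨hx, hk⟩, hi⟩
    · exact inter_subset_left.trans inter_subset_left

/-- The area formula for graphs. -/
theorem hausdorff_graphPt_image {u : E m → E n} {L : E m → E m →L[ℝ] E n} {B : Set (E m)}
    (hu : Measurable u) (hL : Measurable L) (hB : MeasurableSet B)
    (hf : ∀ x ∈ B, HasFDerivWithinAt (graphPt u) (graphMap (L x)) B x) :
    hausdorff m n (graphPt u '' B) = ∫⁻ x in B, jac (L x) := by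
  -- up to the factor `c δ`, both sides agree on pieces where the graph is nearly flat
  set c : ℝ≥0 → ℝ≥0∞ := fun δ => ((((1 - δ)⁻¹ : ℝ≥0) : ℝ≥0∞) ^ m) * (((1 - δ)⁻¹ : ℝ≥0) : ℝ≥0∞) ^ m
    with hc
  have hclim : Tendsto c (𝓝[>] 0) (𝓝 1) := by
    have h1 : Tendsto (fun δ : ℝ≥0 => (1 - δ)⁻¹) (𝓝[>] 0) (𝓝 1) := by
      have : ContinuousAt (fun δ : ℝ≥0 => (1 - δ)⁻¹) 0 :=
        (continuous_const.sub continuous_id).continuousAt.inv₀ (by simp)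
      simpa using this.tendsto.mono_left nhdsWithin_le_nhds
    have h2 : Tendsto (fun δ : ℝ≥0 => (((1 - δ)⁻¹) ^ m * ((1 - δ)⁻¹) ^ m : ℝ≥0)) (𝓝[>] 0) (𝓝 1) := by
      simpa using (h1.pow m).mul (h1.pow m)
    have h3 := ENNReal.tendsto_coe.2 h2
    simpa only [hc, ENNReal.coe_mul, ENNReal.coe_pow, ENNReal.coe_one] using h3
  have hev : ∀ᶠ δ : ℝ≥0 in 𝓝[>] 0, 0 < δ ∧ δ < 1 :=
    Ioo_mem_nhdsGT (zero_lt_one (α := ℝ≥0))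
  have key : ∀ δ : ℝ≥0, 0 < δ ∧ δ < 1 →
      hausdorff m n (graphPt u '' B) ≤ c δ * ∫⁻ x in B, jac (L x) ∧
      ∫⁻ x in B, jac (L x) ≤ c δ * hausdorff m n (graphPt u '' B) := by
    rintro δ ⟨hδ, hδ1⟩
    obtain ⟨S, Λ, hSm, hSd, hBS, hS⟩ := exists_partition_near_linear hL hB hf hδ
    have hle : (1 + δ : ℝ≥0) ≤ (1 - δ)⁻¹ := by
      have h0 : 0 < 1 - δ := tsub_pos_of_lt hδ1
      rw [← NNReal.coe_le_coe, NNReal.coe_inv, NNReal.coe_sub hδ1.le]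
      have h0' : (0 : ℝ) < 1 - δ := sub_pos.2 (by exact_mod_cast hδ1)
      push_cast
      rw [le_inv_comm₀ (by positivity) h0', ← one_div, le_div_iff₀ (by positivity)]
      nlinarith [NNReal.coe_nonneg δ]
    have hle' : ((1 + δ : ℝ≥0) : ℝ≥0∞) ^ m ≤ (((1 - δ)⁻¹ : ℝ≥0) : ℝ≥0∞) ^ m := by gcongr
    have hH : hausdorff m n (graphPt u '' B) = ∑' i, hausdorff m n (graphPt u '' S i) := by
      conv_lhs => rw [hBS, image_iUnion]
      refine measure_iUnion (fun i j hij => ?_) fun i => ?_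
      · exact (disjoint_image_iff (graphPt_injective u)).2 (hSd hij)
      · exact (hSm i).image_of_measurable_injOn (measurable_graphPt hu) (graphPt_injective u).injOn
    have hI : ∫⁻ x in B, jac (L x) = ∑' i, ∫⁻ x in S i, jac (L x) := by
      conv_lhs => rw [hBS]
      exact lintegral_iUnion hSm hSd _
    have hcomp : ∀ i, ∀ x ∈ S i, jac (Λ i) ≤ (1 + δ) ^ m * jac (L x) ∧
        jac (L x) ≤ (1 + δ) ^ m * jac (Λ i) := by
      intro i x hx
      have h1 := (hS i).2 x hx
      constructor
      · exact (jac_le_mul (L x) (Λ i)).trans (by gcongr)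
      · refine (jac_le_mul (Λ i) (L x)).trans ?_
        rw [← nnnorm_neg, neg_sub]
        gcongr
    rw [hH, hI, ← ENNReal.tsum_mul_left, ← ENNReal.tsum_mul_left]
    refine ⟨ENNReal.tsum_le_tsum fun i => ?_, ENNReal.tsum_le_tsum fun i => ?_⟩
    · refine (hausdorff_image_le_of_approximatesLinearOn (hS i).1).trans ?_
      rw [hc, mul_assoc]
      refine mul_le_mul' hle' ?_
      have h1 : (jac (Λ i) : ℝ≥0∞) * volume (S i) = ∫⁻ x in S i, jac (Λ i) := by
        rw [setLIntegral_const]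
      rw [h1, ← lintegral_const_mul' _ _ (by finiteness)]
      refine setLIntegral_mono' (hSm i) fun x hx => ?_
      refine le_trans ?_ (mul_le_mul_left hle' _)
      exact_mod_cast (hcomp i x hx).1
    · have h1 : ∫⁻ x in S i, jac (L x) ≤ ((1 + δ : ℝ≥0) : ℝ≥0∞) ^ m * (jac (Λ i) * volume (S i)) := by
        rw [← mul_assoc, ← setLIntegral_const]
        refine setLIntegral_mono' (hSm i) fun x hx => ?_
        exact_mod_cast (hcomp i x hx).2
      refine h1.trans ?_
      rw [hc, mul_assoc]
      exact mul_le_mul' hle' (le_hausdorff_image_of_approximatesLinearOn hδ1 (hS i).1)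
  have hlim : ∀ a : ℝ≥0∞, Tendsto (fun δ => c δ * a) (𝓝[>] 0) (𝓝 a) := fun a => by
    simpa using ENNReal.Tendsto.mul_const hclim (b := a) (Or.inl one_ne_zero)
  refine le_antisymm (ge_of_tendsto (hlim _) ?_) (ge_of_tendsto (hlim _) ?_)
  · exact hev.mono fun δ hδ => (key δ hδ).1
  · exact hev.mono fun δ hδ => (key δ hδ).2

/-! ### Approximate differentiability and decomposition into differentiable pieces -/

/-- The points near which `u` has difference quotients at most `k` outside a set of density at
most `1 / 4`, at all scales below `1 / (k + 1)`. Rational scales suffice, and make it plain that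
the set is measurable. -/
def slowSet (u : E m → E n) (k : ℕ) : Set (E m) :=
  {x | ∀ q : ℚ, 0 < q → (q : ℝ) < 1 / (k + 1) →
    volume {y ∈ Metric.ball x q | k * ‖y - x‖ < ‖u y - u x‖} ≤ volume (Metric.ball x (q : ℝ)) / 4}

lemma volume_ball_scale (x y : E m) {r s : ℝ} (hr : 0 < r) (hs : 0 < s) :
    volume (Metric.ball x s) = ENNReal.ofReal ((s / r) ^ m) * volume (Metric.ball y r) := by
  rw [Measure.addHaar_ball_of_pos _ _ hr, Measure.addHaar_ball_of_pos _ _ hs, ← mul_assoc,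
    ← ENNReal.ofReal_mul (by positivity), finrank_euclideanSpace_fin, ← mul_pow,
    div_mul_cancel₀ _ hr.ne']

lemma HasApproxDerivAt.exists_radius {u : E m → E n} {L : E m →L[ℝ] E n} {x : E m}
    (h : HasApproxDerivAt u L x) {ε : ℝ} (hε : 0 < ε) {η : ℝ≥0∞} (hη : 0 < η) :
    ∃ ρ > 0, ∀ r, 0 < r → r < ρ →
      volume {y ∈ Metric.ball x r | ε * ‖y - x‖ < ‖u y - u x - L (y - x)‖}
        ≤ η * volume (Metric.ball x r) := by
  have h1 := (h ε hε).eventually (gt_mem_nhds hη)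
  obtain ⟨ρ, hρ, hsub⟩ := mem_nhdsGT_iff_exists_Ioo_subset.1 h1
  refine ⟨ρ, hρ, fun r hr hrρ => ?_⟩
  have h2 := le_of_lt (mem_ofPred_eq ▸ hsub ⟨hr, hrρ⟩)
  rwa [ENNReal.div_le_iff (Metric.measure_ball_pos _ _ hr).ne' measure_ball_lt_top.ne] at h2

lemma HasApproxDerivAt.exists_mem_slowSet {u : E m → E n} {L : E m →L[ℝ] E n} {x : E m}
    (h : HasApproxDerivAt u L x) : ∃ k, x ∈ slowSet u k := by
  obtain ⟨ρ, hρ, hball⟩ := h.exists_radius one_pos (η := 4⁻¹) (by norm_num)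
  obtain ⟨k₁, hk₁⟩ := exists_nat_gt (1 / ρ)
  obtain ⟨k₂, hk₂⟩ := exists_nat_gt (‖L‖ + 1)
  refine ⟨max k₁ k₂, fun q hq hqk => ?_⟩
  have hk1 : (k₁ : ℝ) ≤ (max k₁ k₂ : ℕ) := by exact_mod_cast le_max_left _ _
  have hk2 : (k₂ : ℝ) ≤ (max k₁ k₂ : ℕ) := by exact_mod_cast le_max_right _ _
  have hqρ : (q : ℝ) < ρ := by
    refine hqk.trans_le ?_
    rw [one_div_le (by positivity) hρ]
    linarith
  rw [div_eq_mul_inv, mul_comm]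
  refine le_trans (measure_mono ?_) (hball q (by exact_mod_cast hq) hqρ)
  rintro y ⟨hy, h1⟩
  refine ⟨hy, ?_⟩
  have h2 := norm_sub_norm_le (u y - u x) (L (y - x))
  have h3 := L.le_opNorm (y - x)
  have h4 : (‖L‖ + 1) * ‖y - x‖ ≤ (max k₁ k₂ : ℕ) * ‖y - x‖ := by gcongr; linarith
  linarith

/-- Along a set `slowSet u k`, approximate differentials are differentials: between `x` and
`y ∈ slowSet u k` there is a point `z` very close to `y`, at which both the affine approximation at
`x` and the bound on difference quotients at `y` are good. -/
lemma HasApproxDerivAt.hasFDerivWithinAt {u : E m → E n} {L : E m →L[ℝ] E n} {x : E m}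
    (h : HasApproxDerivAt u L x) (k : ℕ) : HasFDerivWithinAt u L (slowSet u k) x := by
  rw [hasFDerivWithinAt_iff_isLittleO, Asymptotics.isLittleO_iff]
  intro c hc
  set ε : ℝ := c / (k + 2 + ‖L‖ + c) with hε_def
  have hden : 0 < k + 2 + ‖L‖ + c := by positivity
  have hε : 0 < ε := by positivity
  have hε1 : ε < 1 := by
    rw [hε_def, div_lt_one hden]
    have : 0 ≤ ‖L‖ := norm_nonneg _
    have : (0 : ℝ) ≤ k := Nat.cast_nonneg k
    linarith
  have hεc : (k + 2 + ‖L‖) * ε ≤ c := by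
    rw [hε_def, ← mul_div_assoc, div_le_iff₀ hden]
    nlinarith
  obtain ⟨ρ, hρ, hball⟩ := h.exists_radius hε (η := ENNReal.ofReal ((ε / 4) ^ m) / 4)
    (ENNReal.div_pos (by simp; positivity) (by norm_num))
  have hmin : 0 < min (ρ / 2) (1 / (k + 1)) := by positivity
  filter_upwards [mem_nhdsWithin_of_mem_nhds (Metric.ball_mem_nhds x hmin), self_mem_nhdsWithin]
    with y hy hyS
  rcases eq_or_ne y x with rfl | hne
  · simp
  set d := ‖y - x‖ with hd
  have hd0 : 0 < d := norm_sub_pos_iff.2 hne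
  rw [Metric.mem_ball, dist_eq_norm, lt_min_iff] at hy
  -- `z` is sought in a ball around `y` of radius `q` comparable to `ε d`, of which the exceptional
  -- sets of `x` and `y` each fill at most a quarter
  obtain ⟨q, hq1, hq2⟩ := exists_rat_btwn (by nlinarith : ε * d / 2 < ε * d)
  have hq0 : (0 : ℝ) < q := lt_trans (by positivity) hq1
  have hqd : (q : ℝ) < d := by nlinarith
  have hbadx := hball (2 * d) (by positivity) (by linarith [hy.1])
  have hbady := hyS q (by exact_mod_cast hq0) (hqd.trans hy.2)
  have hbadx' : volume {z ∈ Metric.ball x (2 * d) | ε * ‖z - x‖ < ‖u z - u x - L (z - x)‖}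
      ≤ volume (Metric.ball y (q : ℝ)) / 4 := by
    refine hbadx.trans ?_
    rw [ENNReal.mul_comm_div, ← mul_div_assoc]
    gcongr
    have : ε / 4 = (ε * d / 2) / (2 * d) := by field_simp; norm_num
    rw [this, ← volume_ball_scale y x (by positivity) (by positivity)]
    exact measure_mono (Metric.ball_subset_ball hq1.le)
  obtain ⟨z, hz, hzx, hzy⟩ : ∃ z ∈ Metric.ball y (q : ℝ),
      ‖u z - u x - L (z - x)‖ ≤ ε * ‖z - x‖ ∧ ‖u z - u y‖ ≤ k * ‖z - y‖ := by
    by_contra! hcon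
    have hsub : Metric.ball y (q : ℝ) ⊆
        {z ∈ Metric.ball x (2 * d) | ε * ‖z - x‖ < ‖u z - u x - L (z - x)‖} ∪
        {z ∈ Metric.ball y (q : ℝ) | k * ‖z - y‖ < ‖u z - u y‖} := by
      intro z hz
      by_cases hzx : ε * ‖z - x‖ < ‖u z - u x - L (z - x)‖
      · refine Or.inl ⟨?_, hzx⟩
        rw [Metric.mem_ball] at hz ⊢
        have := dist_triangle z y x
        rw [dist_eq_norm y x] at this
        linarith
      · exact Or.inr ⟨hz, hcon z hz (not_lt.1 hzx)⟩
    have h1 := (measure_mono hsub).trans ((measure_union_le _ _).trans (add_le_add hbadx' hbady))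
    have h2 : volume (Metric.ball y (q : ℝ)) ≠ ⊤ := measure_ball_lt_top.ne
    have h3 : 0 < volume (Metric.ball y (q : ℝ)) := Metric.measure_ball_pos _ _ hq0
    have h4 : (volume (Metric.ball y (q : ℝ))).toReal ≤
        (volume (Metric.ball y (q : ℝ)) / 4 + volume (Metric.ball y (q : ℝ)) / 4).toReal :=
      ENNReal.toReal_mono (by finiteness) h1
    rw [ENNReal.toReal_add (by finiteness) (by finiteness), ENNReal.toReal_div] at h4
    have h5 := ENNReal.toReal_pos h3.ne' h2
    norm_num at h4
    linarith
  rw [Metric.mem_ball, dist_eq_norm] at hz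
  have hzy' : ‖z - y‖ ≤ ε * d := by linarith
  have hzx' : ‖z - x‖ ≤ 2 * d := by
    have := norm_add_le (z - y) (y - x)
    rw [sub_add_sub_cancel] at this
    linarith
  have hL := L.le_opNorm (z - y)
  have hdecomp : u y - u x - L (y - x)
      = (u z - u x - L (z - x)) - (u z - u y) + L (z - y) := by
    rw [show L (z - x) = L (z - y) + L (y - x) by rw [← map_add, sub_add_sub_cancel]]
    abel
  calc ‖u y - u x - L (y - x)‖
      ≤ ‖u z - u x - L (z - x)‖ + ‖u z - u y‖ + ‖L (z - y)‖ := by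
        rw [hdecomp]
        exact (norm_add_le _ _).trans (by gcongr; exact norm_sub_le _ _)
    _ ≤ ε * (2 * d) + k * (ε * d) + ‖L‖ * (ε * d) := by
        gcongr
        · exact hzx.trans (by gcongr)
        · exact hzy.trans (by gcongr)
        · exact hL.trans (by gcongr)
    _ = ((k + 2 + ‖L‖) * ε) * d := by ring
    _ ≤ c * d := by gcongr

lemma measurableSet_slowSet {u : E m → E n} (hu : Measurable u) (k : ℕ) :
    MeasurableSet (slowSet u k) := by
  have hset : slowSet u k = ⋂ q : ℚ, {x | 0 < q → (q : ℝ) < 1 / (k + 1) →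
      volume {y ∈ Metric.ball x q | k * ‖y - x‖ < ‖u y - u x‖}
        ≤ volume (Metric.ball x (q : ℝ)) / 4} := by
    ext x; simp [slowSet]
  rw [hset]
  refine MeasurableSet.iInter fun q => ?_
  refine MeasurableSet.imp (.const _) (MeasurableSet.imp (.const _) ?_)
  have h1 : MeasurableSet {p : E m × E m | dist p.2 p.1 < q ∧ k * ‖p.2 - p.1‖ < ‖u p.2 - u p.1‖} :=
    MeasurableSet.inter
      (measurableSet_lt (f := fun p : E m × E m => dist p.2 p.1) (by fun_prop) (by fun_prop))
      (measurableSet_lt (f := fun p : E m × E m => k * ‖p.2 - p.1‖)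
        (g := fun p : E m × E m => ‖u p.2 - u p.1‖) (by fun_prop) (by fun_prop))
  have h2 : Measurable fun x : E m => volume (Metric.ball x (q : ℝ)) := by
    have : (fun x : E m => volume (Metric.ball x (q : ℝ)))
        = fun _ => volume (Metric.ball (0 : E m) (q : ℝ)) := by
      ext x; exact Measure.addHaar_ball_center volume x _
    rw [this]
    exact measurable_const
  exact measurableSet_le (measurable_measure_prodMk_left (ν := volume) h1) (h2.div_const 4)

lemma HasApproxDerivAt.hasFDerivWithinAt_graphPt {u : E m → E n} {L : E m →L[ℝ] E n} {x : E m}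
    (h : HasApproxDerivAt u L x) (k : ℕ) :
    HasFDerivWithinAt (graphPt u) (graphMap L) (slowSet u k) x := by
  have h1 := h.hasFDerivWithinAt k
  rw [hasFDerivWithinAt_iff_isLittleO, Asymptotics.isLittleO_iff] at h1 ⊢
  intro c hc
  filter_upwards [h1 hc] with y hy
  have : graphPt u y - graphPt u x - graphMap L (y - x) = pt 0 (u y - u x - L (y - x)) := by
    rw [graphPt, graphPt, graphMap_apply, pt_sub, pt_sub, sub_self]
  rwa [this, norm_pt_zero]

/-- A Sobolev graph over a null set is `ℋᵐ`-null. -/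
lemma hausdorff_graphPt_image_eq_zero {u : E m → E n} {S : Set (E m)} (hS : volume S = 0)
    (h : ∀ x ∈ S, ∃ L, HasApproxDerivAt u L x) : hausdorff m n (graphPt u '' S) = 0 := by
  choose! L hL using h
  have hsub : graphPt u '' S ⊆ ⋃ k, graphPt u '' (S ∩ slowSet u k) := by
    rw [← image_iUnion, ← inter_iUnion]
    refine image_mono fun x hx => ⟨hx, mem_iUnion.2 (hL x hx).exists_mem_slowSet⟩
  refine measure_mono_null hsub (measure_iUnion_null fun k => ?_)
  refine hausdorff_image_eq_zero (L := L) (fun x hx => ?_) (measure_mono_null inter_subset_left hS)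
  exact ((hL x hx.1).hasFDerivWithinAt_graphPt k).mono inter_subset_right

/-! ### Sobolev maps are approximately differentiable -/

lemma IsTestFunction.exists_bound {Ω : Set (E m)} {φ : E m → ℝ} (h : IsTestFunction Ω φ) :
    ∃ C, ∀ x, ‖φ x‖ ≤ C :=
  h.2.1.exists_bound_of_continuous h.1.continuous

lemma IsTestFunction.continuous_fderiv {Ω : Set (E m)} {φ : E m → ℝ} (h : IsTestFunction Ω φ) :
    Continuous (fderiv ℝ φ) := h.1.continuous_fderiv (by simp)

lemma IsTestFunction.exists_bound_fderiv {Ω : Set (E m)} {φ : E m → ℝ} (h : IsTestFunction Ω φ) :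
    ∃ C, ∀ x, ‖fderiv ℝ φ x‖ ≤ C :=
  (h.2.1.fderiv ℝ).exists_bound_of_continuous h.continuous_fderiv

lemma IsTestFunction.comp_sub {Ω V : Set (E m)} {φ : E m → ℝ} (h : IsTestFunction V φ) {η : E m}
    (hV : ∀ x ∈ V, x + η ∈ Ω) : IsTestFunction Ω (fun x => φ (x - η)) := by
  have he : (fun x => φ (x - η)) = φ ∘ (Homeomorph.subRight η) := rfl
  refine ⟨h.1.comp (contDiff_id.sub contDiff_const), ?_, ?_⟩
  · rw [he]; exact h.2.1.comp_homeomorph _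
  · rw [he, tsupport_comp_eq_preimage]
    intro x hx
    have := hV _ (h.2.2 hx)
    simpa using this

/-- The weak differential, tested on the whole space. -/
lemma IsWeakDeriv.integral_eq {Ω : Set (E m)} {u : E m → E n} {D : E m → E m →L[ℝ] E n}
    (h : IsWeakDeriv Ω u D) {φ : E m → ℝ} (hφ : IsTestFunction Ω φ) (v : E m) :
    ∫ x, (fderiv ℝ φ x v) • u x = -∫ x, φ x • D x v := by
  have h1 := h.2.2 φ hφ v
  rwa [setIntegral_eq_integral_of_forall_compl_eq_zero,
    setIntegral_eq_integral_of_forall_compl_eq_zero] at h1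
  · intro x hx
    rw [image_eq_zero_of_notMem_tsupport fun hx' => hx (hφ.2.2 hx'), zero_smul]
  · intro x hx
    rw [image_eq_zero_of_notMem_tsupport (f := fderiv ℝ φ)
      fun hx' => hx (hφ.2.2 (tsupport_fderiv_subset ℝ hx'))]
    simp

lemma integrable_translates {D : E m → E m →L[ℝ] E n} (hDm : StronglyMeasurable D)
    (hD : Integrable D) (η : E m) :
    Integrable (fun q : E m × ℝ => D (q.1 + q.2 • η) η)
      (volume.prod (volume.restrict (Ioc (0 : ℝ) 1))) := by
  have h1 : Integrable (fun q : E m × ℝ => D (q.1 + q.2 • η))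
      (volume.prod (volume.restrict (Ioc (0 : ℝ) 1))) := by
    have hs : StronglyMeasurable fun q : E m × ℝ => D (q.1 + q.2 • η) :=
      hDm.comp_measurable (by fun_prop)
    rw [integrable_prod_iff' hs.aestronglyMeasurable]
    refine ⟨ae_of_all _ fun t => hD.comp_add_right (t • η), ?_⟩
    have : (fun t : ℝ => ∫ x, ‖D (x + t • η)‖) = fun _ => ∫ x, ‖D x‖ := by
      ext t
      exact integral_add_right_eq_self (fun x => ‖D x‖) (t • η)
    rw [this]
    exact integrable_const _
  exact (ContinuousLinearMap.apply ℝ (E n) η).integrable_comp h1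

/-- A Sobolev map is the integral of its differential along almost every segment parallel to a
given one. -/
lemma IsWeakDeriv.ae_eq_integral_segment {Ω V : Set (E m)} {u : E m → E n}
    {D : E m → E m →L[ℝ] E n} (h : IsWeakDeriv Ω u D) (hu : Integrable u)
    (hDm : StronglyMeasurable D) (hD : Integrable D) (hV : IsOpen V) {η : E m}
    (hη : ∀ x ∈ V, ∀ t : ℝ, t ∈ Ioc (0 : ℝ) 1 → x + t • η ∈ Ω) :
    ∀ᵐ x, x ∈ V → u (x + η) - u x = ∫ t in Ioc (0 : ℝ) 1, D (x + t • η) η := by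
  have hint := integrable_translates hDm hD η
  have hg : Integrable fun x => u (x + η) - u x - ∫ t in Ioc (0 : ℝ) 1, D (x + t • η) η :=
    ((hu.comp_add_right η).sub hu).sub hint.integral_prod_left
  have key := hV.ae_eq_zero_of_integral_contDiff_smul_eq_zero
    (hg.locallyIntegrable.locallyIntegrableOn V) ?_
  · filter_upwards [key] with x hx hxV using sub_eq_zero.1 (hx hxV)
  intro φ hφ1 hφ2 hφ3
  have hφ : IsTestFunction V φ := ⟨hφ1, hφ2, hφ3⟩
  obtain ⟨C, hC⟩ := hφ.exists_bound
  obtain ⟨C', hC'⟩ := hφ.exists_bound_fderiv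
  have hφc := hφ1.continuous
  have i1 : Integrable fun x => φ x • u (x + η) :=
    (hu.comp_add_right η).bdd_smul C hφc.aestronglyMeasurable (ae_of_all _ hC)
  have i2 : Integrable fun x => φ x • u x :=
    hu.bdd_smul C hφc.aestronglyMeasurable (ae_of_all _ hC)
  have i3 : Integrable fun x => φ x • ∫ t in Ioc (0 : ℝ) 1, D (x + t • η) η :=
    hint.integral_prod_left.bdd_smul C hφc.aestronglyMeasurable (ae_of_all _ hC)
  have i4 : Integrable fun x => φ (x - η) • u x :=
    hu.bdd_smul C (hφc.comp (continuous_id.sub continuous_const)).aestronglyMeasurable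
      (ae_of_all _ fun x => hC _)
  have e1 : ∫ x, φ x • u (x + η) = ∫ x, φ (x - η) • u x := by
    rw [← integral_add_right_eq_self (fun x => φ (x - η) • u x) η]
    simp
  have e2 : ∫ x, φ x • ∫ t in Ioc (0 : ℝ) 1, D (x + t • η) η
      = ∫ t in Ioc (0 : ℝ) 1, ∫ x, φ x • D (x + t • η) η := by
    rw [← integral_integral_swap (f := fun x t => φ x • D (x + t • η) η)]
    · simp_rw [integral_smul]
    · exact hint.bdd_smul C (hφc.comp continuous_fst).aestronglyMeasurable
        (ae_of_all _ fun q => hC _)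
  have e3 : ∀ t ∈ Ioc (0 : ℝ) 1, ∫ x, φ x • D (x + t • η) η
      = -∫ x, (fderiv ℝ φ (x - t • η) η) • u x := by
    intro t ht
    have h1 := h.integral_eq (hφ.comp_sub fun x hx => hη x hx t ht) η
    have h2 : ∀ x, fderiv ℝ (fun x => φ (x - t • η)) x = fderiv ℝ φ (x - t • η) := fun x => by
      simp_rw [sub_eq_add_neg]
      exact fderiv_comp_add_right (-(t • η))
    simp_rw [h2] at h1
    rw [h1, neg_neg, ← integral_add_right_eq_self (fun x => φ (x - t • η) • D x η) (t • η)]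
    simp
  have e4 : ∫ t in Ioc (0 : ℝ) 1, ∫ x, (fderiv ℝ φ (x - t • η) η) • u x
      = ∫ x, (φ x - φ (x - η)) • u x := by
    rw [← integral_integral_swap (f := fun x (t : ℝ) => (fderiv ℝ φ (x - t • η) η) • u x)]
    · refine integral_congr_ae (ae_of_all _ fun x => ?_)
      simp only
      rw [integral_smul_const]
      congr 1
      have hd : ∀ t : ℝ, HasDerivAt (fun t : ℝ => -φ (x - t • η)) (fderiv ℝ φ (x - t • η) η) t := by
        intro t
        have h1 : HasDerivAt (fun t : ℝ => x - t • η) (-η) t := by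
          simpa using ((hasDerivAt_id t).smul_const η).const_sub x
        have h2 : HasFDerivAt φ (fderiv ℝ φ (x - t • η)) (x - t • η) :=
          (hφ1.differentiable (by simp) _).hasFDerivAt
        have h3 := (h2.comp_hasDerivAt t h1).neg
        exact h3.congr_deriv (by simp)
      rw [← intervalIntegral.integral_of_le zero_le_one,
        intervalIntegral.integral_eq_sub_of_hasDerivAt (fun t _ => hd t)]
      · simp only [one_smul, zero_smul, sub_zero]; ring
      · refine Continuous.intervalIntegrable ?_ _ _
        exact (hφ.continuous_fderiv.comp (by fun_prop)).clm_apply continuous_const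
    · refine (hu.comp_fst (volume.restrict (Ioc (0 : ℝ) 1))).bdd_smul (C' * ‖η‖)
        (φ := fun q : E m × ℝ => fderiv ℝ φ (q.1 - q.2 • η) η) ?_ ?_
      · exact ((hφ.continuous_fderiv.comp (by fun_prop)).clm_apply
          continuous_const).aestronglyMeasurable
      · exact ae_of_all _ fun q => (ContinuousLinearMap.le_opNorm _ _).trans (by gcongr; exact hC' _)
  have e5 : ∫ t in Ioc (0 : ℝ) 1, ∫ x, φ x • D (x + t • η) η = ∫ x, (φ (x - η) - φ x) • u x := by
    rw [setIntegral_congr_fun measurableSet_Ioc e3, integral_neg, e4, ← integral_neg]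
    simp [← neg_smul]
  simp_rw [smul_sub]
  have i12 : Integrable fun x => φ x • u (x + η) - φ x • u x := i1.sub i2
  rw [integral_sub i12 i3, integral_sub i1 i2, e1, e2, e5]
  simp_rw [sub_smul]
  rw [integral_sub i4 i2, sub_self]

/-- The points of `Ω` at distance more than `1 / (k + 1)` from the complement. -/
def innerSet (Ω : Set (E m)) (k : ℕ) : Set (E m) := (Metric.cthickening (1 / (k + 1)) Ωᶜ)ᶜ

lemma isOpen_innerSet (Ω : Set (E m)) (k : ℕ) : IsOpen (innerSet Ω k) :=
  Metric.isClosed_cthickening.isOpen_compl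

lemma mem_of_mem_innerSet {Ω : Set (E m)} {k : ℕ} {x y : E m} (hx : x ∈ innerSet Ω k)
    (hy : dist x y ≤ 1 / (k + 1)) : y ∈ Ω := by
  by_contra hyΩ
  exact hx (Metric.mem_cthickening_of_dist_le x y _ _ hyΩ hy)

lemma exists_mem_innerSet {Ω : Set (E m)} (hΩ : IsOpen Ω) {x : E m} (hx : x ∈ Ω) :
    ∃ k, ∀ l ≥ k, x ∈ innerSet Ω l := by
  obtain ⟨r, hr, hball⟩ := Metric.isOpen_iff.1 hΩ x hx
  obtain ⟨k, hk⟩ := exists_nat_one_div_lt hr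
  refine ⟨k, fun l hl hmem => ?_⟩
  have hlk : (1 : ℝ) / (l + 1) ≤ 1 / (k + 1) := by gcongr
  obtain ⟨z, hz, hxz⟩ := Metric.mem_thickening_iff.1
    (Metric.cthickening_subset_thickening' hr (hlk.trans_lt hk) _ hmem)
  exact hz (hball (by rwa [Metric.mem_ball, dist_comm]))

lemma lintegral_comp_add_smul (x : E m) {t : ℝ} (ht : 0 < t) {F : E m → ℝ≥0∞}
    (hF : Measurable F) :
    ∫⁻ η, F (x + t • η) = ENNReal.ofReal ((t ^ m)⁻¹) * ∫⁻ z, F z := by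
  have h1 : Measurable fun z => F (x + z) := hF.comp (measurable_const_add x)
  calc ∫⁻ η, F (x + t • η) = ∫⁻ z, F (x + z) ∂(Measure.map (t • ·) volume) := by
        rw [lintegral_map h1 (measurable_const_smul t)]
    _ = ENNReal.ofReal ((t ^ m)⁻¹) * ∫⁻ z, F (x + z) := by
        rw [Measure.map_addHaar_smul _ ht.ne', lintegral_smul_measure, smul_eq_mul,
          finrank_euclideanSpace_fin, abs_of_pos (by positivity)]
    _ = _ := by rw [lintegral_add_left_eq_self]

/-- At a Lebesgue point `x` of `D`, the averages of `D` over segments from `x` are close to `D x`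
in the mean. -/
lemma lintegral_segments_le {D : E m → E m →L[ℝ] E n} (hDm : StronglyMeasurable D) {x : E m}
    {r : ℝ} {δ : ℝ≥0∞} (hδ : ∀ s, 0 < s → s ≤ r →
      ∫⁻ z in Metric.closedBall x s, ‖D z - D x‖ₑ ≤ δ * volume (Metric.closedBall x s)) (hr : 0 < r) :
    ∫⁻ η in Metric.ball 0 r, ∫⁻ t in Ioc (0 : ℝ) 1, ‖D (x + t • η) - D x‖ₑ
      ≤ δ * volume (Metric.ball x r) := by
  rw [lintegral_lintegral_swap]
  swap
  · exact ((hDm.comp_measurable (by fun_prop)).sub stronglyMeasurable_const).enorm.aemeasurable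
  have hin : ∀ t ∈ Ioc (0 : ℝ) 1, ∫⁻ η in Metric.ball 0 r, ‖D (x + t • η) - D x‖ₑ
      ≤ δ * volume (Metric.ball x r) := by
    intro t ht
    set F : E m → ℝ≥0∞ := (Metric.closedBall x (t * r)).indicator fun z => ‖D z - D x‖ₑ with hF
    have hFm : Measurable F :=
      (hDm.sub stronglyMeasurable_const).enorm.indicator Metric.isClosed_closedBall.measurableSet
    have h1 : ∫⁻ η in Metric.ball 0 r, ‖D (x + t • η) - D x‖ₑ ≤ ∫⁻ η, F (x + t • η) := by
      refine (setLIntegral_mono' Metric.isOpen_ball.measurableSet fun η hη => ?_).trans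
        (setLIntegral_le_lintegral _ _)
      rw [hF, indicator_of_mem]
      rw [Metric.mem_closedBall, dist_self_add_left, norm_smul, Real.norm_of_nonneg ht.1.le]
      rw [mem_ball_zero_iff] at hη
      exact mul_le_mul_of_nonneg_left hη.le ht.1.le
    refine h1.trans ?_
    have htr : 0 < t * r := mul_pos ht.1 hr
    rw [lintegral_comp_add_smul x ht.1 hFm, hF,
      lintegral_indicator Metric.isClosed_closedBall.measurableSet]
    refine (mul_le_mul_right (hδ (t * r) htr (by nlinarith [ht.2])) _).trans ?_
    rw [Measure.addHaar_closedBall _ _ htr.le, ← Measure.addHaar_ball_of_pos _ x htr,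
      volume_ball_scale x x hr htr,
      mul_left_comm, ← mul_assoc (ENNReal.ofReal _), ← ENNReal.ofReal_mul (by have := ht.1; positivity)]
    rw [mul_div_cancel_right₀ _ hr.ne', inv_mul_cancel₀ (pow_pos ht.1 m).ne']
    simp
  refine (setLIntegral_mono' measurableSet_Ioc hin).trans ?_
  simp

/-- Sobolev maps are approximately differentiable almost everywhere: by the formula along segments
and Markov's inequality, this holds at Lebesgue points of the differential. -/
theorem IsWeakDeriv.ae_hasApproxDerivAt_of_integrable {Ω : Set (E m)} (hΩ : IsOpen Ω)
    {u : E m → E n} {D : E m → E m →L[ℝ] E n} (h : IsWeakDeriv Ω u D)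
    (hum : StronglyMeasurable u) (hu : Integrable u) (hDm : StronglyMeasurable D)
    (hD : Integrable D) : ∀ᵐ x, x ∈ Ω → HasApproxDerivAt u (D x) x := by
  have hseg : ∀ k : ℕ, ∀ᵐ x, ∀ᵐ η : E m, ‖η‖ ≤ 1 / (k + 1) → x ∈ innerSet Ω k →
      u (x + η) - u x = ∫ t in Ioc (0 : ℝ) 1, D (x + t • η) η := by
    intro k
    have hmeas : MeasurableSet {q : E m × E m | ‖q.2‖ ≤ 1 / (k + 1) → q.1 ∈ innerSet Ω k →
        u (q.1 + q.2) - u q.1 = ∫ t in Ioc (0 : ℝ) 1, D (q.1 + t • q.2) q.2} := by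
      refine MeasurableSet.imp (measurableSet_le (by fun_prop) (by fun_prop)) (MeasurableSet.imp
        (measurable_fst (isOpen_innerSet Ω k).measurableSet) ?_)
      refine StronglyMeasurable.measurableSet_eq_fun
        ((hum.comp_measurable (by fun_prop)).sub (hum.comp_measurable (by fun_prop))) ?_
      refine StronglyMeasurable.integral_prod_right
        (f := fun (q : E m × E m) (t : ℝ) => D (q.1 + t • q.2) q.2) ?_
      have h1 : StronglyMeasurable fun q : (E m × E m) × ℝ => D (q.1.1 + q.2 • q.1.2) :=
        hDm.comp_measurable (by fun_prop)
      have h2 : StronglyMeasurable fun q : (E m × E m) × ℝ => q.1.2 :=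
        (measurable_snd.comp measurable_fst).stronglyMeasurable
      exact (isBoundedBilinearMap_apply (𝕜 := ℝ) (E := E m) (F := E n)).continuous.comp_stronglyMeasurable
        (h1.prodMk h2)
    rw [Measure.ae_ae_comm hmeas]
    refine ae_of_all _ fun η => ?_
    by_cases hη : ‖η‖ ≤ 1 / (k + 1)
    · have hη' : ∀ x ∈ innerSet Ω k, ∀ t : ℝ, t ∈ Ioc (0 : ℝ) 1 → x + t • η ∈ Ω := by
        intro x hx t ht
        refine mem_of_mem_innerSet hx (le_trans ?_ hη)
        rw [dist_self_add_right, norm_smul, Real.norm_of_nonneg ht.1.le]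
        exact mul_le_of_le_one_left (norm_nonneg _) ht.2
      filter_upwards [h.ae_eq_integral_segment hu hDm hD (isOpen_innerSet Ω k) hη']
        with x hx _ using hx
    · exact ae_of_all _ fun x h' => absurd h' hη
  filter_upwards [ae_all_iff.2 hseg,
    (Besicovitch.vitaliFamily volume).ae_tendsto_lintegral_enorm_sub_div hD.locallyIntegrable]
    with x hx hleb hxΩ
  obtain ⟨k, hk⟩ := exists_mem_innerSet hΩ hxΩ
  have hxk := hk k le_rfl
  have hleb' := hleb.comp (Besicovitch.tendsto_filterAt volume x)
  intro ε hε
  rw [ENNReal.tendsto_nhds_zero]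
  intro δ hδ
  have hδ' : 0 < ENNReal.ofReal ε * δ := ENNReal.mul_pos (by simpa using hε) hδ.ne'
  obtain ⟨ρ, hρ, hsub⟩ := mem_nhdsGT_iff_exists_Ioo_subset.1 (hleb'.eventually (ge_mem_nhds hδ'))
  have hmin : 0 < min ρ (1 / (k + 1)) := lt_min hρ (by positivity)
  filter_upwards [Ioo_mem_nhdsGT hmin] with r hr
  obtain ⟨hr0, hr1⟩ := hr
  have hrρ := hr1.trans_le (min_le_left _ _)
  have hrk := hr1.trans_le (min_le_right _ _)
  have hball := lintegral_segments_le hDm (x := x) (r := r) (δ := ENNReal.ofReal ε * δ)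
    (fun s hs hsr => by
      have h1 : _ / _ ≤ _ := mem_ofPred_eq ▸ hsub ⟨hs, hsr.trans_lt hrρ⟩
      rwa [ENNReal.div_le_iff (Metric.measure_closedBall_pos _ _ hs).ne'
        measure_closedBall_lt_top.ne] at h1) hr0
  refine ENNReal.div_le_of_le_mul ?_
  set G : E m → ℝ≥0∞ := fun η => ∫⁻ t in Ioc (0 : ℝ) 1, ‖D (x + t • η) - D x‖ₑ with hG
  have hGm : Measurable G := by
    refine Measurable.lintegral_prod_right' (f := fun q : E m × ℝ => ‖D (x + q.2 • q.1) - D x‖ₑ) ?_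
    exact ((hDm.comp_measurable (by fun_prop)).sub stronglyMeasurable_const).enorm
  have htrans : volume {y ∈ Metric.ball x r | ε * ‖y - x‖ < ‖u y - u x - D x (y - x)‖}
      = volume {η ∈ Metric.ball (0 : E m) r | ε * ‖η‖ < ‖u (x + η) - u x - D x η‖} := by
    rw [← measure_preimage_add volume x]
    congr 1
    ext η
    simp
  have hle : volume {η ∈ Metric.ball (0 : E m) r | ε * ‖η‖ < ‖u (x + η) - u x - D x η‖}
      ≤ (volume.restrict (Metric.ball (0 : E m) r)) {η | ENNReal.ofReal ε ≤ G η} := by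
    rw [Measure.restrict_apply (measurableSet_le measurable_const hGm)]
    refine measure_mono_ae ?_
    filter_upwards [hx k] with η hη hmem
    obtain ⟨hηr, hηε⟩ : η ∈ Metric.ball (0 : E m) r ∧ ε * ‖η‖ < ‖u (x + η) - u x - D x η‖ := hmem
    refine ⟨?_, hηr⟩
    change ENNReal.ofReal ε ≤ G η
    rcases eq_or_ne (G η) ⊤ with htop | htop
    · rw [htop]; exact le_top
    rw [mem_ball_zero_iff] at hηr
    rw [hη (hηr.le.trans hrk.le) hxk] at hηε
    have hi : Integrable (fun t : ℝ => D (x + t • η) - D x) (volume.restrict (Ioc (0 : ℝ) 1)) :=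
      ⟨((hDm.comp_measurable (by fun_prop)).sub stronglyMeasurable_const).aestronglyMeasurable,
        lt_top_iff_ne_top.2 htop⟩
    have hi' : Integrable (fun t : ℝ => D (x + t • η) η) (volume.restrict (Ioc (0 : ℝ) 1)) := by
      have := (ContinuousLinearMap.apply ℝ (E n) η).integrable_comp (hi.add (integrable_const (D x)))
      simpa using this
    have heq : ∫ t in Ioc (0 : ℝ) 1, D (x + t • η) η - D x η
        = (∫ t in Ioc (0 : ℝ) 1, D (x + t • η) η) - D x η := by
      rw [integral_sub hi' (integrable_const _)]
      simp
    rw [← heq] at hηε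
    have h1 : ‖∫ t in Ioc (0 : ℝ) 1, D (x + t • η) η - D x η‖ₑ ≤ G η * ‖η‖ₑ := by
      refine (enorm_integral_le_lintegral_enorm _).trans ?_
      rw [hG, ← lintegral_mul_const' _ _ (by simp)]
      refine lintegral_mono fun t => ?_
      rw [← sub_apply]
      exact (D (x + t • η) - D x).le_opENorm η
    have h2 : ENNReal.ofReal ε * ‖η‖ₑ ≤ G η * ‖η‖ₑ := by
      refine le_trans ?_ h1
      rw [← ofReal_norm, ← ofReal_norm, ← ENNReal.ofReal_mul hε.le]
      exact ENNReal.ofReal_le_ofReal hηε.le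
    have hη0 : ‖η‖ₑ ≠ 0 := by
      intro h0
      rw [enorm_eq_zero] at h0
      simp [h0] at hηε
    exact (ENNReal.mul_le_mul_iff_left hη0 (by simp)).1 h2
  rw [htrans]
  refine hle.trans ((meas_ge_le_lintegral_div hGm.aemeasurable (by simpa using hε) (by simp)).trans ?_)
  refine ENNReal.div_le_of_le_mul (hball.trans_eq ?_)
  ring

/-! ### The Hausdorff measure on the graph of a Sobolev map -/

/-- `u ∈ W^{1,1}(Ω)` with weak differential `D`. -/
structure IsW11 (Ω : Set (E m)) (u : E m → E n) (D : E m → E m →L[ℝ] E n) : Prop where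
  int : IntegrableOn u Ω
  int_deriv : IntegrableOn D Ω
  weak : IsWeakDeriv Ω u D

lemma isFiniteMeasure_restrict {Ω : Set (E m)} (hΩb : Bornology.IsBounded Ω) :
    IsFiniteMeasure (volume.restrict Ω) :=
  ⟨by rw [Measure.restrict_apply_univ]; exact hΩb.measure_lt_top⟩

lemma MemSobolev.isW11 {Ω : Set (E m)} (hΩb : Bornology.IsBounded Ω) {p : ℝ≥0∞} (hp : 1 ≤ p)
    {u : E m → E n} {D : E m → E m →L[ℝ] E n} (h : MemSobolev Ω p u D) : IsW11 Ω u D := by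
  have := isFiniteMeasure_restrict hΩb
  exact ⟨h.1.integrable hp, h.2.1.integrable hp, h.2.2⟩

lemma HasApproxDerivAt.congr_ae {Ω : Set (E m)} (hΩ : IsOpen Ω) {u w : E m → E n}
    (huw : u =ᵐ[volume.restrict Ω] w) {x : E m} (hx : x ∈ Ω) (hux : u x = w x) {L : E m →L[ℝ] E n}
    (h : HasApproxDerivAt u L x) : HasApproxDerivAt w L x := by
  intro ε hε
  obtain ⟨ρ, hρ, hball⟩ := Metric.isOpen_iff.1 hΩ x hx
  refine (h ε hε).congr' ?_
  filter_upwards [Ioo_mem_nhdsGT hρ] with r hr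
  congr 1
  refine measure_congr ?_
  filter_upwards [(ae_restrict_iff' hΩ.measurableSet).1 huw] with y hy
  have : (y ∈ Metric.ball x r ∧ ε * ‖y - x‖ < ‖u y - u x - L (y - x)‖) =
      (y ∈ Metric.ball x r ∧ ε * ‖y - x‖ < ‖w y - w x - L (y - x)‖) := by
    refine propext (and_congr_right fun hyr => ?_)
    rw [hy (hball (Metric.ball_subset_ball hr.2.le hyr)), hux]
  exact this

lemma exists_integrable_extension {F : Type*} [NormedAddCommGroup F] {Ω : Set (E m)}
    (hΩ : MeasurableSet Ω) {f : E m → F} (hf : IntegrableOn f Ω) :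
    ∃ g : E m → F, StronglyMeasurable g ∧ f =ᵐ[volume.restrict Ω] g ∧ Integrable g := by
  obtain ⟨g, hg, hfg⟩ := hf.aestronglyMeasurable
  exact ⟨Ω.indicator g, hg.indicator hΩ, hfg.trans (indicator_ae_eq_restrict hΩ).symm,
    (IntegrableOn.congr_fun_ae hf hfg).integrable_indicator hΩ⟩

lemma IsWeakDeriv.congr_ae {Ω : Set (E m)} {u w : E m → E n} {D D' : E m → E m →L[ℝ] E n}
    (h : IsWeakDeriv Ω u D) (huw : u =ᵐ[volume.restrict Ω] w) (hDD : D =ᵐ[volume.restrict Ω] D')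
    (hw : Integrable w) (hD' : Integrable D') : IsWeakDeriv Ω w D' := by
  refine ⟨hw.locallyIntegrable.locallyIntegrableOn Ω,
    hD'.locallyIntegrable.locallyIntegrableOn Ω, fun φ hφ v => ?_⟩
  have e1 : ∫ x in Ω, (fderiv ℝ φ x v) • w x = ∫ x in Ω, (fderiv ℝ φ x v) • u x :=
    integral_congr_ae (huw.mono fun x hx => by simp only [hx])
  have e2 : ∫ x in Ω, φ x • D' x v = ∫ x in Ω, φ x • D x v :=
    integral_congr_ae (hDD.mono fun x hx => by simp only [hx])
  rw [e1, e2, h.2.2 φ hφ v]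

/-- An integrable Sobolev map agrees, up to null sets, with a measurable map defined everywhere
which is approximately differentiable, with a measurable approximate differential, at every point
of a Borel set of full measure. -/
lemma IsW11.exists_representative {Ω : Set (E m)} (hΩ : IsOpen Ω) {u : E m → E n}
    {D : E m → E m →L[ℝ] E n} (h : IsW11 Ω u D) :
    ∃ (w : E m → E n) (D' : E m → E m →L[ℝ] E n) (G : Set (E m)), Measurable w ∧ Measurable D' ∧
      MeasurableSet G ∧ G ⊆ Ω ∧ volume (Ω \ G) = 0 ∧ ∀ x ∈ G, u x = w x ∧ D x = D' x ∧
        HasApproxDerivAt u (D x) x ∧ HasApproxDerivAt w (D' x) x := by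
  obtain ⟨w, hwm, huw, hwi⟩ := exists_integrable_extension hΩ.measurableSet h.int
  obtain ⟨D', hD'm, hDD, hD'i⟩ := exists_integrable_extension hΩ.measurableSet h.int_deriv
  have hweak : IsWeakDeriv Ω w D' := h.weak.congr_ae huw hDD hwi hD'i
  have hae : ∀ᵐ x ∂(volume.restrict Ω), u x = w x ∧ D x = D' x ∧
        HasApproxDerivAt u (D x) x ∧ HasApproxDerivAt w (D' x) x := by
    have h0 := ae_restrict_of_ae (s := Ω)
      (hweak.ae_hasApproxDerivAt_of_integrable hΩ hwm hwi hD'm hD'i)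
    filter_upwards [huw, hDD, h0, ae_restrict_mem hΩ.measurableSet] with x h1 h2 h3 h4
    have h5 := h3 h4
    refine ⟨h1, h2, ?_, h5⟩
    rw [h2]
    exact h5.congr_ae hΩ huw.symm h4 h1.symm
  obtain ⟨t, hsub, htm, ht0⟩ := exists_measurable_superset_of_null (ae_iff.1 hae)
  have hdiff : Ω \ (Ω \ t) = t ∩ Ω := by rw [Set.sdiff_sdiff_right_self, inter_comm]
  refine ⟨w, D', Ω \ t, hwm.measurable, hD'm.measurable, hΩ.measurableSet.diff htm,
    sdiff_subset, ?_, ?_⟩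
  · rw [hdiff, ← Measure.restrict_apply htm]
    exact ht0
  · intro x hx
    by_contra hc
    exact hx.2 (hsub hc)

lemma sobolevGraph_eq_image (Ω : Set (E m)) (u : E m → E n) :
    sobolevGraph Ω u = graphPt u '' {x ∈ Ω | ∃ L, HasApproxDerivAt u L x} := by
  ext z
  constructor
  · rintro ⟨x, hx, hL, rfl⟩
    exact ⟨x, ⟨hx, hL⟩, rfl⟩
  · rintro ⟨x, ⟨hx, hL⟩, rfl⟩
    exact ⟨x, hx, hL, rfl⟩

/-- The area formula over a set of points of approximate differentiability. -/
theorem hausdorff_graphPt_image_of_hasApproxDerivAt {u : E m → E n} {L : E m → E m →L[ℝ] E n}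
    {B : Set (E m)} (hu : Measurable u) (hL : Measurable L) (hB : MeasurableSet B)
    (h : ∀ x ∈ B, HasApproxDerivAt u (L x) x) :
    hausdorff m n (graphPt u '' B) = ∫⁻ x in B, jac (L x) := by
  set S : ℕ → Set (E m) := fun k => B ∩ disjointed (slowSet u) k with hS
  have hSm : ∀ k, MeasurableSet (S k) := fun k =>
    hB.inter (MeasurableSet.disjointed (fun k => measurableSet_slowSet hu k) k)
  have hSd : Pairwise (Function.onFun Disjoint S) := fun i j hij =>
    (disjoint_disjointed (slowSet u) hij).mono inter_subset_right inter_subset_right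
  have hBS : B = ⋃ k, S k := by
    rw [hS, ← inter_iUnion, iUnion_disjointed, eq_comm, inter_eq_left]
    exact fun x hx => mem_iUnion.2 (h x hx).exists_mem_slowSet
  conv_lhs => rw [hBS, image_iUnion]
  conv_rhs => rw [hBS]
  rw [lintegral_iUnion hSm hSd, measure_iUnion]
  · refine tsum_congr fun k => hausdorff_graphPt_image hu hL (hSm k) fun x hx => ?_
    exact ((h x hx.1).hasFDerivWithinAt_graphPt k).mono
      (inter_subset_right.trans (disjointed_subset _ k))
  · exact fun i j hij => (disjoint_image_iff (graphPt_injective u)).2 (hSd hij)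
  · exact fun k =>
      (hSm k).image_of_measurable_injOn (measurable_graphPt hu) (graphPt_injective u).injOn

lemma IsW11.aemeasurable_graphPt {Ω : Set (E m)} {u : E m → E n}
    {D : E m → E m →L[ℝ] E n} (h : IsW11 Ω u D) : AEMeasurable (graphPt u) (volume.restrict Ω) :=
  continuous_pt.measurable.comp_aemeasurable (aemeasurable_id.prodMk h.int.1.aemeasurable)

lemma IsW11.aemeasurable_jac {Ω : Set (E m)} {u : E m → E n}
    {D : E m → E m →L[ℝ] E n} (h : IsW11 Ω u D) :
    AEMeasurable (fun x => jac (D x)) (volume.restrict Ω) :=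
  continuous_jac.measurable.comp_aemeasurable h.int_deriv.1.aemeasurable

/-- `ℋᵐ` on the graph is the image of `J(Du) dx`, and the graph is `ℋᵐ`-measurable. -/
theorem IsW11.restrict_sobolevGraph {Ω : Set (E m)} (hΩ : IsOpen Ω) {u : E m → E n}
    {D : E m → E m →L[ℝ] E n} (h : IsW11 Ω u D) :
    NullMeasurableSet (sobolevGraph Ω u) (hausdorff m n) ∧
    (hausdorff m n).restrict (sobolevGraph Ω u)
      = ((volume.restrict Ω).withDensity fun x => jac (D x)).map (graphPt u) := by
  obtain ⟨w, D', G, hw, hD', hG, hGΩ, hG0, hGp⟩ := h.exists_representative hΩ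
  -- the area formula is applied to the measurable representative `w`, over the Borel set `G`
  have hGae : (G : Set (E m)) =ᵐ[volume] Ω := by
    refine (ae_le_set.2 ?_).antisymm (ae_le_set.2 hG0)
    rw [sdiff_eq_empty.2 hGΩ, measure_empty]
  have hrestr : volume.restrict Ω = volume.restrict G := (Measure.restrict_congr_set hGae).symm
  have himg : graphPt u '' G = graphPt w '' G :=
    image_congr fun x hx => by rw [graphPt, graphPt, (hGp x hx).1]
  have hΓ : (sobolevGraph Ω u : Set (Amb m n)) =ᵐ[hausdorff m n] graphPt w '' G := by
    rw [← himg, sobolevGraph_eq_image]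
    refine (ae_le_set.2 ?_).antisymm (ae_le_set.2 ?_)
    · rw [← image_sdiff (graphPt_injective u)]
      refine hausdorff_graphPt_image_eq_zero (measure_mono_null ?_ hG0) fun x hx => hx.1.2
      exact sdiff_subset_sdiff_left fun x hx => hx.1
    · have : graphPt u '' G ⊆ graphPt u '' {x ∈ Ω | ∃ L, HasApproxDerivAt u L x} :=
        image_mono fun x hx => ⟨hGΩ hx, _, (hGp x hx).2.2.1⟩
      rw [sdiff_eq_empty.2 this, measure_empty]
  have hmeas : MeasurableSet (graphPt w '' G) :=
    hG.image_of_measurable_injOn (measurable_graphPt hw) (graphPt_injective w).injOn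
  refine ⟨hmeas.nullMeasurableSet.congr hΓ.symm, ?_⟩
  have haeG : ∀ᵐ x ∂(volume.restrict G), x ∈ G := ae_restrict_mem hG
  have hdens : (volume.restrict G).withDensity (fun x => (jac (D x) : ℝ≥0∞))
      = (volume.restrict G).withDensity (fun x => (jac (D' x) : ℝ≥0∞)) :=
    withDensity_congr_ae (haeG.mono fun x hx => by simp only [(hGp x hx).2.1])
  have hmap : ((volume.restrict G).withDensity (fun x => (jac (D' x) : ℝ≥0∞))).map (graphPt u)
      = ((volume.restrict G).withDensity (fun x => (jac (D' x) : ℝ≥0∞))).map (graphPt w) := by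
    refine Measure.map_congr ((withDensity_absolutelyContinuous _ _).ae_le ?_)
    exact haeG.mono fun x hx => by rw [graphPt, graphPt, (hGp x hx).1]
  rw [Measure.restrict_congr_set hΓ, hrestr, hdens, hmap]
  ext B hB
  have hpre := measurable_graphPt hw hB
  rw [Measure.restrict_apply hB, Measure.map_apply (measurable_graphPt hw) hB,
    withDensity_apply _ hpre, Measure.restrict_restrict hpre, ← image_preimage_inter,
    hausdorff_graphPt_image_of_hasApproxDerivAt hw hD' (hpre.inter hG)
      fun x hx => (hGp x hx.2).2.2.2]

lemma IsW11.ae_hasApproxDerivAt {Ω : Set (E m)} (hΩ : IsOpen Ω) {u : E m → E n}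
    {D : E m → E m →L[ℝ] E n} (h : IsW11 Ω u D) :
    ∀ᵐ x ∂(volume.restrict Ω), HasApproxDerivAt u (D x) x := by
  obtain ⟨w, D', G, -, -, hG, hGΩ, hG0, hGp⟩ := h.exists_representative hΩ
  rw [ae_restrict_iff' hΩ.measurableSet]
  refine measure_mono_null (fun x hx => ?_) hG0
  have hx' : ¬(x ∈ Ω → HasApproxDerivAt u (D x) x) := hx
  push Not at hx'
  exact ⟨hx'.1, fun hxG => hx'.2 (hGp x hxG).2.2.1⟩

/-- The mass of the graph in `K`. -/
lemma IsW11.hausdorff_sobolevGraph_inter {Ω : Set (E m)} (hΩ : IsOpen Ω) {u : E m → E n}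
    {D : E m → E m →L[ℝ] E n} (h : IsW11 Ω u D) {K : Set (Amb m n)} (hK : MeasurableSet K) :
    hausdorff m n (sobolevGraph Ω u ∩ K) = ∫⁻ x in graphPt u ⁻¹' K, jac (D x) ∂(volume.restrict Ω) := by
  have hac := withDensity_absolutelyContinuous (volume.restrict Ω) (fun x => (jac (D x) : ℝ≥0∞))
  rw [inter_comm, ← Measure.restrict_apply hK, (h.restrict_sobolevGraph hΩ).2,
    Measure.map_apply_of_aemeasurable (h.aemeasurable_graphPt.mono_ac hac) hK, withDensity_apply']

/-- Integrals over the graph in terms of the parametrization. -/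
lemma IsW11.setIntegral_sobolevGraph {Ω : Set (E m)} (hΩ : IsOpen Ω) {u : E m → E n}
    {D : E m → E m →L[ℝ] E n} (h : IsW11 Ω u D) {g : Amb m n → ℝ} (hg : Continuous g) :
    ∫ z in sobolevGraph Ω u, g z ∂(hausdorff m n) = ∫ x in Ω, jac (D x) * g (graphPt u x) := by
  have hac := withDensity_absolutelyContinuous (volume.restrict Ω) (fun x => (jac (D x) : ℝ≥0∞))
  rw [(h.restrict_sobolevGraph hΩ).2,
    integral_map (h.aemeasurable_graphPt.mono_ac hac) hg.aestronglyMeasurable,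
    integral_withDensity_eq_integral_smul₀ h.aemeasurable_jac]
  rfl

/-- Statements almost everywhere on the graph, in terms of the parametrization. -/
lemma IsW11.ae_sobolevGraph {Ω : Set (E m)} (hΩ : IsOpen Ω) {u : E m → E n}
    {D : E m → E m →L[ℝ] E n} (h : IsW11 Ω u D) {p : Amb m n → Prop}
    (hp : ∀ᵐ x ∂(volume.restrict Ω), p (graphPt u x)) :
    ∀ᵐ z ∂((hausdorff m n).restrict (sobolevGraph Ω u)), p z := by
  rw [ae_restrict_iff'₀ (h.restrict_sobolevGraph hΩ).1, ae_iff]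
  rw [ae_restrict_iff' hΩ.measurableSet, ae_iff] at hp
  refine measure_mono_null (fun z hz => ?_) (hausdorff_graphPt_image_eq_zero (u := u)
    (S := {x ∈ Ω | (∃ L, HasApproxDerivAt u L x) ∧ ¬p (graphPt u x)})
    (measure_mono_null (fun x hx => ?_) hp) fun x hx => hx.2.1)
  · have hz' : ¬(z ∈ sobolevGraph Ω u → p z) := hz
    push Not at hz'
    obtain ⟨⟨x, hx, hL, rfl⟩, hpz⟩ := hz'
    exact ⟨x, ⟨hx, hL, hpz⟩, rfl⟩
  · exact fun hx' => hx.2.2 (hx' hx.1)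

/-! ### Approximate tangent planes of Sobolev graphs -/

/-- The `L¹` estimate behind the blow-up of a graph at `x₀`: in the ball of radius `r R`, the
rescaled integrand of the graph is close to that of the plane. -/
lemma lintegral_blowup_le {u : E m → E n} {L : E m →L[ℝ] E n} {x₀ : E m} {a : E m → ℝ}
    (ha : AEMeasurable a) {f : Amb m n → ℝ} {M ε δ r R : ℝ} (hM : ∀ z, |f z| ≤ M) (hM0 : 0 ≤ M)
    (hε : 0 < ε) (hr : 0 < r) (hR : 0 < R)
    (hf : ∀ z z', ‖z - z'‖ < δ → |f z - f z'| ≤ ε)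
    (hleb : ∫⁻ x in Metric.ball x₀ (r * R), ‖a x - a x₀‖ₑ
      ≤ ENNReal.ofReal ε * volume (Metric.ball x₀ (r * R)))
    (hbad : volume {x ∈ Metric.ball x₀ (r * R) | δ / R * ‖x - x₀‖ < ‖u x - u x₀ - L (x - x₀)‖}
      ≤ ENNReal.ofReal ε * volume (Metric.ball x₀ (r * R))) (hδ : 0 < δ) :
    ∫⁻ x in Metric.ball x₀ (r * R), ‖a x * f (r⁻¹ • (graphPt u x - graphPt u x₀))
        - a x₀ * f (r⁻¹ • graphMap L (x - x₀))‖ₑ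
      ≤ ENNReal.ofReal ((M + |a x₀| * (1 + 2 * M)) * ε) * volume (Metric.ball x₀ (r * R)) := by
  set B := Metric.ball x₀ (r * R) with hB
  set bad := {x ∈ B | δ / R * ‖x - x₀‖ < ‖u x - u x₀ - L (x - x₀)‖} with hbad_def
  have hpt : ∀ x ∈ B, ‖a x * f (r⁻¹ • (graphPt u x - graphPt u x₀))
        - a x₀ * f (r⁻¹ • graphMap L (x - x₀))‖ₑ
      ≤ ENNReal.ofReal M * ‖a x - a x₀‖ₑ + (ENNReal.ofReal (|a x₀| * ε)
        + bad.indicator (fun _ => ENNReal.ofReal (|a x₀| * (2 * M))) x) := by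
    intro x hx
    set f₁ := f (r⁻¹ • (graphPt u x - graphPt u x₀)) with hf₁
    set f₂ := f (r⁻¹ • graphMap L (x - x₀)) with hf₂
    have h1 : a x * f₁ - a x₀ * f₂ = (a x - a x₀) * f₁ + a x₀ * (f₁ - f₂) := by ring
    rw [h1]
    refine (enorm_add_le _ _).trans (add_le_add ?_ ?_)
    · rw [enorm_mul, mul_comm]
      refine mul_le_mul_left ?_ _
      rw [← ofReal_norm, Real.norm_eq_abs]
      exact ENNReal.ofReal_le_ofReal (hM _)
    · by_cases hxb : x ∈ bad
      · rw [indicator_of_mem hxb, ← ofReal_norm, norm_mul, Real.norm_eq_abs, Real.norm_eq_abs]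
        refine le_trans (ENNReal.ofReal_le_ofReal ?_) le_add_self
        gcongr
        refine (abs_sub _ _).trans ?_
        linarith [hM (r⁻¹ • (graphPt u x - graphPt u x₀)), hM (r⁻¹ • graphMap L (x - x₀))]
      · rw [indicator_of_notMem hxb, add_zero, ← ofReal_norm, norm_mul, Real.norm_eq_abs,
          Real.norm_eq_abs]
        refine ENNReal.ofReal_le_ofReal ?_
        gcongr
        refine hf _ _ ?_
        have h2 : graphPt u x - graphPt u x₀ - graphMap L (x - x₀)
            = pt 0 (u x - u x₀ - L (x - x₀)) := by
          rw [graphPt, graphPt, graphMap_apply, pt_sub, pt_sub, sub_self]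
        rw [← smul_sub, h2, norm_smul, norm_pt_zero, norm_inv, Real.norm_of_nonneg hr.le,
          inv_mul_lt_iff₀ hr]
        have h3 : ‖u x - u x₀ - L (x - x₀)‖ ≤ δ / R * ‖x - x₀‖ :=
          not_lt.1 fun hlt => hxb ⟨hx, hlt⟩
        refine h3.trans_lt ?_
        rw [hB, Metric.mem_ball, dist_eq_norm] at hx
        calc δ / R * ‖x - x₀‖ < δ / R * (r * R) := by gcongr
          _ = r * δ := by field_simp
  refine (setLIntegral_mono' Metric.isOpen_ball.measurableSet hpt).trans ?_
  rw [lintegral_add_left' (((ha.sub_const _).enorm.const_mul _).restrict),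
    lintegral_add_left measurable_const, lintegral_const_mul' _ _ ENNReal.ofReal_ne_top,
    setLIntegral_const]
  have h4 : ∫⁻ x in B, bad.indicator (fun _ => ENNReal.ofReal (|a x₀| * (2 * M))) x
      ≤ ENNReal.ofReal (|a x₀| * (2 * M)) * (ENNReal.ofReal ε * volume B) := by
    refine (lintegral_indicator_const_le _ _).trans (mul_le_mul_right ?_ _)
    exact (Measure.restrict_apply_le _ _).trans hbad
  refine (add_le_add (mul_le_mul_right hleb _) (add_le_add le_rfl h4)).trans_eq ?_
  rw [← mul_assoc, ← mul_assoc, ← add_mul, ← add_mul, ← ENNReal.ofReal_mul hM0,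
    ← ENNReal.ofReal_mul (by positivity), ← ENNReal.ofReal_add (by positivity) (by positivity),
    ← ENNReal.ofReal_add (by positivity) (by positivity)]
  congr 2
  ring

/-- A point of approximate differentiability which is a Lebesgue point of the Jacobian has the graph
of the approximate differential as its approximate tangent plane. The Jacobian need only be
integrable near the point of the graph, as expressed by `a`. -/
lemma isApproxTangent_of_lebesgue {Ω : Set (E m)} (hΩ : IsOpen Ω) {u : E m → E n}
    {D : E m → E m →L[ℝ] E n} (h : IsW11 Ω u D) {x₀ : E m} (hx₀ : x₀ ∈ Ω)
    (hL : HasApproxDerivAt u (D x₀) x₀) {a : E m → ℝ} (ha : Integrable a) {ρ : ℝ} (hρ : 0 < ρ)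
    (hax : ∀ x ∈ Ω, ‖graphPt u x - graphPt u x₀‖ < ρ → a x = jac (D x))
    (hleb : Tendsto (fun s => (∫⁻ y in Metric.closedBall x₀ s, ‖a y - a x₀‖ₑ)
      / volume (Metric.closedBall x₀ s)) (𝓝[>] 0) (𝓝 0)) :
    IsApproxTangent (sobolevGraph Ω u) (graphPt u x₀) (tangentProj (D x₀)) := by
  intro f hf hfs
  set L := D x₀
  have ha0 : a x₀ = jac L := hax x₀ hx₀ (by simpa using hρ)
  obtain ⟨M, hM⟩ := hfs.exists_bound_of_continuous hf
  simp_rw [Real.norm_eq_abs] at hM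
  have hM0 : 0 ≤ M := (abs_nonneg _).trans (hM 0)
  obtain ⟨R, hR, hsupp⟩ : ∃ R > 0, ∀ z, f z ≠ 0 → ‖z‖ < R := by
    obtain ⟨R, hR, hsub⟩ := hfs.isCompact.isBounded.subset_ball_lt 0 0
    exact ⟨R, hR, fun z hz => by simpa using hsub (subset_tsupport f hz)⟩
  obtain ⟨ρ', hρ', hballΩ⟩ := Metric.isOpen_iff.1 hΩ x₀ hx₀
  have huc := hfs.uniformContinuous_of_continuous hf
  set V := (volume (Metric.ball (0 : E m) R)).toReal with hV
  set C := (M + |a x₀| * (1 + 2 * M)) * V with hC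
  have hC0 : 0 ≤ C := by positivity
  rw [Metric.tendsto_nhds]
  intro ε' hε'
  set ε := ε' / (C + 1) with hε_def
  have hε : 0 < ε := by positivity
  have hCε : C * ε < ε' := by
    rw [hε_def, ← mul_div_assoc, div_lt_iff₀ (by positivity)]
    nlinarith
  obtain ⟨δ, hδ, hfδ⟩ := Metric.uniformContinuous_iff.1 huc ε hε
  obtain ⟨ρ₁, hρ₁, hbad⟩ := hL.exists_radius (ε := δ / R) (by positivity)
    (η := ENNReal.ofReal ε) (by simpa using hε)
  obtain ⟨ρ₂, hρ₂, hsub⟩ := mem_nhdsGT_iff_exists_Ioo_subset.1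
    (hleb.eventually (ge_mem_nhds (ENNReal.ofReal_pos.2 hε)))
  have hmin : 0 < min (min ρ ρ') (min ρ₁ ρ₂) / R := by
    have : 0 < ρ₂ := hρ₂
    positivity
  filter_upwards [Ioo_mem_nhdsGT hmin] with r ⟨hr, hrlt⟩
  rw [lt_div_iff₀ hR, lt_min_iff, lt_min_iff, lt_min_iff] at hrlt
  obtain ⟨⟨hrρ, hrρ'⟩, hrρ₁, hrρ₂⟩ := hrlt
  have hrR : 0 < r * R := by positivity
  set B := Metric.ball x₀ (r * R) with hB
  have hBΩ : B ⊆ Ω := (Metric.ball_subset_ball hrρ'.le).trans hballΩ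
  have hvol : volume B = ENNReal.ofReal (r ^ m) * volume (Metric.ball (0 : E m) R) := by
    rw [hB, volume_ball_scale x₀ 0 hR hrR, mul_div_cancel_right₀ _ hR.ne']
  set F : E m → ℝ := fun x => a x * f (r⁻¹ • (graphPt u x - graphPt u x₀)) with hF
  set G : E m → ℝ := fun x => a x₀ * f (r⁻¹ • graphMap L (x - x₀)) with hG
  have hsmall : ∀ z : Amb m n, f (r⁻¹ • z) ≠ 0 → ‖z‖ < r * R := by
    intro z hz
    have := hsupp _ hz
    rwa [norm_smul, norm_inv, Real.norm_of_nonneg hr.le, inv_mul_lt_iff₀ hr] at this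
  -- both integrals reduce to integrals over `B`
  have hI : ∫ z in sobolevGraph Ω u, f (r⁻¹ • (z - graphPt u x₀)) ∂(hausdorff m n)
      = ∫ x in B, F x := by
    rw [h.setIntegral_sobolevGraph hΩ (g := fun z => f (r⁻¹ • (z - graphPt u x₀)))
      (hf.comp (by fun_prop))]
    rw [setIntegral_eq_of_subset_of_forall_sdiff_eq_zero hΩ.measurableSet hBΩ (f := fun x =>
      (jac (D x) : ℝ) * f (r⁻¹ • (graphPt u x - graphPt u x₀)))]
    · refine setIntegral_congr_fun Metric.isOpen_ball.measurableSet fun x hx => ?_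
      simp only [hF]
      by_cases h0 : f (r⁻¹ • (graphPt u x - graphPt u x₀)) = 0
      · rw [h0, mul_zero, mul_zero]
      · rw [hax x (hBΩ hx) ((hsmall _ h0).trans hrρ)]
    · intro x hx
      by_contra h0
      refine hx.2 ?_
      have h1 := hsmall _ (right_ne_zero_of_mul h0)
      rw [graphPt, graphPt, pt_sub] at h1
      rw [hB, Metric.mem_ball, dist_eq_norm]
      exact (norm_le_norm_pt _ _).trans_lt h1
  have hT : ∫ z in plane (tangentProj L), f z ∂(hausdorff m n) = (r ^ m)⁻¹ * ∫ x in B, G x := by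
    have h1 : ∫ x in B, G x = ∫ x, G x := by
      refine setIntegral_eq_integral_of_forall_compl_eq_zero fun x hx => ?_
      by_contra h0
      refine hx ?_
      have h1 := hsmall _ (right_ne_zero_of_mul h0)
      rw [hB, Metric.mem_ball, dist_eq_norm]
      exact (norm_le_norm_graphMap L _).trans_lt h1
    rw [h1, setIntegral_plane, ha0.symm]
    have h2 := integral_sub_right_eq_self (μ := (volume : Measure (E m)))
      (fun x => a x₀ * f (r⁻¹ • graphMap L x)) x₀
    have h3 := Measure.integral_comp_smul (volume : Measure (E m))
      (fun x => a x₀ * f (graphMap L x)) r⁻¹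
    simp only [map_smul] at h3
    rw [hG, h2, h3, finrank_euclideanSpace_fin, inv_pow, inv_inv, abs_of_pos (by positivity),
      smul_eq_mul, ← mul_assoc, inv_mul_cancel₀ (by positivity), one_mul]
  have hFi : IntegrableOn F B := by
    have h1 : AEStronglyMeasurable (fun x => f (r⁻¹ • (graphPt u x - graphPt u x₀)))
        (volume.restrict B) := by
      have := (h.aemeasurable_graphPt.mono_measure (Measure.restrict_mono hBΩ le_rfl))
      exact (hf.measurable.comp_aemeasurable
        ((this.sub_const (graphPt u x₀)).const_smul r⁻¹)).aestronglyMeasurable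
    exact ha.integrableOn.mul_bdd (c := M) h1 (ae_of_all _ fun x => hM _)
  have hGi : IntegrableOn G B := by
    have : IsFiniteMeasure (volume.restrict B) := isFiniteMeasure_restrict Metric.isBounded_ball
    refine Integrable.mono' (g := fun _ => |a x₀| * M) (integrable_const _) ?_ ?_
    · exact (continuous_const.mul (hf.comp (by fun_prop))).aestronglyMeasurable
    · refine ae_of_all _ fun x => ?_
      rw [hG, norm_mul, Real.norm_eq_abs, Real.norm_eq_abs]
      gcongr
      exact hM _
  have hest : ‖(∫ x in B, F x) - ∫ x in B, G x‖ ≤ r ^ m * (C * ε) := by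
    rw [← integral_sub hFi hGi]
    have h1 := (enorm_integral_le_lintegral_enorm (μ := volume.restrict B) (fun x => F x - G x)).trans
      (lintegral_blowup_le (u := u) (L := L) (x₀ := x₀) ha.1.aemeasurable hM hM0 hε hr hR
      (fun z z' hzz => (hfδ (by rwa [dist_eq_norm])).le) ?_ (hbad _ hrR hrρ₁) hδ)
    · rw [← hB, hvol, ← ofReal_norm, ← ENNReal.ofReal_toReal (a := volume (Metric.ball (0 : E m) R))
        measure_ball_lt_top.ne, ← ENNReal.ofReal_mul (by positivity), ← ENNReal.ofReal_mul
        (by positivity)] at h1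
      refine ((ENNReal.ofReal_le_ofReal_iff (by positivity)).1 h1).trans_eq ?_
      rw [hC, hV]
      ring
    · have h2 : _ / _ ≤ _ := mem_ofPred_eq ▸ hsub ⟨hrR, hrρ₂⟩
      rw [ENNReal.div_le_iff (Metric.measure_closedBall_pos _ _ hrR).ne'
        measure_closedBall_lt_top.ne, Measure.addHaar_closedBall _ _ hrR.le,
        ← Measure.addHaar_ball_of_pos _ x₀ hrR] at h2
      exact (lintegral_mono_set Metric.ball_subset_closedBall).trans h2
  rw [hI, hT, Real.dist_eq, ← mul_sub, abs_mul, abs_of_pos (by positivity)]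
  rw [Real.norm_eq_abs] at hest
  calc (r ^ m)⁻¹ * |(∫ x in B, F x) - ∫ x in B, G x| ≤ (r ^ m)⁻¹ * (r ^ m * (C * ε)) := by gcongr
    _ = C * ε := by rw [← mul_assoc, inv_mul_cancel₀ (by positivity), one_mul]
    _ < ε' := hCε

/-- A compact exhaustion of `Ω × ℝⁿ`. -/
def cylinderPiece (n : ℕ) (Ω : Set (E m)) (k : ℕ) : Set (Amb m n) :=
  {z | horiz m n z ∈ (Metric.thickening (1 / (k + 1)) Ωᶜ)ᶜ ∧ ‖vert m n z‖ ≤ k}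

lemma isClosed_cylinderPiece (Ω : Set (E m)) (k : ℕ) : IsClosed (cylinderPiece n Ω k) :=
  (Metric.isOpen_thickening.isClosed_compl.preimage (horiz m n).continuous).inter
    (isClosed_le (vert m n).continuous.norm continuous_const)

lemma cylinderPiece_subset (Ω : Set (E m)) (k : ℕ) :
    cylinderPiece n Ω k ⊆ domainCylinder n Ω := by
  intro z hz
  refine ⟨horiz m n z, ?_, vert m n z, (pt_horiz_vert z).symm⟩
  by_contra hc
  exact hz.1 (Metric.self_subset_thickening (by positivity) _ hc)

lemma isCompact_cylinderPiece {Ω : Set (E m)} (hΩb : Bornology.IsBounded Ω) (k : ℕ) :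
    IsCompact (cylinderPiece n Ω k) := by
  obtain ⟨R, hR⟩ := hΩb.exists_norm_le
  refine Metric.isCompact_of_isClosed_isBounded (isClosed_cylinderPiece Ω k) ?_
  refine isBounded_iff_forall_norm_le.2 ⟨R + k, fun z hz => ?_⟩
  obtain ⟨x, hx, y, rfl⟩ := cylinderPiece_subset Ω k hz
  exact (norm_pt_le x y).trans (add_le_add (hR x hx) hz.2)

lemma mem_cylinderPiece_of_mem_innerSet {Ω : Set (E m)} {k : ℕ} {x : E m} {y : E n}
    (hx : x ∈ innerSet Ω k) (hy : ‖y‖ ≤ k) : pt x y ∈ cylinderPiece n Ω k :=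
  ⟨fun hc => hx (Metric.thickening_subset_cthickening _ _ hc), hy⟩

lemma IsW11.integrable_jac_indicator {Ω : Set (E m)} (hΩ : IsOpen Ω) {u : E m → E n}
    {D : E m → E m →L[ℝ] E n} (h : IsW11 Ω u D) {K : Set (Amb m n)} (hK : MeasurableSet K)
    (hfin : hausdorff m n (sobolevGraph Ω u ∩ K) < ⊤) :
    Integrable (Ω.indicator ((graphPt u ⁻¹' K).indicator fun x => (jac (D x) : ℝ))) := by
  refine IntegrableOn.integrable_indicator ?_ hΩ.measurableSet
  have hKm : NullMeasurableSet (graphPt u ⁻¹' K) (volume.restrict Ω) :=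
    h.aemeasurable_graphPt.nullMeasurable hK
  refine IntegrableOn.integrable_indicator₀ ?_ hKm
  refine ⟨(NNReal.continuous_coe.measurable.comp_aemeasurable
    h.aemeasurable_jac).aestronglyMeasurable.restrict, ?_⟩
  rw [h.hausdorff_sobolevGraph_inter hΩ hK] at hfin
  simpa [HasFiniteIntegral] using hfin

/-- The graph of `Du(x)` is the approximate tangent plane at almost every point of the graph. -/
theorem IsW11.ae_isApproxTangent {Ω : Set (E m)} (hΩ : IsOpen Ω) (hΩb : Bornology.IsBounded Ω)
    {u : E m → E n} {D : E m → E m →L[ℝ] E n} (h : IsW11 Ω u D)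
    (hfin : ∀ K, IsCompact K → K ⊆ domainCylinder n Ω → hausdorff m n (sobolevGraph Ω u ∩ K) < ⊤) :
    ∀ᵐ x ∂(volume.restrict Ω),
      IsApproxTangent (sobolevGraph Ω u) (graphPt u x) (tangentProj (D x)) := by
  -- the Jacobian may fail to be locally integrable on `Ω`, but it is integrable where the graph lies
  -- in a given compact set
  set a : ℕ → E m → ℝ := fun k =>
    Ω.indicator ((graphPt u ⁻¹' cylinderPiece n Ω k).indicator fun x => (jac (D x) : ℝ)) with ha_def
  have ha : ∀ k, Integrable (a k) := fun k =>
    h.integrable_jac_indicator hΩ (isClosed_cylinderPiece Ω k).measurableSet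
      (hfin _ (isCompact_cylinderPiece hΩb k) (cylinderPiece_subset Ω k))
  have hleb : ∀ᵐ x, ∀ k, Tendsto (fun s => (∫⁻ y in s, ‖a k y - a k x‖ₑ) / volume s)
      ((Besicovitch.vitaliFamily volume).filterAt x) (𝓝 0) :=
    ae_all_iff.2 fun k =>
      (Besicovitch.vitaliFamily volume).ae_tendsto_lintegral_enorm_sub_div (ha k).locallyIntegrable
  filter_upwards [ae_restrict_of_ae hleb, h.ae_hasApproxDerivAt hΩ, ae_restrict_mem hΩ.measurableSet]
    with x₀ hx₀ hL hxΩ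
  obtain ⟨k₁, hk₁⟩ := exists_mem_innerSet hΩ hxΩ
  obtain ⟨k₂, hk₂⟩ := exists_nat_ge (‖u x₀‖ + 1)
  set k := max k₁ k₂
  obtain ⟨ρ, hρ, hball⟩ := Metric.isOpen_iff.1 (isOpen_innerSet Ω k) x₀ (hk₁ k (le_max_left _ _))
  refine isApproxTangent_of_lebesgue hΩ h hxΩ hL (ha k) (lt_min hρ one_pos) (fun x hx hlt => ?_)
    ((hx₀ k).comp (Besicovitch.tendsto_filterAt volume x₀))
  rw [graphPt, graphPt, pt_sub, lt_min_iff] at hlt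
  have h1 : x ∈ innerSet Ω k :=
    hball (by rw [Metric.mem_ball, dist_eq_norm]; exact (norm_le_norm_pt _ _).trans_lt hlt.1)
  have h2 : ‖u x‖ ≤ k := by
    have h3 := (norm_le_norm_pt' (x - x₀) (u x - u x₀)).trans_lt hlt.2
    have h4 := norm_sub_norm_le (u x) (u x₀)
    have h5 : (k₂ : ℝ) ≤ k := by exact_mod_cast le_max_right k₁ k₂
    linarith
  have h3 : x ∈ graphPt u ⁻¹' cylinderPiece n Ω k := mem_cylinderPiece_of_mem_innerSet h1 h2
  simp only [ha_def]
  rw [indicator_of_mem hx, indicator_of_mem h3]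

lemma approxTangent_eq {Γ : Set (Amb m n)} {y : Amb m n} {L : E m →L[ℝ] E n}
    (h : IsApproxTangent Γ y (tangentProj L)) : approxTangent Γ y = tangentProj L :=
  h.eq_tangentProj (Classical.epsilon_spec ⟨_, h⟩)

/-- The tangent plane at `z` of the graph of a map with differential `D`. -/
lemma IsW11.ae_approxTangent_eq {Ω : Set (E m)} (hΩ : IsOpen Ω) (hΩb : Bornology.IsBounded Ω)
    {u : E m → E n} {D : E m → E m →L[ℝ] E n} (h : IsW11 Ω u D)
    (hfin : ∀ K, IsCompact K → K ⊆ domainCylinder n Ω → hausdorff m n (sobolevGraph Ω u ∩ K) < ⊤) :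
    ∀ᵐ z ∂((hausdorff m n).restrict (sobolevGraph Ω u)),
      IsApproxTangent (sobolevGraph Ω u) z (tangentProj (D (horiz m n z))) ∧
      approxTangent (sobolevGraph Ω u) z = tangentProj (D (horiz m n z)) := by
  refine h.ae_sobolevGraph hΩ ((h.ae_isApproxTangent hΩ hΩb hfin).mono fun x hx => ?_)
  exact ⟨hx, approxTangent_eq hx⟩

lemma IsW11.aemeasurable_approxTangent {Ω : Set (E m)} (hΩ : IsOpen Ω)
    (hΩb : Bornology.IsBounded Ω) {u : E m → E n} {D : E m → E m →L[ℝ] E n} (h : IsW11 Ω u D)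
    (hfin : ∀ K, IsCompact K → K ⊆ domainCylinder n Ω → hausdorff m n (sobolevGraph Ω u ∩ K) < ⊤) :
    AEMeasurable (approxTangent (sobolevGraph Ω u))
      ((hausdorff m n).restrict (sobolevGraph Ω u)) := by
  obtain ⟨D₀, hD₀, hDD₀⟩ := h.int_deriv.aestronglyMeasurable
  refine ⟨fun z => tangentProj (D₀ (horiz m n z)), continuous_tangentProj.measurable.comp
    (hD₀.measurable.comp (horiz m n).continuous.measurable), ?_⟩
  have h1 : ∀ᵐ z ∂((hausdorff m n).restrict (sobolevGraph Ω u)),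
      D (horiz m n z) = D₀ (horiz m n z) := h.ae_sobolevGraph hΩ hDD₀
  filter_upwards [h.ae_approxTangent_eq hΩ hΩb hfin, h1] with z hz hz'
  rw [hz.2, hz']

/-- The varifold of a Sobolev graph in terms of the parametrization. -/
theorem IsW11.integral_varifold {Ω : Set (E m)} (hΩ : IsOpen Ω) (hΩb : Bornology.IsBounded Ω)
    {u : E m → E n} {D : E m → E m →L[ℝ] E n} (h : IsW11 Ω u D)
    (hfin : ∀ K, IsCompact K → K ⊆ domainCylinder n Ω → hausdorff m n (sobolevGraph Ω u ∩ K) < ⊤)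
    {f : Amb m n × Grass m n → ℝ} (hf : Continuous f) :
    ∫ w, f w ∂(varifold (sobolevGraph Ω u))
      = ∫ x in Ω, jac (D x) * f (graphPt u x, tangentProj (D x)) := by
  have hac := withDensity_absolutelyContinuous (volume.restrict Ω) (fun x => (jac (D x) : ℝ≥0∞))
  have hm := h.aemeasurable_approxTangent hΩ hΩb hfin
  have hpair : AEMeasurable (fun y => (y, approxTangent (sobolevGraph Ω u) y))
      ((hausdorff m n).restrict (sobolevGraph Ω u)) := aemeasurable_id.prodMk hm
  rw [varifold, integral_map hpair hf.aestronglyMeasurable]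
  have hgm : AEMeasurable (fun z => f (z, approxTangent (sobolevGraph Ω u) z))
      ((hausdorff m n).restrict (sobolevGraph Ω u)) := hf.measurable.comp_aemeasurable hpair
  rw [(h.restrict_sobolevGraph hΩ).2] at hgm ⊢
  rw [integral_map (h.aemeasurable_graphPt.mono_ac hac) hgm.aestronglyMeasurable,
    integral_withDensity_eq_integral_smul₀ h.aemeasurable_jac]
  refine integral_congr_ae ((h.ae_isApproxTangent hΩ hΩb hfin).mono fun x hx => ?_)
  simp only [approxTangent_eq hx]
  rfl

/-! ### Strong convergence implies convergence of varifolds -/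

lemma jac_le_of_le {L : E m →L[ℝ] E n} {b : ℝ} (hb : 1 + ‖L‖ ≤ b) :
    (jac L : ℝ) ≤ b ^ m * jac (0 : E m →L[ℝ] E n) := by
  have h : (jac L : ℝ) ≤ (1 + ‖L‖) ^ m * jac (0 : E m →L[ℝ] E n) := by
    exact_mod_cast jac_le_growth L
  exact h.trans (by gcongr)

lemma IsW11.isVarifoldIn_univ {Ω : Set (E m)} (hΩ : IsOpen Ω) (hΩb : Bornology.IsBounded Ω)
    {u : E m → E n} {D : E m → E m →L[ℝ] E n} (h : IsW11 Ω u D)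
    (hmass : hausdorff m n (sobolevGraph Ω u) < ⊤) : IsVarifoldIn univ (sobolevGraph Ω u) := by
  have hfin : ∀ K : Set (Amb m n), hausdorff m n (sobolevGraph Ω u ∩ K) < ⊤ := fun K =>
    (measure_mono inter_subset_left).trans_lt hmass
  exact ⟨(h.restrict_sobolevGraph hΩ).1, fun K _ _ => hfin K,
    (h.ae_approxTangent_eq hΩ hΩb fun K _ _ => hfin K).mono fun z hz => ⟨_, hz.1⟩,
    h.aemeasurable_approxTangent hΩ hΩb fun K _ _ => hfin K⟩

lemma MemSobolev.integrable_one_add_norm_pow {Ω : Set (E m)} (hΩb : Bornology.IsBounded Ω)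
    (hm : m ≠ 0) {u : E m → E n} {D : E m → E m →L[ℝ] E n} (h : MemSobolev Ω (m : ℝ≥0∞) u D) :
    Integrable (fun x => (1 + ‖D x‖) ^ m) (volume.restrict Ω) := by
  have := isFiniteMeasure_restrict hΩb
  have h1 : MemLp (fun x => 1 + ‖D x‖) (m : ℝ≥0∞) (volume.restrict Ω) :=
    (memLp_const (1 : ℝ)).add h.2.1.norm
  refine (h1.integrable_norm_pow hm).congr (ae_of_all _ fun x => ?_)
  simp only
  rw [Real.norm_of_nonneg (by positivity)]

lemma MemSobolev.hausdorff_sobolevGraph_lt_top {Ω : Set (E m)} (hΩ : IsOpen Ω)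
    (hΩb : Bornology.IsBounded Ω) (hm : m ≠ 0) {u : E m → E n} {D : E m → E m →L[ℝ] E n}
    (h : MemSobolev Ω (m : ℝ≥0∞) u D) : hausdorff m n (sobolevGraph Ω u) < ⊤ := by
  have hW : IsW11 Ω u D := h.isW11 hΩb (by exact_mod_cast Nat.one_le_iff_ne_zero.2 hm)
  have h1 := hW.hausdorff_sobolevGraph_inter hΩ MeasurableSet.univ
  rw [inter_univ, preimage_univ, Measure.restrict_univ] at h1
  rw [h1]
  have h2 : Integrable (fun x => (jac (D x) : ℝ)) (volume.restrict Ω) := by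
    refine ((h.integrable_one_add_norm_pow hΩb hm).mul_const
      (jac (0 : E m →L[ℝ] E n) : ℝ)).mono' ?_ ?_
    · exact (NNReal.continuous_coe.measurable.comp_aemeasurable
        hW.aemeasurable_jac).aestronglyMeasurable
    · refine ae_of_all _ fun x => ?_
      rw [Real.norm_of_nonneg (NNReal.coe_nonneg _)]
      exact jac_le_of_le le_rfl
  simpa [HasFiniteIntegral] using h2.2

/-- A sequence converging fast in `L^m` converges almost everywhere and is dominated. -/
lemma exists_dominating_of_lintegral_le {α F : Type*} [MeasurableSpace α] {μ : Measure α}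
    [NormedAddCommGroup F] {v : ℕ → α → F} {w : α → F}
    (hv : ∀ k, AEStronglyMeasurable (v k) μ) (hw : AEStronglyMeasurable w μ)
    (hle : ∀ k, ∫⁻ x, ‖v k x - w x‖ₑ ^ m ∂μ ≤ 2⁻¹ ^ k) :
    ∃ G : α → ℝ, Integrable G μ ∧ ∀ᵐ x ∂μ, (∀ k, ‖v k x - w x‖ ^ m ≤ G x) ∧
      Tendsto (fun k => v k x) atTop (𝓝 (w x)) := by
  set S : α → ℝ≥0∞ := fun x => ∑' k, ‖v k x - w x‖ₑ ^ m with hS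
  have hterm : ∀ k, AEMeasurable (fun x => ‖v k x - w x‖ₑ ^ m) μ := fun k =>
    ((hv k).sub hw).enorm.pow_const m
  have hSm : AEMeasurable S μ := AEMeasurable.tsum hterm
  have hSint : ∫⁻ x, S x ∂μ ≠ ⊤ := by
    rw [hS, lintegral_tsum hterm]
    refine ne_top_of_le_ne_top ?_ (ENNReal.tsum_le_tsum hle)
    rw [ENNReal.tsum_geometric]
    simp
  refine ⟨fun x => (S x).toReal, integrable_toReal_of_lintegral_ne_top hSm hSint, ?_⟩
  filter_upwards [ae_lt_top' hSm hSint] with x hx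
  have hnorm : ∀ k, ‖v k x - w x‖ ^ m = (‖v k x - w x‖ₑ ^ m).toReal := fun k => by
    rw [ENNReal.toReal_pow, toReal_enorm]
  refine ⟨fun k => ?_, ?_⟩
  · rw [hnorm]
    exact ENNReal.toReal_mono hx.ne (ENNReal.le_tsum k)
  · have h1 := ENNReal.tendsto_atTop_zero_of_tsum_ne_top hx.ne
    have h2 : Tendsto (fun k => ‖v k x - w x‖ ^ m) atTop (𝓝 0) := by
      simp_rw [hnorm]
      exact (ENNReal.tendsto_toReal ENNReal.zero_ne_top).comp h1
    rw [tendsto_iff_norm_sub_tendsto_zero, Metric.tendsto_nhds]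
    intro ε hε
    filter_upwards [h2.eventually (gt_mem_nhds (pow_pos hε m))] with k hk
    rw [dist_zero_right, norm_norm]
    exact lt_of_pow_lt_pow_left₀ m hε.le hk

lemma tendsto_lintegral_pow_of_eLpNorm {α F : Type*} [MeasurableSpace α] {μ : Measure α}
    [NormedAddCommGroup F] (hm : m ≠ 0) {v : ℕ → α → F}
    (h : Tendsto (fun j => eLpNorm (v j) (m : ℝ≥0∞) μ) atTop (𝓝 0)) :
    Tendsto (fun j => ∫⁻ x, ‖v j x‖ₑ ^ m ∂μ) atTop (𝓝 0) := by
  have h1 : ∀ j, ∫⁻ x, ‖v j x‖ₑ ^ m ∂μ = eLpNorm (v j) (m : ℝ≥0∞) μ ^ m := fun j => by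
    have := eLpNorm_nnreal_pow_eq_lintegral (f := v j) (μ := μ) (p := (m : ℝ≥0))
      (by exact_mod_cast hm)
    simpa using this.symm
  simp_rw [h1]
  have h2 := ((ENNReal.continuous_pow m).tendsto 0).comp h
  rwa [zero_pow hm] at h2

/-- Strong `W^{1,m}` convergence implies varifold convergence of the graphs along a subsequence. -/
theorem StrongSobolevTendsto.exists_varifoldTendsto {Ω : Set (E m)} (hm : m ≠ 0) (hΩ : IsOpen Ω)
    (hΩb : Bornology.IsBounded Ω) {uj : ℕ → E m → E n} {Duj : ℕ → E m → E m →L[ℝ] E n}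
    {u : E m → E n} {Du : E m → E m →L[ℝ] E n}
    (h : StrongSobolevTendsto Ω (m : ℝ≥0∞) uj Duj u Du) :
    ∃ φ : ℕ → ℕ, StrictMono φ ∧
      VarifoldTendsto (univ : Set (Amb m n)) (fun k => sobolevGraph Ω (uj (φ k)))
        (sobolevGraph Ω u) := by
  obtain ⟨hj, hu, hconv, hDconv⟩ := h
  have hm1 : (1 : ℝ≥0∞) ≤ m := by exact_mod_cast Nat.one_le_iff_ne_zero.2 hm
  have hWj : ∀ j, IsW11 Ω (uj j) (Duj j) := fun j => (hj j).isW11 hΩb hm1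
  have hW : IsW11 Ω u Du := hu.isW11 hΩb hm1
  have t1 := tendsto_lintegral_pow_of_eLpNorm hm hconv
  have t2 := tendsto_lintegral_pow_of_eLpNorm hm hDconv
  have hpos : ∀ k : ℕ, (0 : ℝ≥0∞) < 2⁻¹ ^ k := fun k => ENNReal.pow_pos (by simp) k
  obtain ⟨φ, hφ, hφle⟩ := extraction_forall_of_eventually
    (fun k => (t1.eventually (ge_mem_nhds (hpos k))).and (t2.eventually (ge_mem_nhds (hpos k))))
  obtain ⟨G₁, -, hG₁⟩ := exists_dominating_of_lintegral_le (fun k => (hj (φ k)).1.1) hu.1.1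
    fun k => (hφle k).1
  obtain ⟨G₂, hG₂i, hG₂⟩ := exists_dominating_of_lintegral_le (fun k => (hj (φ k)).2.1.1) hu.2.1.1
    fun k => (hφle k).2
  have hmassj : ∀ j, hausdorff m n (sobolevGraph Ω (uj j)) < ⊤ := fun j =>
    (hj j).hausdorff_sobolevGraph_lt_top hΩ hΩb hm
  have hmass := hu.hausdorff_sobolevGraph_lt_top hΩ hΩb hm
  refine ⟨φ, hφ, fun k => (hWj (φ k)).isVarifoldIn_univ hΩ hΩb (hmassj _),
    hW.isVarifoldIn_univ hΩ hΩb hmass, fun f hf hfs _ => ?_⟩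
  rw [hW.integral_varifold hΩ hΩb (fun K _ _ => (measure_mono inter_subset_left).trans_lt hmass) hf]
  simp_rw [fun k => (hWj (φ k)).integral_varifold hΩ hΩb
    (fun K _ _ => (measure_mono inter_subset_left).trans_lt (hmassj _)) hf]
  obtain ⟨M, hM⟩ := hfs.exists_bound_of_continuous hf
  have hM0 : 0 ≤ M := (norm_nonneg _).trans (hM (graphPt u 0, tangentProj 0))
  set J₀ : ℝ := (jac (0 : E m →L[ℝ] E n) : ℝ) with hJ₀
  refine tendsto_integral_of_dominated_convergence
    (fun x => 2 ^ (m - 1) * ((1 + ‖Du x‖) ^ m + G₂ x) * J₀ * M) (fun k => ?_) ?_ (fun k => ?_) ?_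
  · have hW' := hWj (φ k)
    have h1 : AEMeasurable (fun x => (graphPt (uj (φ k)) x, tangentProj (Duj (φ k) x)))
        (volume.restrict Ω) := hW'.aemeasurable_graphPt.prodMk
      (continuous_tangentProj.measurable.comp_aemeasurable hW'.int_deriv.1.aemeasurable)
    exact ((NNReal.continuous_coe.measurable.comp_aemeasurable hW'.aemeasurable_jac).mul
      (hf.measurable.comp_aemeasurable h1)).aestronglyMeasurable
  · exact ((((hu.integrable_one_add_norm_pow hΩb hm).add hG₂i).const_mul _).mul_const _).mul_const _
  · filter_upwards [hG₂] with x hx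
    rw [norm_mul, Real.norm_of_nonneg (NNReal.coe_nonneg _)]
    refine mul_le_mul ?_ (hM _) (norm_nonneg _) ?_
    · refine (jac_le_of_le (b := (1 + ‖Du x‖) + ‖Duj (φ k) x - Du x‖) ?_).trans ?_
      · have := norm_add_le (Du x) (Duj (φ k) x - Du x)
        rw [add_sub_cancel] at this
        linarith
      · gcongr
        refine (add_pow_le (by positivity) (norm_nonneg _) m).trans ?_
        gcongr
        exact hx.1 k
    · have : 0 ≤ G₂ x := (pow_nonneg (norm_nonneg _) m).trans (hx.1 0)
      positivity
  · filter_upwards [hG₁, hG₂] with x hx1 hx2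
    have c1 : Tendsto (fun k => (jac (Duj (φ k) x) : ℝ)) atTop (𝓝 (jac (Du x))) :=
      ((NNReal.continuous_coe.comp continuous_jac).tendsto _).comp hx2.2
    have c2 : Tendsto (fun k => graphPt (uj (φ k)) x) atTop (𝓝 (graphPt u x)) :=
      (continuous_pt.tendsto (x, u x)).comp (tendsto_const_nhds.prodMk_nhds hx1.2)
    have c3 : Tendsto (fun k => tangentProj (Duj (φ k) x)) atTop (𝓝 (tangentProj (Du x))) :=
      (continuous_tangentProj.tendsto _).comp hx2.2
    exact c1.mul ((hf.tendsto _).comp (c2.prodMk_nhds c3))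

/-! ### Weakly convergent sequences are bounded -/

/-- The duality `‖w‖_p ≤ sup ∫ w g` over `‖g‖_{p'} ≤ 1`, with the extremal function
`g = |w|^{p-2} w`. -/
lemma eLpNorm_le_of_forall_integral_mul_le {α : Type*} [MeasurableSpace α] {μ : Measure α}
    {p : ℝ} (hp : 1 < p) {w : α → ℝ} (hw : MemLp w (ENNReal.ofReal p) μ) {C : ℝ} (hC0 : 0 ≤ C)
    (hC : ∀ g : α → ℝ, MemLp g (ENNReal.ofReal (p / (p - 1))) μ →
      |∫ x, w x * g x ∂μ| ≤ C * (eLpNorm g (ENNReal.ofReal (p / (p - 1))) μ).toReal) :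
    eLpNorm w (ENNReal.ofReal p) μ ≤ ENNReal.ofReal C := by
  have hp0 : 0 < p := by linarith
  have hp1 : 0 < p - 1 := by linarith
  set N := (eLpNorm w (ENNReal.ofReal p) μ).toReal with hN
  have hNtop : eLpNorm w (ENNReal.ofReal p) μ ≠ ⊤ := hw.2.ne
  set g : α → ℝ := fun x => SignType.sign (w x) * ‖w x‖ ^ (p - 1) with hg
  have hgnorm : ∀ x, ‖g x‖ = ‖‖w x‖ ^ (p - 1)‖ := by
    intro x
    rcases eq_or_ne (w x) 0 with h0 | h0
    · simp [hg, h0, Real.zero_rpow hp1.ne']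
    · rw [hg, norm_mul]
      rcases lt_or_gt_of_ne h0 with h | h
      · rw [sign_neg h]; simp
      · rw [sign_pos h]; simp
  have hexp : ENNReal.ofReal (p / (p - 1)) * ENNReal.ofReal (p - 1) = ENNReal.ofReal p := by
    rw [← ENNReal.ofReal_mul (by positivity), div_mul_cancel₀ _ hp1.ne']
  have hgn : eLpNorm g (ENNReal.ofReal (p / (p - 1))) μ
      = eLpNorm w (ENNReal.ofReal p) μ ^ (p - 1) := by
    rw [eLpNorm_congr_norm_ae (ae_of_all _ hgnorm), eLpNorm_norm_rpow w hp1, hexp]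
  have hgm : AEStronglyMeasurable g μ := by
    have h1 : Measurable fun t : ℝ => (SignType.sign t : ℝ) := by
      have : (fun t : ℝ => (SignType.sign t : ℝ))
          = fun t => if 0 < t then 1 else if t < 0 then -1 else 0 := by
        ext t
        rcases lt_trichotomy t 0 with h | h | h
        · simp [sign_neg h, h, h.le.not_gt]
        · simp [h]
        · simp [sign_pos h, h]
      rw [this]
      exact Measurable.ite measurableSet_Ioi measurable_const
        (Measurable.ite measurableSet_Iio measurable_const measurable_const)
    exact ((h1.comp_aemeasurable hw.1.aemeasurable).mul
      (hw.1.norm.aemeasurable.pow_const _)).aestronglyMeasurable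
  have hgL : MemLp g (ENNReal.ofReal (p / (p - 1))) μ :=
    ⟨hgm, by rw [hgn]; exact ENNReal.rpow_lt_top_of_nonneg hp1.le hNtop⟩
  have hint : ∫ x, w x * g x ∂μ = N ^ p := by
    have h1 : ∀ x, w x * g x = ‖w x‖ ^ p := by
      intro x
      rcases eq_or_ne (w x) 0 with h0 | h0
      · simp [h0, Real.zero_rpow hp0.ne']
      · rw [hg, ← mul_assoc, self_mul_sign, ← Real.norm_eq_abs,
          ← Real.rpow_one_add' (norm_nonneg _) (by simpa using hp0.ne')]
        congr 1
        ring
    simp_rw [h1]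
    rw [hN, hw.eLpNorm_eq_integral_rpow_norm (by simpa using hp0) ENNReal.ofReal_ne_top,
      ENNReal.toReal_ofReal hp0.le, ENNReal.toReal_ofReal (by positivity), ← Real.rpow_mul
      (integral_nonneg fun x => by positivity), inv_mul_cancel₀ hp0.ne', Real.rpow_one]
  have hmain := hC g hgL
  rw [hint, hgn, ← ENNReal.toReal_rpow, ← hN] at hmain
  have hN0 : 0 ≤ N := ENNReal.toReal_nonneg
  have hNC : N ≤ C := by
    rcases hN0.eq_or_lt with h0 | h0
    · rw [← h0]; exact hC0
    · have h2 : N ^ p = N * N ^ (p - 1) := by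
        rw [← Real.rpow_one_add' hN0 (by simpa using hp0.ne')]
        congr 1
        ring
      rw [h2, abs_of_nonneg (by positivity)] at hmain
      exact le_of_mul_le_mul_right hmain (by positivity)
  rw [← ENNReal.ofReal_toReal hNtop]
  exact ENNReal.ofReal_le_ofReal hNC

/-- The uniform boundedness principle in `L^p`. -/
lemma exists_eLpNorm_bound_of_tendsto {α : Type*} [MeasurableSpace α] {μ : Measure α}
    {p : ℝ} (hp : 1 < p) {w : ℕ → α → ℝ} (hw : ∀ j, MemLp (w j) (ENNReal.ofReal p) μ)
    (h : ∀ g : α → ℝ, MemLp g (ENNReal.ofReal (p / (p - 1))) μ →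
      ∃ l, Tendsto (fun j => ∫ x, w j x * g x ∂μ) atTop (𝓝 l)) :
    ∃ C : ℝ, ∀ j, eLpNorm (w j) (ENNReal.ofReal p) μ ≤ ENNReal.ofReal C := by
  have hconj : Real.HolderConjugate p (p / (p - 1)) := Real.HolderConjugate.conjExponent hp
  have hc : ENNReal.HolderConjugate (ENNReal.ofReal p) (ENNReal.ofReal (p / (p - 1))) :=
    hconj.ennrealOfReal
  have f1 : Fact (1 ≤ ENNReal.ofReal p) := ⟨by simpa using hp.le⟩
  have f2 : Fact (1 ≤ ENNReal.ofReal (p / (p - 1))) := ⟨by simpa using hconj.symm.lt.le⟩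
  set T : ℕ → (Lp ℝ (ENNReal.ofReal (p / (p - 1))) μ →L[ℝ] ℝ) := fun j =>
    (ContinuousLinearMap.mul ℝ ℝ).lpPairing μ (ENNReal.ofReal p) (ENNReal.ofReal (p / (p - 1)))
      ((hw j).toLp (w j)) with hT
  have hTg : ∀ j (g : Lp ℝ (ENNReal.ofReal (p / (p - 1))) μ), T j g = ∫ x, w j x * g x ∂μ := by
    intro j g
    rw [hT, ContinuousLinearMap.lpPairing_eq_integral]
    refine integral_congr_ae ((hw j).coeFn_toLp.mono fun x hx => ?_)
    simp only [ContinuousLinearMap.mul_apply', hx]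
  obtain ⟨C, hC⟩ := banach_steinhaus (g := T) fun g => by
    obtain ⟨l, hl⟩ := h g (Lp.memLp g)
    obtain ⟨C, hC⟩ := (Metric.isBounded_range_of_tendsto _ hl).exists_norm_le
    refine ⟨C, fun j => ?_⟩
    rw [hTg]
    exact hC _ (mem_range_self j)
  have hC0 : 0 ≤ C := (norm_nonneg _).trans (hC 0)
  refine ⟨C, fun j => eLpNorm_le_of_forall_integral_mul_le hp (hw j) hC0 fun g hg => ?_⟩
  have h1 := ((T j).le_opNorm (hg.toLp g)).trans (mul_le_mul_of_nonneg_right (hC j) (norm_nonneg _))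
  rw [hTg, Lp.norm_toLp, Real.norm_eq_abs] at h1
  have h2 : ∫ x, w j x * (hg.toLp g) x ∂μ = ∫ x, w j x * g x ∂μ :=
    integral_congr_ae (hg.coeFn_toLp.mono fun x hx => by simp only [hx])
  rwa [h2] at h1

lemma exists_eLpNorm_bound_of_coordinates {α F ι : Type*} [MeasurableSpace α] {μ : Measure α}
    [NormedAddCommGroup F] [NormedSpace ℝ F] [Fintype ι] {p : ℝ} (hp : 1 < p)
    {V : ℕ → α → F} {ℓ : ι → F →L[ℝ] ℝ} (hℓ : ∀ y, ‖y‖ ≤ ∑ i, ‖ℓ i y‖)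
    (hV : ∀ j, MemLp (V j) (ENNReal.ofReal p) μ)
    (h : ∀ i, ∀ g : α → ℝ, MemLp g (ENNReal.ofReal (p / (p - 1))) μ →
      ∃ l, Tendsto (fun j => ∫ x, ℓ i (V j x) * g x ∂μ) atTop (𝓝 l)) :
    ∃ C : ℝ≥0∞, C ≠ ⊤ ∧ ∀ j, eLpNorm (V j) (ENNReal.ofReal p) μ ≤ C := by
  have hmem : ∀ i j, MemLp (fun x => ℓ i (V j x)) (ENNReal.ofReal p) μ := fun i j =>
    (ℓ i).comp_memLp' (hV j)
  choose C hC using fun i => exists_eLpNorm_bound_of_tendsto hp (hmem i) (h i)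
  refine ⟨∑ i, ENNReal.ofReal (C i), by simp, fun j => ?_⟩
  have h1 : eLpNorm (V j) (ENNReal.ofReal p) μ
      ≤ eLpNorm (∑ i, fun x => ‖ℓ i (V j x)‖) (ENNReal.ofReal p) μ := by
    refine eLpNorm_mono_real fun x => ?_
    simpa using hℓ (V j x)
  refine h1.trans ((eLpNorm_sum_le (fun i _ => (hmem i j).1.norm) (by simpa using hp.le)).trans ?_)
  refine Finset.sum_le_sum fun i _ => ?_
  rw [eLpNorm_norm]
  exact hC i j

lemma norm_le_sum_coord (y : E n) : ‖y‖ ≤ ∑ i, ‖y i‖ := by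
  conv_lhs => rw [← (EuclideanSpace.basisFun (Fin n) ℝ).sum_repr y]
  refine (norm_sum_le _ _).trans (Finset.sum_le_sum fun i _ => ?_)
  rw [norm_smul]
  simp

lemma norm_le_sum_entries (L : E m →L[ℝ] E n) :
    ‖L‖ ≤ ∑ q : Fin m × Fin n, ‖L (EuclideanSpace.single q.1 1) q.2‖ := by
  refine ContinuousLinearMap.opNorm_le_bound _ (by positivity) fun x => ?_
  have h1 : L x = ∑ k, x k • L (EuclideanSpace.single k 1) := by
    conv_lhs => rw [← (EuclideanSpace.basisFun (Fin m) ℝ).sum_repr x]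
    simp
  rw [h1, Fintype.sum_prod_type, Finset.sum_mul]
  refine (norm_sum_le _ _).trans (Finset.sum_le_sum fun k _ => ?_)
  rw [norm_smul, mul_comm]
  exact mul_le_mul (norm_le_sum_coord _) (PiLp.norm_apply_le x k) (norm_nonneg _) (by positivity)

/-- A weakly convergent sequence is bounded in `W^{1,p}`. -/
lemma WeakSobolevTendsto.exists_bound {Ω : Set (E m)} {p : ℝ} (hp : 1 < p)
    {uj : ℕ → E m → E n} {Duj : ℕ → E m → E m →L[ℝ] E n} {u : E m → E n} {Du : E m → E m →L[ℝ] E n}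
    (hΩb : Bornology.IsBounded Ω) (h : WeakSobolevTendsto Ω p uj Duj u Du) :
    ∃ C : ℝ≥0∞, C ≠ ⊤ ∧ ∀ j, eLpNorm (uj j) (ENNReal.ofReal p) (volume.restrict Ω) ≤ C ∧
      eLpNorm (Duj j) (ENNReal.ofReal p) (volume.restrict Ω) ≤ C := by
  obtain ⟨hj, -, hconv⟩ := h
  have hfin := isFiniteMeasure_restrict hΩb
  have hconj : Real.HolderConjugate p (p / (p - 1)) := Real.HolderConjugate.conjExponent hp
  have hc : ENNReal.HolderConjugate (ENNReal.ofReal (p / (p - 1))) (ENNReal.ofReal p) :=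
    hconj.symm.ennrealOfReal
  obtain ⟨C₁, hC₁, h₁⟩ := exists_eLpNorm_bound_of_coordinates hp (μ := volume.restrict Ω)
    (V := uj) (ℓ := fun i : Fin n => EuclideanSpace.proj i) (fun y => norm_le_sum_coord y)
    (fun j => (hj j).1) fun i g hg => by
      refine ⟨_, ((EuclideanSpace.proj i : E n →L[ℝ] ℝ).continuous.tendsto _).comp (hconv g hg).1 |>.congr fun j => ?_⟩
      rw [Function.comp_apply, ← ContinuousLinearMap.integral_comp_comm]
      · simp [mul_comm]
      · exact memLp_one_iff_integrable.1 ((hj j).1.smul hg)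
  obtain ⟨C₂, hC₂, h₂⟩ := exists_eLpNorm_bound_of_coordinates hp (μ := volume.restrict Ω)
    (V := Duj) (ℓ := fun q : Fin m × Fin n => (EuclideanSpace.proj q.2 : E n →L[ℝ] ℝ).comp
      (ContinuousLinearMap.apply ℝ (E n) (EuclideanSpace.single q.1 (1 : ℝ))))
    (fun L => norm_le_sum_entries L) (fun j => (hj j).2.1) fun q g hg => by
      refine ⟨_, ((EuclideanSpace.proj q.2 : E n →L[ℝ] ℝ).continuous.tendsto _).comp
        ((hconv g hg).2 (EuclideanSpace.single q.1 (1 : ℝ))) |>.congr fun j => ?_⟩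
      rw [Function.comp_apply, ← ContinuousLinearMap.integral_comp_comm]
      · simp [mul_comm]
      · exact memLp_one_iff_integrable.1 (((ContinuousLinearMap.apply ℝ (E n)
          (EuclideanSpace.single q.1 (1 : ℝ))).comp_memLp' (hj j).2.1).smul hg)
  exact ⟨max C₁ C₂, max_lt hC₁.lt_top hC₂.lt_top |>.ne,
    fun j => ⟨(h₁ j).trans (le_max_left _ _), (h₂ j).trans (le_max_right _ _)⟩⟩

/-! ### Varifold convergence of graphs gives convergence in measure -/

/-- A continuous cutoff in the dependent variable: `1` for `‖y‖ ≤ R`, `0` for `‖y‖ ≥ R + 1`. -/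
def vertCutoff (R : ℝ) (y : E n) : ℝ := max 0 (min 1 (R + 1 - ‖y‖))

/-- A continuous cutoff on the Grassmannian which removes the planes close to vertical ones. -/
def planeCutoff (δ : ℝ) (P : Grass m n) : ℝ := max 0 (min 1 (horizDet P / δ - 1))

/-- The cutoff in `(u x, Du x)` which is the trace of `vertCutoff` and `planeCutoff` on the
graph. -/
def graphCutoff (R δ : ℝ) (Y : E n × (E m →L[ℝ] E n)) : ℝ :=
  vertCutoff R Y.1 * planeCutoff δ (tangentProj Y.2)

lemma max_zero_min_one_mem (t : ℝ) : max 0 (min 1 t) ∈ Icc (0 : ℝ) 1 :=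
  ⟨le_max_left _ _, max_le zero_le_one (min_le_left _ _)⟩

lemma continuous_vertCutoff (R : ℝ) : Continuous (vertCutoff R : E n → ℝ) := by
  unfold vertCutoff
  fun_prop

lemma continuous_planeCutoff (δ : ℝ) : Continuous (planeCutoff δ : Grass m n → ℝ) := by
  unfold planeCutoff
  have := continuous_horizDet (m := m) (n := n)
  fun_prop

lemma continuous_graphCutoff (R δ : ℝ) :
    Continuous (graphCutoff R δ : E n × (E m →L[ℝ] E n) → ℝ) :=
  ((continuous_vertCutoff R).comp continuous_fst).mul
    ((continuous_planeCutoff δ).comp (continuous_tangentProj.comp continuous_snd))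

lemma graphCutoff_mem (R δ : ℝ) (Y : E n × (E m →L[ℝ] E n)) : graphCutoff R δ Y ∈ Icc (0 : ℝ) 1 :=
  ⟨mul_nonneg (max_zero_min_one_mem _).1 (max_zero_min_one_mem _).1,
    mul_le_one₀ (max_zero_min_one_mem _).2 (max_zero_min_one_mem _).1 (max_zero_min_one_mem _).2⟩

lemma le_horizDet_of_planeCutoff_ne_zero {δ : ℝ} (hδ : 0 < δ) {P : Grass m n}
    (hP : planeCutoff δ P ≠ 0) : δ ≤ horizDet P := by
  by_contra! h
  refine hP (max_eq_left ((min_le_right _ _).trans ?_))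
  rw [sub_nonpos, div_le_one hδ]
  exact h.le

/-- Graphs of linear maps `L` with `‖L‖ ≤ R` stay away from vertical planes, hence the cutoff is `1`
on the ball of radius `R` if its threshold is small. -/
lemma exists_graphCutoff_eq_one {R : ℝ} (hR : 0 < R) : ∃ δ : ℝ, 0 < δ ∧
    ∀ Y : E n × (E m →L[ℝ] E n), 1 - graphCutoff R δ Y ≤ ‖Y‖ / R := by
  obtain ⟨L₀, -, hL₀⟩ := (isCompact_closedBall (0 : E m →L[ℝ] E n) R).exists_isMinOn
    ⟨0, by simpa using hR.le⟩
    (continuous_horizDet.comp continuous_tangentProj).continuousOn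
  have h0 := horizDet_tangentProj_pos L₀
  refine ⟨horizDet (tangentProj L₀) / 2, half_pos h0, fun Y => ?_⟩
  rcases le_or_gt ‖Y‖ R with h | h
  · have h1 : vertCutoff R Y.1 = 1 := by
      have : ‖Y.1‖ ≤ R := (norm_fst_le Y).trans h
      unfold vertCutoff
      rw [min_eq_left (by linarith), max_eq_right zero_le_one]
    have h2 : planeCutoff (horizDet (tangentProj L₀) / 2) (tangentProj Y.2) = 1 := by
      have : horizDet (tangentProj L₀) ≤ horizDet (tangentProj Y.2) :=
        hL₀ (by simpa using (norm_snd_le Y).trans h)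
      have h3 : 2 ≤ horizDet (tangentProj Y.2) / (horizDet (tangentProj L₀) / 2) := by
        rw [le_div_iff₀ (half_pos h0)]
        linarith
      unfold planeCutoff
      rw [min_eq_left (by linarith), max_eq_right zero_le_one]
    rw [graphCutoff, h1, h2]
    have : 0 ≤ ‖Y‖ / R := by positivity
    linarith
  · have h1 := (graphCutoff_mem R (horizDet (tangentProj L₀) / 2) Y).1
    have h2 : 1 ≤ ‖Y‖ / R := by rw [le_div_iff₀ hR]; linarith
    linarith

/-- The test function on `ℝᵐ⁺ⁿ × 𝔾` whose integral over the graph varifold of `u` is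
`∫_Ω η χ(u, Du) min(1, |(u, Du) - W|)`, where `χ` is the cutoff `graphCutoff R δ`. -/
def graphTest (η : E m → ℝ) (W : E m → E n × (E m →L[ℝ] E n)) (R δ : ℝ)
    (w : Amb m n × Grass m n) : ℝ :=
  η (horiz m n w.1) * vertCutoff R (vert m n w.1) * (planeCutoff δ w.2 *
    (min 1 ‖(vert m n w.1, slope w.2) - W (horiz m n w.1)‖ / jac (slope w.2)))

/-- `graphTest` is continuous although `slope` is not: its support avoids the planes on which
`horizDet` vanishes. -/
lemma continuous_graphTest {η : E m → ℝ} (hη : Continuous η) {W : E m → E n × (E m →L[ℝ] E n)}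
    (hW : Continuous W) (R : ℝ) {δ : ℝ} (hδ : 0 < δ) : Continuous (graphTest η W R δ) := by
  refine continuous_of_tsupport fun w hw => ?_
  have hw' : δ ≤ horizDet w.2 := by
    have hcl : IsClosed {w : Amb m n × Grass m n | δ ≤ horizDet w.2} :=
      isClosed_le continuous_const (continuous_horizDet.comp continuous_snd)
    refine closure_minimal (fun w hw => ?_) hcl hw
    refine le_horizDet_of_planeCutoff_ne_zero hδ fun h0 => hw ?_
    simp [graphTest, h0]
  have hs : ContinuousAt (fun w : Amb m n × Grass m n => slope w.2) w :=
    (continuousAt_slope (hδ.trans_le hw').ne').comp continuousAt_snd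
  have hj : ContinuousAt (fun w : Amb m n × Grass m n => (jac (slope w.2) : ℝ)) w :=
    (NNReal.continuous_coe.comp continuous_jac).continuousAt.comp hs
  have hW' : ContinuousAt (fun w : Amb m n × Grass m n => W (horiz m n w.1)) w :=
    (hW.comp ((horiz m n).continuous.comp continuous_fst)).continuousAt
  have hv : ContinuousAt (fun w : Amb m n × Grass m n => vert m n w.1) w :=
    ((vert m n).continuous.comp continuous_fst).continuousAt
  have h1 : ContinuousAt (fun w : Amb m n × Grass m n =>
      η (horiz m n w.1) * vertCutoff R (vert m n w.1)) w :=
    ((hη.comp ((horiz m n).continuous.comp continuous_fst)).mul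
      ((continuous_vertCutoff R).comp ((vert m n).continuous.comp continuous_fst))).continuousAt
  have h2 : ContinuousAt (fun w : Amb m n × Grass m n => planeCutoff δ w.2) w :=
    ((continuous_planeCutoff δ).comp continuous_snd).continuousAt
  have h3 : ContinuousAt (fun w : Amb m n × Grass m n =>
      min 1 ‖(vert m n w.1, slope w.2) - W (horiz m n w.1)‖) w :=
    continuousAt_const.min (((hv.prodMk hs).sub hW').norm)
  exact h1.mul (h2.mul (h3.div hj (NNReal.coe_ne_zero.2 (jac_pos _).ne')))

lemma graphTest_support {η : E m → ℝ} (hηs : HasCompactSupport η)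
    (W : E m → E n × (E m →L[ℝ] E n)) (R δ : ℝ) {Ω : Set (E m)} (hηΩ : tsupport η ⊆ Ω) :
    HasCompactSupport (graphTest η W R δ) ∧
      tsupport (graphTest η W R δ) ⊆ domainCylinder n Ω ×ˢ univ := by
  set K : Set (Amb m n) := (fun q : E m × E n => pt q.1 q.2) ''
    (tsupport η ×ˢ Metric.closedBall 0 (R + 1)) with hK
  have hKc : IsCompact K :=
    (hηs.isCompact.prod (isCompact_closedBall _ _)).image continuous_pt
  have hKG : IsCompact (K ×ˢ (univ : Set (Grass m n))) := hKc.prod isCompact_univ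
  have hsub : tsupport (graphTest η W R δ) ⊆ K ×ˢ (univ : Set (Grass m n)) := by
    refine closure_minimal (fun w hw => ⟨?_, mem_univ _⟩)
      ((hKc.isClosed).prod isClosed_univ)
    refine ⟨(horiz m n w.1, vert m n w.1), ⟨subset_tsupport _ fun h0 => hw ?_, ?_⟩,
      pt_horiz_vert w.1⟩
    · simp [graphTest, h0]
    · by_contra h
      have h' : R + 1 < ‖vert m n w.1‖ := by simpa using h
      refine hw ?_
      have : vertCutoff R (vert m n w.1) = 0 :=
        max_eq_left ((min_le_right _ _).trans (by linarith))
      simp [graphTest, this]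
  refine ⟨hKG.of_isClosed_subset (isClosed_tsupport _) hsub, hsub.trans ?_⟩
  refine prod_mono ?_ le_rfl
  rintro _ ⟨q, hq, rfl⟩
  exact ⟨q.1, hηΩ hq.1, q.2, rfl⟩

lemma IsW11.integral_graphTest {Ω : Set (E m)} (hΩ : IsOpen Ω) (hΩb : Bornology.IsBounded Ω)
    {u : E m → E n} {D : E m → E m →L[ℝ] E n} (h : IsW11 Ω u D)
    (hvar : IsVarifoldIn (domainCylinder n Ω) (sobolevGraph Ω u))
    {η : E m → ℝ} (hη : Continuous η) {W : E m → E n × (E m →L[ℝ] E n)}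
    (hW : Continuous W) (R : ℝ) {δ : ℝ} (hδ : 0 < δ) :
    ∫ w, graphTest η W R δ w ∂(varifold (sobolevGraph Ω u))
      = ∫ x in Ω, η x * graphCutoff R δ (u x, D x) * min 1 ‖(u x, D x) - W x‖ := by
  rw [h.integral_varifold hΩ hΩb hvar.finite (continuous_graphTest hη hW R hδ)]
  refine integral_congr_ae (ae_of_all _ fun x => ?_)
  have hj : (jac (D x) : ℝ) ≠ 0 := NNReal.coe_ne_zero.2 (jac_pos _).ne'
  simp only [graphTest, graphPt, horiz_pt, vert_pt, slope_tangentProj, graphCutoff]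
  field_simp

lemma integrable_of_mem_Icc {α : Type*} [MeasurableSpace α] {μ : Measure α} [IsFiniteMeasure μ]
    {f : α → ℝ} (hf : AEStronglyMeasurable f μ) (h : ∀ x, f x ∈ Icc (0 : ℝ) 1) :
    Integrable f μ :=
  Integrable.of_bound hf 1 (ae_of_all _ fun x => by
    rw [Real.norm_eq_abs, abs_of_nonneg (h x).1]; exact (h x).2)

/-- The heart of the matter: if the graph varifolds converge, then `(u_j, Du_j) → (u, Du)` in
measure. -/
theorem tendsto_integral_min_of_varifoldTendsto {Ω : Set (E m)} (hΩ : IsOpen Ω)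
    (hΩb : Bornology.IsBounded Ω) {uj : ℕ → E m → E n} {Duj : ℕ → E m → E m →L[ℝ] E n}
    {u : E m → E n} {Du : E m → E m →L[ℝ] E n} (hj : ∀ j, IsW11 Ω (uj j) (Duj j))
    (hu : IsW11 Ω u Du) {M : ℝ} (hM : ∀ j, ∫ x in Ω, ‖(uj j x, Duj j x)‖ ≤ M)
    (hvar : VarifoldTendsto (domainCylinder n Ω) (fun j => sobolevGraph Ω (uj j))
      (sobolevGraph Ω u)) :
    Tendsto (fun j => ∫ x in Ω, min 1 ‖(uj j x, Duj j x) - (u x, Du x)‖) atTop (𝓝 0) := by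
  have hfin := isFiniteMeasure_restrict hΩb
  have hM0 : 0 ≤ M := (integral_nonneg fun x => norm_nonneg _).trans (hM 0)
  have hVj : ∀ j, Integrable (fun x => (uj j x, Duj j x)) (volume.restrict Ω) := fun j =>
    (hj j).int.prodMk (hj j).int_deriv
  have hV : Integrable (fun x => (u x, Du x)) (volume.restrict Ω) := hu.int.prodMk hu.int_deriv
  have key : ∀ ε : ℝ, 0 < ε →
      ∀ᶠ j in atTop, ∫ x in Ω, min 1 ‖(uj j x, Duj j x) - (u x, Du x)‖ ≤ 5 * ε := by
    intro ε hε
    have hvol : (volume Ω) ≠ ⊤ := hΩb.measure_lt_top.ne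
    obtain ⟨K, hKΩ, hK, hKε⟩ := hΩ.measurableSet.exists_isCompact_sdiff_lt hvol
      (ε := ENNReal.ofReal ε) (by simpa using hε)
    obtain ⟨η, hη1, hηc, hηΩ, hη01⟩ := exists_continuousMap_one_of_isCompact_subset_isOpen hK hΩ hKΩ
    obtain ⟨W, -, hWε, hWc, hWint⟩ := hV.exists_hasCompactSupport_integral_sub_le hε
    -- with this `R`, the part cut off by `graphCutoff` costs at most `M / R ≤ ε`
    have hR : 0 < (M + 1) / ε := by positivity
    obtain ⟨δ, hδ, hχ⟩ := exists_graphCutoff_eq_one (m := m) (n := n) hR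
    set R := (M + 1) / ε with hRdef
    have hlim := hvar.2.2 (graphTest η W R δ) (continuous_graphTest η.continuous hWc R hδ)
      (graphTest_support hηc W R δ hηΩ).1 (graphTest_support hηc W R δ hηΩ).2
    rw [hu.integral_graphTest hΩ hΩb hvar.2.1 η.continuous hWc R hδ] at hlim
    simp_rw [fun j => (hj j).integral_graphTest hΩ hΩb (hvar.1 j) η.continuous hWc R hδ] at hlim
    have hmin : ∀ t : ℝ, 0 ≤ t → min 1 t ∈ Icc (0 : ℝ) 1 := fun t ht =>
      ⟨le_min zero_le_one ht, min_le_left _ _⟩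
    have hcm : ∀ V : E m → E n × (E m →L[ℝ] E n), Integrable V (volume.restrict Ω) →
        Integrable (fun x => η x * graphCutoff R δ (V x) * min 1 ‖V x - W x‖)
          (volume.restrict Ω) := by
      intro V hV
      refine integrable_of_mem_Icc ((η.continuous.aestronglyMeasurable.mul
        ((continuous_graphCutoff R δ).comp_aestronglyMeasurable hV.1)).mul ?_) fun x => ?_
      · exact (continuous_const.min continuous_id).comp_aestronglyMeasurable (hV.1.sub hWint.1).norm
      · have h1 := hη01 x
        have h2 := graphCutoff_mem R δ (V x)
        have h3 := hmin ‖V x - W x‖ (norm_nonneg _)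
        exact ⟨mul_nonneg (mul_nonneg h1.1 h2.1) h3.1,
          mul_le_one₀ (mul_le_one₀ h1.2 h2.1 h2.2) h3.1 h3.2⟩
    have hVW : Integrable (fun x => ‖(u x, Du x) - W x‖) (volume.restrict Ω) := (hV.sub hWint).norm
    have hlimit : ∫ x in Ω, η x * graphCutoff R δ (u x, Du x) * min 1 ‖(u x, Du x) - W x‖ ≤ ε := by
      refine (integral_mono (hcm _ hV) hVW fun x => ?_).trans hWε
      have h1 := hη01 x
      have h2 := graphCutoff_mem R δ (u x, Du x)
      have h3 := hmin ‖(u x, Du x) - W x‖ (norm_nonneg _)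
      exact (mul_le_of_le_one_left h3.1 (mul_le_one₀ h1.2 h2.1 h2.2)).trans (min_le_right _ _)
    have hηint : Integrable (fun x => 1 - η x) (volume.restrict Ω) :=
      integrable_of_mem_Icc (continuous_const.sub η.continuous).aestronglyMeasurable fun x =>
        ⟨sub_nonneg.2 (hη01 x).2, sub_le_self _ (hη01 x).1⟩
    have hηε : ∫ x in Ω, (1 - η x) ≤ ε := by
      have h1 : ∫ x in Ω, (1 - η x) ≤ ∫ x in Ω, (Kᶜ).indicator (fun _ => (1 : ℝ)) x := by
        refine integral_mono hηint
          ((integrable_const _).indicator hK.measurableSet.compl) fun x => ?_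
        by_cases hx : x ∈ K
        · simp [hx, hη1 hx]
        · simp [hx, (hη01 x).1]
      refine h1.trans ?_
      rw [integral_indicator_const _ hK.measurableSet.compl, smul_eq_mul, mul_one, Measure.real,
        Measure.restrict_apply hK.measurableSet.compl, inter_comm, ← sdiff_eq_compl_inter.trans
        (inter_comm _ _)]
      exact ENNReal.toReal_le_of_le_ofReal hε.le hKε.le
    filter_upwards [hlim.eventually (eventually_lt_nhds (hlimit.trans_lt (lt_two_mul_self hε)))]
      with j hj2
    have hχint : Integrable (fun x => ‖(uj j x, Duj j x)‖ / R) (volume.restrict Ω) :=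
      (hVj j).norm.div_const R
    have hχε : ∫ x in Ω, ‖(uj j x, Duj j x)‖ / R ≤ ε := by
      rw [integral_div, div_le_iff₀ hR]
      refine (hM j).trans ?_
      rw [hRdef, mul_div_cancel₀ _ hε.ne']
      linarith
    have hsum₁ : Integrable (fun x => η x * graphCutoff R δ (uj j x, Duj j x) *
        min 1 ‖(uj j x, Duj j x) - W x‖ + (1 - η x)) (volume.restrict Ω) :=
      (hcm _ (hVj j)).add hηint
    have hsum₂ : Integrable (fun x => η x * graphCutoff R δ (uj j x, Duj j x) *
        min 1 ‖(uj j x, Duj j x) - W x‖ + (1 - η x) + ‖(uj j x, Duj j x)‖ / R)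
        (volume.restrict Ω) := hsum₁.add hχint
    have hmain : ∫ x in Ω, min 1 ‖(uj j x, Duj j x) - (u x, Du x)‖ ≤
        ∫ x in Ω, (η x * graphCutoff R δ (uj j x, Duj j x) * min 1 ‖(uj j x, Duj j x) - W x‖
          + (1 - η x) + ‖(uj j x, Duj j x)‖ / R + ‖(u x, Du x) - W x‖) := by
      refine integral_mono (integrable_of_mem_Icc ((continuous_const.min
        continuous_id).comp_aestronglyMeasurable ((hVj j).1.sub hV.1).norm)
        fun x => hmin _ (norm_nonneg _)) (hsum₂.add hVW) fun x => ?_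
      have h1 := hη01 x
      have h2 := graphCutoff_mem R δ (uj j x, Duj j x)
      have h3 := hmin ‖(uj j x, Duj j x) - W x‖ (norm_nonneg _)
      have h4 := hχ (uj j x, Duj j x)
      have h5 : min 1 ‖(uj j x, Duj j x) - (u x, Du x)‖
          ≤ min 1 ‖(uj j x, Duj j x) - W x‖ + ‖(u x, Du x) - W x‖ := by
        have := norm_sub_le_norm_sub_add_norm_sub (uj j x, Duj j x) (W x) (u x, Du x)
        rw [norm_sub_rev (W x)] at this
        rcases le_total 1 ‖(uj j x, Duj j x) - W x‖ with h | h
        · rw [min_eq_left h]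
          exact (min_le_left _ _).trans (le_add_of_nonneg_right (norm_nonneg _))
        · rw [min_eq_right h]
          exact (min_le_right _ _).trans this
      -- `t ≤ a b t + (1 - a) + (1 - b)` for `a, b, t ∈ [0, 1]`
      have h6 : min 1 ‖(uj j x, Duj j x) - W x‖
          ≤ η x * graphCutoff R δ (uj j x, Duj j x) * min 1 ‖(uj j x, Duj j x) - W x‖
            + (1 - η x) + (1 - graphCutoff R δ (uj j x, Duj j x)) := by
        nlinarith [mul_nonneg (sub_nonneg.2 h3.2) (sub_nonneg.2 h1.2),
          mul_nonneg (mul_nonneg h1.1 (sub_nonneg.2 h3.2)) (sub_nonneg.2 h2.2),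
          mul_nonneg (sub_nonneg.2 h1.2) (sub_nonneg.2 h2.2)]
      simp only
      linarith
    rw [integral_add hsum₂ hVW, integral_add hsum₁ hχint, integral_add (hcm _ (hVj j)) hηint]
      at hmain
    linarith
  refine tendsto_order.2 ⟨fun a ha => Eventually.of_forall fun j =>
    ha.trans_le (integral_nonneg fun x => le_min zero_le_one (norm_nonneg _)), fun a ha => ?_⟩
  filter_upwards [key (a / 10) (by positivity)] with j hj
  linarith

/-! ### Strong convergence below the critical exponent and the Young measure -/

/-- On a finite measure space an `L^p`-bounded sequence that tends to `0` in measure tends to `0`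
in `L^q` for `q < p`. -/
lemma tendsto_eLpNorm_of_tendsto_integral_min {α F : Type*} [MeasurableSpace α] {μ : Measure α}
    [IsFiniteMeasure μ] [NormedAddCommGroup F] {p q : ℝ} (hq : 1 ≤ q) (hqp : q < p)
    {d : ℕ → α → F} (hd : ∀ j, AEStronglyMeasurable (d j) μ) {C : ℝ≥0∞} (hC : C ≠ ⊤)
    (hdC : ∀ j, eLpNorm (d j) (ENNReal.ofReal p) μ ≤ C)
    (h : Tendsto (fun j => ∫ x, min 1 ‖d j x‖ ∂μ) atTop (𝓝 0)) :
    Tendsto (fun j => eLpNorm (d j) (ENNReal.ofReal q) μ) atTop (𝓝 0) := by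
  have hq0 : 0 < q := by linarith
  have hp0 : 0 < p := by linarith
  have hCp : C ^ p ≠ ⊤ := ENNReal.rpow_ne_top_of_nonneg hp0.le hC
  have hdp : ∀ j, ∫⁻ x, ENNReal.ofReal (‖d j x‖ ^ p) ∂μ ≤ C ^ p := by
    intro j
    have h1 := hdC j
    rw [eLpNorm_eq_lintegral_rpow_enorm_toReal (by simpa using hp0) ENNReal.ofReal_ne_top,
      ENNReal.toReal_ofReal hp0.le, one_div, ENNReal.rpow_inv_le_iff hp0] at h1
    refine (lintegral_congr fun x => ?_).le.trans h1
    rw [← ENNReal.ofReal_rpow_of_nonneg (norm_nonneg _) hp0.le, ofReal_norm]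
  -- large values are controlled by the `p`-th power, the others by `min 1 ‖d‖`
  have hpt : ∀ K : ℝ, 1 ≤ K → ∀ t : ℝ, 0 ≤ t →
      t ^ q ≤ K ^ q * min 1 t + K ^ (-(p - q)) * t ^ p := by
    intro K hK t ht
    have hK0 : 0 < K := by linarith
    have hnn : 0 ≤ K ^ (-(p - q)) * t ^ p := by positivity
    rcases le_or_gt t K with h1 | h1
    · refine le_add_of_le_of_nonneg ?_ hnn
      rcases le_total 1 t with h2 | h2
      · rw [min_eq_left h2, mul_one]
        exact Real.rpow_le_rpow ht h1 hq0.le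
      · rw [min_eq_right h2]
        have h3 : t ^ q ≤ t := by
          rcases ht.eq_or_lt with h0 | h0
          · rw [← h0, Real.zero_rpow hq0.ne']
          · simpa using Real.rpow_le_rpow_of_exponent_ge h0 h2 hq
        exact h3.trans (le_mul_of_one_le_left ht (Real.one_le_rpow hK hq0.le))
    · refine le_add_of_nonneg_of_le (mul_nonneg (by positivity) (le_min zero_le_one ht)) ?_
      have ht0 : 0 < t := hK0.trans h1
      have h2 : t ^ q = t ^ (-(p - q)) * t ^ p := by
        rw [← Real.rpow_add ht0]
        congr 1
        ring
      rw [h2]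
      exact mul_le_mul_of_nonneg_right
        (Real.rpow_le_rpow_of_nonpos hK0 h1.le (by linarith)) (by positivity)
  have hlin : Tendsto (fun j => ∫⁻ x, ‖d j x‖ₑ ^ q ∂μ) atTop (𝓝 0) := by
    refine ENNReal.tendsto_nhds_zero.2 fun ε hε => ?_
    have hK : Tendsto (fun K : ℝ => ENNReal.ofReal (K ^ (-(p - q))) * C ^ p) atTop (𝓝 0) := by
      have := ENNReal.Tendsto.mul_const (ENNReal.tendsto_ofReal
        (tendsto_rpow_neg_atTop (sub_pos.2 hqp))) (Or.inr hCp)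
      simpa using this
    have hε2 : 0 < ε / 2 := ENNReal.half_pos hε.ne'
    obtain ⟨K, hK1, hKε⟩ := ((eventually_ge_atTop (1 : ℝ)).and
      (ENNReal.tendsto_nhds_zero.1 hK _ hε2)).exists
    have hmin : Tendsto (fun j => ENNReal.ofReal (K ^ q) *
        ENNReal.ofReal (∫ x, min 1 ‖d j x‖ ∂μ)) atTop (𝓝 0) := by
      have := ENNReal.Tendsto.const_mul (ENNReal.tendsto_ofReal h)
        (Or.inr (ENNReal.ofReal_ne_top (r := K ^ q)))
      simpa using this
    filter_upwards [ENNReal.tendsto_nhds_zero.1 hmin _ hε2] with j hj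
    have hmeas : AEMeasurable (fun x => ENNReal.ofReal (K ^ q) * ENNReal.ofReal (min 1 ‖d j x‖)) μ :=
      ((aemeasurable_const.min (hd j).norm.aemeasurable).ennreal_ofReal).const_mul _
    have hint : Integrable (fun x => min 1 ‖d j x‖) μ :=
      integrable_of_mem_Icc ((continuous_const.min continuous_id).comp_aestronglyMeasurable
        (hd j).norm) fun x => ⟨le_min zero_le_one (norm_nonneg _), min_le_left _ _⟩
    calc ∫⁻ x, ‖d j x‖ₑ ^ q ∂μ
        ≤ ∫⁻ x, (ENNReal.ofReal (K ^ q) * ENNReal.ofReal (min 1 ‖d j x‖)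
          + ENNReal.ofReal (K ^ (-(p - q))) * ENNReal.ofReal (‖d j x‖ ^ p)) ∂μ := by
          refine lintegral_mono fun x => ?_
          have hK0 : 0 < K := by linarith
          rw [← ofReal_norm, ENNReal.ofReal_rpow_of_nonneg (norm_nonneg _) hq0.le,
            ← ENNReal.ofReal_mul (by positivity), ← ENNReal.ofReal_mul (by positivity),
            ← ENNReal.ofReal_add (mul_nonneg (by positivity) (le_min zero_le_one (norm_nonneg _)))
              (by positivity)]
          exact ENNReal.ofReal_le_ofReal (hpt K hK1 _ (norm_nonneg _))
      _ = ENNReal.ofReal (K ^ q) * ENNReal.ofReal (∫ x, min 1 ‖d j x‖ ∂μ)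
          + ENNReal.ofReal (K ^ (-(p - q))) * ∫⁻ x, ENNReal.ofReal (‖d j x‖ ^ p) ∂μ := by
          rw [lintegral_add_left' hmeas, lintegral_const_mul' _ _ ENNReal.ofReal_ne_top,
            lintegral_const_mul' _ _ ENNReal.ofReal_ne_top, ofReal_integral_eq_lintegral_ofReal hint
            (ae_of_all _ fun x => le_min zero_le_one (norm_nonneg _))]
      _ ≤ ε / 2 + ε / 2 := add_le_add hj ((mul_le_mul_right (hdp j) _).trans hKε)
      _ = ε := ENNReal.add_halves ε
  have := ((ENNReal.continuous_rpow_const (y := 1 / q)).tendsto 0).comp hlin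
  rw [ENNReal.zero_rpow_of_pos (by positivity)] at this
  refine this.congr fun j => ?_
  rw [Function.comp_apply, eLpNorm_eq_lintegral_rpow_enorm_toReal (by simpa using hq0)
    ENNReal.ofReal_ne_top, ENNReal.toReal_ofReal hq0.le]

lemma abs_min_one_norm_sub_le {F : Type*} [NormedAddCommGroup F] (a b c : F) :
    |min 1 ‖a - c‖ - min 1 ‖b - c‖| ≤ min 1 ‖a - b‖ := by
  have h1 := abs_norm_sub_norm_le (a - c) (b - c)
  rw [sub_sub_sub_cancel_right] at h1
  refine le_min ?_ ((abs_min_sub_min_le_max _ _ _ _).trans (max_le (by simp) h1))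
  have h2 := min_le_left 1 ‖a - c‖
  have h3 := min_le_left 1 ‖b - c‖
  have h4 : 0 ≤ min 1 ‖a - c‖ := le_min zero_le_one (norm_nonneg _)
  have h5 : 0 ≤ min 1 ‖b - c‖ := le_min zero_le_one (norm_nonneg _)
  rw [abs_le]
  constructor <;> linarith

/-- A probability measure whose integrals of `min(1, |Λ - a|)`, for `a` in a dense sequence,
agree with those of the Dirac mass at `L` is this Dirac mass. -/
lemma eq_dirac_of_integral_min {F : Type*} [NormedAddCommGroup F] [MeasurableSpace F]
    [BorelSpace F] {ν : Measure F} [IsProbabilityMeasure ν] {a : ℕ → F}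
    (ha : DenseRange a) {L : F}
    (h : ∀ i, ∫ Λ, min 1 ‖Λ - a i‖ ∂ν = min 1 ‖L - a i‖) : ν = Measure.dirac L := by
  have hint : ∀ b : F, Integrable (fun Λ => min 1 ‖Λ - b‖) ν := fun b =>
    integrable_of_mem_Icc
      (by fun_prop : Continuous fun Λ : F => min 1 ‖Λ - b‖).aestronglyMeasurable fun x =>
      ⟨le_min zero_le_one (norm_nonneg _), min_le_left _ _⟩
  have h0 : ∫ Λ, min 1 ‖Λ - L‖ ∂ν = 0 := by
    refine le_antisymm (le_of_forall_pos_le_add fun ε hε => ?_)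
      (integral_nonneg fun x => le_min zero_le_one (norm_nonneg _))
    obtain ⟨i, hi⟩ := ha.exists_dist_lt L (half_pos hε)
    rw [dist_eq_norm] at hi
    have h1 : ∫ Λ, min 1 ‖Λ - L‖ ∂ν ≤ ∫ Λ, (min 1 ‖Λ - a i‖ + ‖L - a i‖) ∂ν := by
      refine integral_mono (hint L) ((hint (a i)).add (integrable_const _)) fun Λ => ?_
      have := norm_sub_le_norm_sub_add_norm_sub Λ (a i) L
      rw [norm_sub_rev (a i)] at this
      simp only
      rcases le_total 1 ‖Λ - a i‖ with h | h
      · rw [min_eq_left h]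
        exact (min_le_left _ _).trans (le_add_of_nonneg_right (norm_nonneg _))
      · rw [min_eq_right h]
        exact (min_le_right _ _).trans this
    rw [integral_add (hint _) (integrable_const _), h i] at h1
    have h2 := min_le_right 1 ‖L - a i‖
    simp only [integral_const, probReal_univ, smul_eq_mul, one_mul] at h1
    linarith
  rw [integral_eq_zero_iff_of_nonneg (fun x => le_min zero_le_one (norm_nonneg _)) (hint L)] at h0
  have h1 : ∀ᵐ Λ ∂ν, Λ = L := by
    filter_upwards [h0] with Λ hΛ
    rcases min_eq_iff.1 hΛ with h | h
    · exact absurd h.1 one_ne_zero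
    · exact sub_eq_zero.1 (norm_eq_zero.1 h.1)
  refine Measure.ext fun s hs => ?_
  by_cases hL : L ∈ s
  · rw [Measure.dirac_apply' _ hs, indicator_of_mem hL, Pi.one_apply, ← prob_compl_eq_zero_iff hs]
    exact measure_mono_null (fun Λ hΛ (h : Λ = L) => hΛ (h ▸ hL)) h1
  · rw [Measure.dirac_apply' _ hs, indicator_of_notMem hL]
    exact measure_mono_null (fun Λ hΛ (h : Λ = L) => hL (h ▸ hΛ)) h1

/-- The Young measure generated by a sequence that converges in measure is concentrated at the
limit: testing with `min(1, |Λ - a|)` determines it. -/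
lemma GeneratesYoungMeasure.ae_eq_dirac {Ω : Set (E m)} (hΩ : IsOpen Ω)
    (hΩb : Bornology.IsBounded Ω) {F : Type*} [NormedAddCommGroup F]
    [MeasurableSpace F] [BorelSpace F] [SecondCountableTopology F] {p : ℝ} (hp : 1 < p)
    {v : ℕ → E m → F} {w : E m → F} {ν : E m → Measure F}
    (hv : ∀ j, AEStronglyMeasurable (v j) (volume.restrict Ω))
    (hw : AEStronglyMeasurable w (volume.restrict Ω))
    (hν : GeneratesYoungMeasure Ω p v ν)
    (h : Tendsto (fun j => ∫ x in Ω, min 1 ‖v j x - w x‖) atTop (𝓝 0)) :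
    ∀ᵐ x ∂(volume.restrict Ω), ν x = Measure.dirac (w x) := by
  have hfin := isFiniteMeasure_restrict hΩb
  obtain ⟨-, hprob, hν⟩ := hν
  have hcont : ∀ a : F, Continuous fun Λ : F => min 1 ‖Λ - a‖ := fun a => by fun_prop
  have hmem : ∀ b : F, min 1 ‖b‖ ∈ Icc (0 : ℝ) 1 := fun b =>
    ⟨le_min zero_le_one (norm_nonneg _), min_le_left _ _⟩
  have hkey : ∀ a : F, ∀ᵐ x ∂(volume.restrict Ω),
      ∫ Λ, min 1 ‖Λ - a‖ ∂(ν x) = min 1 ‖w x - a‖ := by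
    intro a
    obtain ⟨-, hint, hlim⟩ := hν (fun Λ => min 1 ‖Λ - a‖) (hcont a) ⟨1, 1, le_rfl, hp, fun Λ => by
      rw [abs_of_nonneg (hmem _).1, Real.rpow_one, one_mul]
      exact (hmem _).2.trans (le_add_of_nonneg_right (norm_nonneg _))⟩
    have hwa : Integrable (fun x => min 1 ‖w x - a‖) (volume.restrict Ω) :=
      integrable_of_mem_Icc ((hcont a).comp_aestronglyMeasurable hw) fun x => hmem _
    have hva : ∀ j, Integrable (fun x => min 1 ‖v j x - a‖) (volume.restrict Ω) := fun j =>
      integrable_of_mem_Icc ((hcont a).comp_aestronglyMeasurable (hv j)) fun x => hmem _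
    have hvw : ∀ j, Integrable (fun x => min 1 ‖v j x - w x‖) (volume.restrict Ω) := fun j =>
      integrable_of_mem_Icc ((continuous_const.min continuous_id).comp_aestronglyMeasurable
        ((hv j).sub hw).norm) fun x => hmem _
    have hzero : ∀ᵐ x, x ∈ Ω → (∫ Λ, min 1 ‖Λ - a‖ ∂(ν x)) - min 1 ‖w x - a‖ = 0 := by
      refine hΩ.ae_eq_zero_of_integral_contDiff_smul_eq_zero
        (IntegrableOn.locallyIntegrableOn (hint.sub hwa)) fun η hη hηc hηΩ => ?_
      have hηt : IsTestFunction Ω η := ⟨hη, hηc, hηΩ⟩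
      obtain ⟨C, hC⟩ := hηt.exists_bound
      have hmul : ∀ g : E m → ℝ, Integrable g (volume.restrict Ω) →
          Integrable (fun x => g x * η x) (volume.restrict Ω) := fun g hg =>
        hg.mul_bdd (c := C) hη.continuous.aestronglyMeasurable (ae_of_all _ hC)
      have hlim2 : Tendsto (fun j => ∫ x in Ω, min 1 ‖v j x - a‖ * η x) atTop
          (𝓝 (∫ x in Ω, min 1 ‖w x - a‖ * η x)) := by
        rw [tendsto_iff_norm_sub_tendsto_zero]
        have h1 := h.const_mul C
        rw [mul_zero] at h1
        refine squeeze_zero (fun j => norm_nonneg _) (fun j => ?_) h1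
        rw [← integral_sub (hmul _ (hva j)) (hmul _ hwa), ← integral_const_mul]
        refine norm_integral_le_of_norm_le ((hvw j).const_mul C) (ae_of_all _ fun x => ?_)
        rw [← sub_mul, norm_mul, mul_comm]
        exact mul_le_mul (hC x) (abs_min_one_norm_sub_le _ _ _) (norm_nonneg _)
          ((norm_nonneg _).trans (hC x))
      have heq := tendsto_nhds_unique (hlim η hηt) hlim2
      have hsupp : ∫ x, η x • ((∫ Λ, min 1 ‖Λ - a‖ ∂(ν x)) - min 1 ‖w x - a‖)
          = ∫ x in Ω, η x • ((∫ Λ, min 1 ‖Λ - a‖ ∂(ν x)) - min 1 ‖w x - a‖) := by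
        refine (setIntegral_eq_integral_of_forall_compl_eq_zero fun x hx => ?_).symm
        rw [image_eq_zero_of_notMem_tsupport fun h => hx (hηΩ h), zero_smul]
      rw [hsupp]
      have : ∀ x, η x • ((∫ Λ, min 1 ‖Λ - a‖ ∂(ν x)) - min 1 ‖w x - a‖)
          = (∫ Λ, min 1 ‖Λ - a‖ ∂(ν x)) * η x - min 1 ‖w x - a‖ * η x := fun x => by
        rw [smul_eq_mul]; ring
      simp_rw [this]
      rw [integral_sub (hmul _ hint) (hmul _ hwa), heq, sub_self]
    exact (ae_restrict_iff' hΩ.measurableSet).2 (hzero.mono fun x hx hxΩ => sub_eq_zero.1 (hx hxΩ))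
  filter_upwards [hprob, ae_all_iff.2 fun i => hkey (TopologicalSpace.denseSeq F i)] with x hx hx2
  exact eq_dirac_of_integral_min (TopologicalSpace.denseRange_denseSeq F) hx2

lemma MemSobolev.mono_exponent {Ω : Set (E m)} (hΩb : Bornology.IsBounded Ω) {p q : ℝ≥0∞}
    (hqp : q ≤ p) {u : E m → E n} {Du : E m → E m →L[ℝ] E n} (h : MemSobolev Ω p u Du) :
    MemSobolev Ω q u Du := by
  have hfin := isFiniteMeasure_restrict hΩb
  exact ⟨h.1.mono_exponent hqp, h.2.1.mono_exponent hqp, h.2.2⟩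

/-- An `L^p`-bounded sequence of integrable maps is `L¹`-bounded on a finite measure space. -/
lemma exists_integral_norm_bound {α F : Type*} [MeasurableSpace α] {μ : Measure α}
    [IsFiniteMeasure μ] [NormedAddCommGroup F] {p : ℝ≥0∞} (hp : 1 ≤ p) {d : ℕ → α → F}
    (hd : ∀ j, AEStronglyMeasurable (d j) μ) {C : ℝ≥0∞} (hC : C ≠ ⊤)
    (hdC : ∀ j, eLpNorm (d j) p μ ≤ C) : ∃ M : ℝ, ∀ j, ∫ x, ‖d j x‖ ∂μ ≤ M := by
  have hexp : 0 ≤ 1 / (1 : ℝ≥0∞).toReal - 1 / p.toReal := by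
    rcases eq_or_ne p ⊤ with rfl | hpt
    · simp
    · have : 1 ≤ p.toReal := by simpa using ENNReal.toReal_mono hpt hp
      rw [ENNReal.toReal_one, div_one, sub_nonneg, div_le_one (by linarith)]
      exact this
  set B := C * μ univ ^ (1 / (1 : ℝ≥0∞).toReal - 1 / p.toReal) with hB
  have hBt : B ≠ ⊤ := ENNReal.mul_ne_top hC
    (ENNReal.rpow_ne_top_of_nonneg hexp (measure_ne_top _ _))
  refine ⟨B.toReal, fun j => ?_⟩
  rw [integral_norm_eq_lintegral_enorm (hd j)]
  refine ENNReal.toReal_mono hBt ?_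
  rw [← eLpNorm_one_eq_lintegral_enorm]
  exact (eLpNorm_le_eLpNorm_mul_rpow_measure_univ hp (hd j)).trans (mul_le_mul_left (hdC j) _)

/-- Varifold convergence of the graphs improves weak convergence: the Young measure is Dirac and
the convergence is strong below the exponent `p`. -/
theorem WeakSobolevTendsto.dirac_and_strong {Ω : Set (E m)} (hΩ : IsOpen Ω)
    (hΩb : Bornology.IsBounded Ω) {p : ℝ} (hp : 1 < p) {uj : ℕ → E m → E n}
    {Duj : ℕ → E m → E m →L[ℝ] E n} {u : E m → E n} {Du : E m → E m →L[ℝ] E n}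
    {ν : E m → Measure (E m →L[ℝ] E n)} (h : WeakSobolevTendsto Ω p uj Duj u Du)
    (hν : GeneratesYoungMeasure Ω p Duj ν)
    (hvar : VarifoldTendsto (domainCylinder n Ω) (fun j => sobolevGraph Ω (uj j))
      (sobolevGraph Ω u)) :
    (∀ᵐ x ∂(volume.restrict Ω), ν x = Measure.dirac (Du x)) ∧
      ∀ q : ℝ, 1 ≤ q → q < p → StrongSobolevTendsto Ω (ENNReal.ofReal q) uj Duj u Du := by
  have hfin := isFiniteMeasure_restrict hΩb
  have hp1 : 1 ≤ ENNReal.ofReal p := by simpa using hp.le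
  obtain ⟨C, hC, hCj⟩ := h.exists_bound hp hΩb
  obtain ⟨hj, hu, -⟩ := h
  have hWj : ∀ j, IsW11 Ω (uj j) (Duj j) := fun j => (hj j).isW11 hΩb hp1
  have hWu : IsW11 Ω u Du := hu.isW11 hΩb hp1
  obtain ⟨M₁, hM₁⟩ := exists_integral_norm_bound hp1 (fun j => (hj j).1.1) hC fun j => (hCj j).1
  obtain ⟨M₂, hM₂⟩ := exists_integral_norm_bound hp1 (fun j => (hj j).2.1.1) hC fun j => (hCj j).2
  have hM : ∀ j, ∫ x in Ω, ‖(uj j x, Duj j x)‖ ≤ M₁ + M₂ := by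
    intro j
    have h1 : Integrable (fun x => ‖uj j x‖) (volume.restrict Ω) := (hWj j).int.norm
    have h2 : Integrable (fun x => ‖Duj j x‖) (volume.restrict Ω) := (hWj j).int_deriv.norm
    refine le_trans ?_ (add_le_add (hM₁ j) (hM₂ j))
    rw [← integral_add h1 h2]
    refine integral_mono ((hWj j).int.prodMk (hWj j).int_deriv).norm (h1.add h2) fun x => ?_
    exact max_le (le_add_of_nonneg_right (norm_nonneg _)) (le_add_of_nonneg_left (norm_nonneg _))
  have hmeas := tendsto_integral_min_of_varifoldTendsto hΩ hΩb hWj hWu hM hvar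
  have hmem : ∀ t : ℝ, 0 ≤ t → min 1 t ∈ Icc (0 : ℝ) 1 := fun t ht =>
    ⟨le_min zero_le_one ht, min_le_left _ _⟩
  have hpair : ∀ j, Integrable (fun x => min 1 ‖(uj j x, Duj j x) - (u x, Du x)‖)
      (volume.restrict Ω) := fun j =>
    integrable_of_mem_Icc ((continuous_const.min continuous_id).comp_aestronglyMeasurable
      (((hWj j).int.prodMk (hWj j).int_deriv).1.sub (hWu.int.prodMk hWu.int_deriv).1).norm)
      fun x => hmem _ (norm_nonneg _)
  have hmeas₁ : Tendsto (fun j => ∫ x in Ω, min 1 ‖uj j x - u x‖) atTop (𝓝 0) := by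
    refine squeeze_zero (fun j => integral_nonneg fun x => (hmem _ (norm_nonneg _)).1)
      (fun j => integral_mono (integrable_of_mem_Icc
        ((continuous_const.min continuous_id).comp_aestronglyMeasurable
          ((hWj j).int.1.sub hWu.int.1).norm) fun x => hmem _ (norm_nonneg _)) (hpair j)
        fun x => min_le_min_left _ ?_) hmeas
    exact norm_fst_le ((uj j x, Duj j x) - (u x, Du x))
  have hmeas₂ : Tendsto (fun j => ∫ x in Ω, min 1 ‖Duj j x - Du x‖) atTop (𝓝 0) := by
    refine squeeze_zero (fun j => integral_nonneg fun x => (hmem _ (norm_nonneg _)).1)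
      (fun j => integral_mono (integrable_of_mem_Icc
        ((continuous_const.min continuous_id).comp_aestronglyMeasurable
          ((hWj j).int_deriv.1.sub hWu.int_deriv.1).norm) fun x => hmem _ (norm_nonneg _))
        (hpair j) fun x => min_le_min_left _ ?_) hmeas
    exact norm_snd_le ((uj j x, Duj j x) - (u x, Du x))
  refine ⟨hν.ae_eq_dirac hΩ hΩb hp (fun j => (hj j).2.1.1) hu.2.1.1 hmeas₂, fun q hq hqp => ?_⟩
  have hqp' : ENNReal.ofReal q ≤ ENNReal.ofReal p := ENNReal.ofReal_le_ofReal hqp.le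
  refine ⟨fun j => (hj j).mono_exponent hΩb hqp', hu.mono_exponent hΩb hqp', ?_, ?_⟩
  · exact tendsto_eLpNorm_of_tendsto_integral_min hq hqp (fun j => (hj j).1.1.sub hu.1.1)
      (ENNReal.add_ne_top.2 ⟨hC, hu.1.2.ne⟩)
      (fun j => (eLpNorm_sub_le (hj j).1.1 hu.1.1 hp1).trans
        (add_le_add_left (hCj j).1 _)) hmeas₁
  · exact tendsto_eLpNorm_of_tendsto_integral_min hq hqp (fun j => (hj j).2.1.1.sub hu.2.1.1)
      (ENNReal.add_ne_top.2 ⟨hC, hu.2.1.2.ne⟩)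
      (fun j => (eLpNorm_sub_le (hj j).2.1.1 hu.2.1.1 hp1).trans
        (add_le_add_left (hCj j).2 _)) hmeas₂

end GraphVarifold

end

theorem mainTheorem6 (m n : ℕ) (hm : 0 < m) (Ω : Set (E m)) (hΩ : IsOpen Ω)
    (hΩb : Bornology.IsBounded Ω) :
    (∀ (p : ℝ), 1 < p →
      ∀ (uj : ℕ → E m → E n) (Duj : ℕ → E m → E m →L[ℝ] E n)
        (u : E m → E n) (Du : E m → E m →L[ℝ] E n) (ν : E m → Measure (E m →L[ℝ] E n)),
        WeakSobolevTendsto Ω p uj Duj u Du →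
        GeneratesYoungMeasure Ω p Duj ν →
        VarifoldTendsto (domainCylinder n Ω) (fun j => sobolevGraph Ω (uj j)) (sobolevGraph Ω u) →
        (∀ᵐ x ∂(volume.restrict Ω), ν x = Measure.dirac (Du x)) ∧
        ∀ q : ℝ, 1 ≤ q → q < p →
          StrongSobolevTendsto Ω (ENNReal.ofReal q) uj Duj u Du) ∧
    (∀ (uj : ℕ → E m → E n) (Duj : ℕ → E m → E m →L[ℝ] E n)
        (u : E m → E n) (Du : E m → E m →L[ℝ] E n),
        StrongSobolevTendsto Ω (m : ℝ≥0∞) uj Duj u Du →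
        ∃ φ : ℕ → ℕ, StrictMono φ ∧
          VarifoldTendsto (univ : Set (Amb m n)) (fun k => sobolevGraph Ω (uj (φ k))) (sobolevGraph Ω u)) := by
  exact ⟨fun p hp uj Duj u Du ν h hν hvar => h.dirac_and_strong hΩ hΩb hp hν hvar,
    fun uj Duj u Du h => h.exists_varifoldTendsto hm.ne' hΩ hΩb⟩
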